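/- Let $n\ge 0$ be an integer and $K\in\mathbb R$. There is a constant $C_0=C_0(n,K)$ with the following property. Let $M$ be a compact (Hausdorff) smooth manifold of dimension $m+n$ with a smooth foliation $\mathcal F$ of codimension $n$, tangent bundle $L\subset TM$ and normal bundle $Q=TM/L$, and let $\chi$ be a smooth $m$-form on $M$ that restricts to a volume form on the leaves and satisfies $\iota_X d\chi=0$ for every $X\in C^\infty(L)$. A transverse metric is a smooth metric $g_Q$ on the fibres of $Q$ with $\mathcal L_Xg_Q=0$ for every $X\in C^\infty(L)$; it has a transverse Levi-Civita connection $\nabla$ on $Q$, with curvature $R^\nabla$ and transverse Ricci tensor $\mathrm{Rc}_Q$. Let $T>0$ and let $g_Q(t)$, $\bar g_Q(t)$, $t\in[0,T]$, be two families of transverse metrics, smooth on $M\times[0,T]$, which solve the transverse Ricci flow $\partial_tg_Q=-2\,\mathrm{Rc}_Q$ on $[0,T]$ and satisfy $g_Q(0)=\bar g_Q(0)$. Suppose that on $M\times[0,T]$ $$|R^{\nabla}|_{g_Q},\ |\nabla R^{\nabla}|_{g_Q},\ |R^{\bar\nabla}|_{\bar g_Q},\ |\bar\nabla R^{\bar\nabla}|_{\bar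 g_Q}\ \le K,$$ where $\nabla$ and $\bar\nabla$ are the transverse Levi-Civita connections of $g_Q(t)$ and $\bar g_Q(t)$. Put $h=g_Q-\bar g_Q$, $A=\nabla-\bar\nabla$, $S=R^{\nabla}-R^{\bar\nabla}$ and $$\mathcal E(t)=\int_M\left(|h|^2+|A|^2+|S|^2\right)\chi\wedge d\mu ,$$ where the norms are taken with respect to $g_Q(t)$, $d\mu$ is the transverse volume form of $g_Q(t)$, and $M$ is oriented by $\chi\wedge d\mu$, i.e. the integral is taken against the measure with density $|\chi(\partial_{x^1},\dots,\partial_{x^m})|\sqrt{\det g_Q(\partial_{y^i},\partial_{y^j})}$ in foliated coordinates $(x,y)$, the leaves being given by $y=\mathrm{const}$. Then the integrand is integrable for every $t\in[0,T]$, $\mathcal E$ is differentiable on $[0,T]$ (one-sidedly at the end points), and $$\mathcal E'(t)\le C_0\,\mathcal E(t)\qquad\text{for all }t\in[0,T].$$ Consequently $\mathcal E(t)=0$ and $g_Q(t)=\bar g_Q(t)$ for all $t\in[0,T]$. -/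

import Mathlib

open Set MeasureTheory
open scoped Manifold ContDiff Topology

noncomputable section

namespace TransverseRicci

/-! ### Foliated manifolds -/

/-- The model `ℝ^m × ℝ^n` of a foliated manifold of leaf dimension `m` and codimension `n`; a point
is written `(x, y)`, and the leaves of the model are the slices `y = const`. -/
abbrev Model (m n : ℕ) : Type := (Fin m → ℝ) × (Fin n → ℝ)

/-- Smooth maps whose differential sends vectors tangent to the slices `y = const` to vectors
tangent to such slices; equivalently, locally `(x, y) ↦ (a (x, y), b y)`. -/
def foliationPregroupoid (m n : ℕ) : Pregroupoid (Model m n) where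
  property f s := ContDiffOn ℝ ∞ f s ∧ ∀ z ∈ s, ∀ u : Fin m → ℝ, (fderiv ℝ f z (u, 0)).2 = 0
  comp {f g u v} hf hg hu hv _ := by
    refine ⟨hg.1.comp (hf.1.mono inter_subset_left) fun z hz => hz.2, fun z hz a => ?_⟩
    have hdf : DifferentiableAt ℝ f z :=
      (hf.1.differentiableOn (by simp) z hz.1).differentiableAt (hu.mem_nhds hz.1)
    have hdg : DifferentiableAt ℝ g (f z) :=
      (hg.1.differentiableOn (by simp) (f z) hz.2).differentiableAt (hv.mem_nhds hz.2)
    rw [fderiv_comp z hdg hdf]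
    have h1 := hf.2 z hz.1 a
    have h2 := hg.2 (f z) hz.2 (fderiv ℝ f z (a, 0)).1
    have h3 : ((fderiv ℝ f z (a, 0)).1, (0 : Fin n → ℝ)) = fderiv ℝ f z (a, 0) :=
      Prod.ext rfl h1.symm
    rw [h3] at h2
    simpa using h2
  id_mem := ⟨contDiff_id.contDiffOn, fun z _ a => by simp⟩
  locality {f u} hu H := by
    refine ⟨fun z hz => ?_, fun z hz a => ?_⟩
    · obtain ⟨v, hv, hzv, h⟩ := H z hz
      exact ((h.1 z ⟨hz, hzv⟩).contDiffAt ((hu.inter hv).mem_nhds ⟨hz, hzv⟩)).contDiffWithinAt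
    · obtain ⟨v, hv, hzv, h⟩ := H z hz
      exact h.2 z ⟨hz, hzv⟩ a
  congr {f g u} hu hfg hf := by
    refine ⟨hf.1.congr hfg, fun z hz a => ?_⟩
    have : g =ᶠ[𝓝 z] f := Filter.eventually_of_mem (hu.mem_nhds hz) hfg
    rw [this.fderiv_eq]
    exact hf.2 z hz a

/-- The groupoid of local diffeomorphisms of `ℝ^m × ℝ^n` preserving the foliation by the slices
`y = const`. A smooth manifold with a smooth foliation of leaf dimension `m` and codimension `n` is
a space `M` with an atlas of foliated charts, i.e. charts with changes of coordinates in this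
groupoid: `[ChartedSpace (Model m n) M] [HasGroupoid M (foliationGroupoid m n)]`. -/
def foliationGroupoid (m n : ℕ) : StructureGroupoid (Model m n) :=
  (foliationPregroupoid m n).groupoid

variable {m n : ℕ} {M : Type*} [TopologicalSpace M] [ChartedSpace (Model m n) M]

/-- The tangent space `T_p M`. -/
abbrev TSpace (m n : ℕ) {M : Type*} [TopologicalSpace M] [ChartedSpace (Model m n) M] (p : M) :
    Type :=
  TangentSpace 𝓘(ℝ, Model m n) p

/-- The fibre `L_p` of the tangent bundle of the foliation. The tangent space at `p` is identified
with the model through the preferred (foliated) chart at `p`. -/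
def leafTangent (m n : ℕ) {M : Type*} [TopologicalSpace M] [ChartedSpace (Model m n) M] (p : M) :
    Submodule ℝ (TSpace m n p) :=
  LinearMap.ker (LinearMap.snd ℝ (Fin m → ℝ) (Fin n → ℝ))

/-- A field of bilinear forms on `TM`. -/
abbrev BilinField (m n : ℕ) (M : Type*) [TopologicalSpace M] [ChartedSpace (Model m n) M] :
    Type _ :=
  ∀ p : M, TSpace m n p →L[ℝ] TSpace m n p →L[ℝ] ℝ

/-- A field of alternating forms of degree `m` (the leaf dimension) on `TM`. -/
abbrev LeafFormField (m n : ℕ) (M : Type*) [TopologicalSpace M] [ChartedSpace (Model m n) M] :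
    Type _ :=
  ∀ p : M, TSpace m n p [⋀^Fin m]→L[ℝ] ℝ

/-- The differential at `z` of the inverse of the chart `e`. -/
def chartSymmDeriv (e : OpenPartialHomeomorph M (Model m n)) (z : Model m n) :
    Model m n →L[ℝ] TSpace m n (e.symm z) :=
  mfderiv 𝓘(ℝ, Model m n) 𝓘(ℝ, Model m n) e.symm z

/-- A field of bilinear forms read in the chart `e`, evaluated at the vectors `u, v`. -/
def bilinIn (e : OpenPartialHomeomorph M (Model m n)) (g : BilinField m n M) (z : Model m n)
    (u v : Model m n) : ℝ :=
  g (e.symm z) (chartSymmDeriv e z u) (chartSymmDeriv e z v)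

/-- An `m`-form read in the chart `e`. -/
def formIn (e : OpenPartialHomeomorph M (Model m n)) (χ : LeafFormField m n M) (z : Model m n) :
    Model m n [⋀^Fin m]→L[ℝ] ℝ :=
  (χ (e.symm z)).compContinuousLinearMap (chartSymmDeriv e z)

/-- The leafwise coordinate vector `∂/∂x^a`. -/
def dx (m n : ℕ) (a : Fin m) : Model m n := (Pi.single a 1, 0)

/-- The transverse coordinate vector `∂/∂y^i`. -/
def dy (m n : ℕ) (i : Fin n) : Model m n := (0, Pi.single i 1)

/-- A transverse metric: a smooth metric on the fibres of `Q = TM/L`, regarded as a symmetric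
2-tensor on `M` that is positive semidefinite with kernel `L`, and holonomy invariant:
`ℒ_X g = 0` for all sections `X` of `L`. -/
structure IsTransverseMetric (g : BilinField m n M) : Prop where
  symm : ∀ p u v, g p u v = g p v u
  leaf : ∀ p, ∀ u ∈ leafTangent m n p, ∀ v, g p u v = 0
  pos : ∀ p, ∀ v ∉ leafTangent m n p, 0 < g p v v
  smooth : ∀ e ∈ atlas (Model m n) M, ∀ u v : Model m n,
    ContDiffOn ℝ ∞ (fun z => bilinIn e g z u v) e.target
  /-- The Lie derivative in a foliated chart,
  `(ℒ_X g)(u, v) = X (g (u, v)) + g (DX u, v) + g (u, DX v)` for constant `u, v`. -/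
  holonomy : ∀ e ∈ atlas (Model m n) M, ∀ X : Model m n → Model m n,
    ContDiffOn ℝ ∞ X e.target → (∀ z ∈ e.target, (X z).2 = 0) →
    ∀ z ∈ e.target, ∀ u v : Model m n,
      fderiv ℝ (fun w => bilinIn e g w u v) z (X z)
        + bilinIn e g z (fderiv ℝ X z u) v + bilinIn e g z u (fderiv ℝ X z v) = 0

/-- A smooth `m`-form `χ` restricting to a volume form on the leaves and with `ι_X dχ = 0` for every
`X` tangent to the foliation. -/
structure IsHomologicalOrientation (χ : LeafFormField m n M) : Prop where
  smooth : ∀ e ∈ atlas (Model m n) M, ContDiffOn ℝ ∞ (formIn e χ) e.target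
  volume_leaf : ∀ (p : M) (v : Fin m → TSpace m n p), LinearIndependent ℝ v →
    (∀ a, v a ∈ leafTangent m n p) → χ p v ≠ 0
  contract_d : ∀ e ∈ atlas (Model m n) M, ∀ z ∈ e.target, ∀ v : Fin (m + 1) → Model m n,
    (v 0).2 = 0 → extDeriv (formIn e χ) z v = 0

/-! ### Transverse Levi-Civita connection and curvature in foliated coordinates

Here `G` is the matrix `g_{ij} = g_Q (V_i, V_j)` of the transverse metric with respect to the frame
`V_i = π (∂/∂y^i)` of `Q`, as a function on the image of a foliated chart. -/

/-- The matrix `g_{ij}` in the chart `e`. -/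
def metricIn (e : OpenPartialHomeomorph M (Model m n)) (g : BilinField m n M) (z : Model m n) :
    Matrix (Fin n) (Fin n) ℝ :=
  Matrix.of fun i j => bilinIn e g z (dy m n i) (dy m n j)

/-- `∂f/∂y^i`. -/
def pd (i : Fin n) (f : Model m n → ℝ) (z : Model m n) : ℝ := fderiv ℝ f z (dy m n i)

/-- `Γ^k_{ij}`, where `∇_{∂/∂y^i} V_j = Γ^k_{ij} V_k` for the transverse Levi-Civita connection. -/
def christoffel (G : Model m n → Matrix (Fin n) (Fin n) ℝ) (z : Model m n) (k i j : Fin n) : ℝ :=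
  (1 / 2) * ∑ l, (G z)⁻¹ k l *
    (pd i (fun w => G w j l) z + pd j (fun w => G w i l) z - pd l (fun w => G w i j) z)

/-- `R_{ijk}^l`, where `R(∂/∂y^i, ∂/∂y^j) V_k = R_{ijk}^l V_l` and
`R(X, Y) = ∇_X ∇_Y - ∇_Y ∇_X - ∇_[X,Y]`. -/
def riemann (G : Model m n → Matrix (Fin n) (Fin n) ℝ) (z : Model m n) (i j k l : Fin n) : ℝ :=
  pd i (fun w => christoffel G w l j k) z - pd j (fun w => christoffel G w l i k) z
    + ∑ p, (christoffel G z p j k * christoffel G z l i p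
      - christoffel G z p i k * christoffel G z l j p)

/-- The transverse Ricci curvature `Rc(V_i, V_j) = g^{kl} g (R(∂/∂y^i, ∂/∂y^k) V_l, V_j)`. -/
def ricci (G : Model m n → Matrix (Fin n) (Fin n) ℝ) (z : Model m n) (i j : Fin n) : ℝ :=
  ∑ k, ∑ l, ∑ r, (G z)⁻¹ k l * riemann G z i k l r * G z r j

/-- The covariant derivative `∇_a R_{ijk}^l` of the transverse curvature. -/
def nablaRiemann (G : Model m n → Matrix (Fin n) (Fin n) ℝ) (z : Model m n)
    (a i j k l : Fin n) : ℝ :=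
  pd a (fun w => riemann G w i j k l) z
    - ∑ p, christoffel G z p a i * riemann G z p j k l
    - ∑ p, christoffel G z p a j * riemann G z i p k l
    - ∑ p, christoffel G z p a k * riemann G z i j p l
    + ∑ p, christoffel G z l a p * riemann G z i j k p

/-- Squared norm, with respect to the scalar product `G`, of a covariant tensor of degree `r`:
`G^{i₁ j₁} ⋯ G^{i_r j_r} S_{i₁ … i_r} S_{j₁ … j_r}`. -/
def covNormSq {r : ℕ} (G : Matrix (Fin n) (Fin n) ℝ) (S : (Fin r → Fin n) → ℝ) : ℝ :=
  ∑ I, ∑ J, (∏ a, G⁻¹ (I a) (J a)) * S I * S J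

/-- Squared norm, with respect to the scalar product `G`, of a tensor with `r` lower indices and one
upper index: `G^{i₁ j₁} ⋯ G^{i_r j_r} G_{kl} S_{i₁ … i_r}^k S_{j₁ … j_r}^l`. -/
def mixNormSq {r : ℕ} (G : Matrix (Fin n) (Fin n) ℝ) (S : (Fin r → Fin n) → Fin n → ℝ) : ℝ :=
  ∑ I, ∑ J, ∑ k, ∑ l, (∏ a, G⁻¹ (I a) (J a)) * G k l * S I k * S J l

/-! ### Norms as functions on `M`

The norms do not depend on the chart; they are computed in the preferred chart at the point. -/

/-- The matrix function `g_{ij}` in the preferred chart at `p`. -/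
def metricAt (g : BilinField m n M) (p : M) : Model m n → Matrix (Fin n) (Fin n) ℝ :=
  metricIn (chartAt (Model m n) p) g

/-- The coordinates of `p` in the preferred chart at `p`. -/
def coordAt (m n : ℕ) {M : Type*} [TopologicalSpace M] [ChartedSpace (Model m n) M] (p : M) :
    Model m n :=
  chartAt (Model m n) p p

/-- `|R|_g` for the transverse curvature `R` of `g`. -/
def curvatureNorm (g : BilinField m n M) (p : M) : ℝ :=
  Real.sqrt (mixNormSq (metricAt g p (coordAt m n p)) fun (I : Fin 3 → Fin n) l =>
    riemann (metricAt g p) (coordAt m n p) (I 0) (I 1) (I 2) l)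

/-- `|∇R|_g` for the transverse curvature `R` and the transverse Levi-Civita connection of `g`. -/
def nablaCurvatureNorm (g : BilinField m n M) (p : M) : ℝ :=
  Real.sqrt (mixNormSq (metricAt g p (coordAt m n p)) fun (I : Fin 4 → Fin n) l =>
    nablaRiemann (metricAt g p) (coordAt m n p) (I 0) (I 1) (I 2) (I 3) l)

/-- `|h|²` with respect to `g`, where `h = g - g'`. -/
def hNormSq (g g' : BilinField m n M) (p : M) : ℝ :=
  covNormSq (metricAt g p (coordAt m n p)) fun (I : Fin 2 → Fin n) =>
    metricAt g p (coordAt m n p) (I 0) (I 1) - metricAt g' p (coordAt m n p) (I 0) (I 1)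

/-- `|A|²` with respect to `g`, where `A = ∇ - ∇'` is the difference of the transverse Levi-Civita
connections of `g` and `g'`. -/
def aNormSq (g g' : BilinField m n M) (p : M) : ℝ :=
  mixNormSq (metricAt g p (coordAt m n p)) fun (I : Fin 2 → Fin n) k =>
    christoffel (metricAt g p) (coordAt m n p) k (I 0) (I 1)
      - christoffel (metricAt g' p) (coordAt m n p) k (I 0) (I 1)

/-- `|S|²` with respect to `g`, where `S = R - R'` is the difference of the transverse curvatures of
`g` and `g'`. -/
def sNormSq (g g' : BilinField m n M) (p : M) : ℝ :=
  mixNormSq (metricAt g p (coordAt m n p)) fun (I : Fin 3 → Fin n) l =>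
    riemann (metricAt g p) (coordAt m n p) (I 0) (I 1) (I 2) l
      - riemann (metricAt g' p) (coordAt m n p) (I 0) (I 1) (I 2) l

/-! ### Integration against `χ ∧ dμ` -/

/-- `|(χ ∧ dμ)(∂/∂x^1, …, ∂/∂x^m, ∂/∂y^1, …, ∂/∂y^n)|` in the chart `e`. Since the transverse volume
form `dμ` of `g` vanishes on `L`, this is `|χ(∂/∂x^1, …, ∂/∂x^m)| √det (g_{ij})`. -/
def volumeDensity (χ : LeafFormField m n M) (g : BilinField m n M)
    (e : OpenPartialHomeomorph M (Model m n)) (z : Model m n) : ℝ :=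
  |formIn e χ z (dx m n)| * Real.sqrt (metricIn e g z).det

/-- The measure given by `χ ∧ dμ` on the domain of the chart `e`. -/
def chartVolume [MeasurableSpace M] (χ : LeafFormField m n M) (g : BilinField m n M)
    (e : OpenPartialHomeomorph M (Model m n)) : Measure M :=
  ((volume.restrict e.target).withDensity
    fun z => ENNReal.ofReal (volumeDensity χ g e z)).map e.symm

/-- The measure on `M` given by the volume form `χ ∧ dμ`, where `M` is oriented by this form: the
smallest measure that dominates, for each chart of the atlas, the one on the domain of the chart.
(These local measures agree on overlaps, so its restriction to each chart domain is the local
one.) -/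
def volumeMeasure [MeasurableSpace M] (χ : LeafFormField m n M) (g : BilinField m n M) :
    Measure M :=
  ⨆ e ∈ atlas (Model m n) M, chartVolume χ g e

/-- The integrand `|h|² + |A|² + |S|²`. -/
def energyDensity (g g' : BilinField m n M) (p : M) : ℝ :=
  hNormSq g g' p + aNormSq g g' p + sNormSq g g' p

/-- The energy `ℰ(t) = ∫_M (|h|² + |A|² + |S|²) χ ∧ dμ`, with norms and `dμ` taken with respect to
`g t`. -/
def energy [MeasurableSpace M] (χ : LeafFormField m n M) (g g' : ℝ → BilinField m n M) (t : ℝ) :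
    ℝ :=
  ∫ p, energyDensity (g t) (g' t) p ∂(volumeMeasure χ (g t))

/-! ### The flow -/

/-- A smooth solution on `[0, T]` of the transverse Ricci flow `∂_t g = -2 Rc`. -/
structure IsTransverseRicciFlow (T : ℝ) (g : ℝ → BilinField m n M) : Prop where
  metric : ∀ t ∈ Icc 0 T, IsTransverseMetric (g t)
  smooth : ∀ e ∈ atlas (Model m n) M, ∀ u v : Model m n,
    ContDiffOn ℝ ∞ (fun q : ℝ × Model m n => bilinIn e (g q.1) q.2 u v) (Icc 0 T ×ˢ e.target)
  flow : ∀ e ∈ atlas (Model m n) M, ∀ z ∈ e.target, ∀ t ∈ Icc 0 T, ∀ i j : Fin n,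
    HasDerivWithinAt (fun s => metricIn e (g s) z i j)
      (-2 * ricci (metricIn e (g t)) z i j) (Icc 0 T) t

/-- At all points and times in `[0, T]`, the transverse curvature of `g t` and its first covariant
derivative are bounded by `K` in the norm of `g t`. -/
def CurvatureBound (K T : ℝ) (g : ℝ → BilinField m n M) : Prop :=
  ∀ t ∈ Icc 0 T, ∀ p : M, curvatureNorm (g t) p ≤ K ∧ nablaCurvatureNorm (g t) p ≤ K

end TransverseRicci

end

/-! The theorem is proved in the reverse of the order in which it is stated. Uniqueness comes first,
from a different energy whose Grönwall constant may depend on the two solutions. Once $g_Q=\bar g_Q$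
on $[0,T]$, the density of $\mathcal E$ is identically zero, so $\mathcal E$ and its derivative
vanish and $C_0=0$ serves for all $m$, $M$ and $K$.

The Ricci flow is only weakly parabolic as an equation for the metric, but the Ricci tensor
satisfies a strictly parabolic one. Write $u=g^{-1}$, $D=\partial g$, $r=\mathrm{Rc}$ in foliated
coordinates. The contracted Bianchi identity (`contracted_bianchi`) removes every second order term
in $r$ except a Laplacian, and `time_deriv_algRicci` gives $$\partial_t
r_{ij}=\partial_k\bigl(u^{kl}\partial_l r_{ij}+F^k_{ij}(u,D,r)\bigr)+P_{ij}(u,D,r,\partial r)$$ with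
$F$ and $P$ polynomial. Second derivatives of the metric, hence the full curvature tensor, occur
only under the divergence. The triple $(g,\partial g,r)$ therefore forms a closed system, since
$\partial_t g=-2r$ and $\partial_t\partial g=-2\partial r$.

For two flows and a cutoff $\sigma$ in a chart, consider $\int\sigma^2\bigl(|h|^2+|\partial
h|^2+|r-\bar r|^2\bigr)$ with Euclidean norms. Integrating the divergence by parts produces
$-2\int\sigma^2u^{kl}\partial_kb\,\partial_lb$ for each component $b$ of $r-\bar r$. Ellipticity on
compact sets (`exists_coercive`) lets this term absorb all other occurrences of $\partial(r-\bar
r)$, while the Lipschitz bounds of `exists_bounds` control the rest. By `exists_energy_deriv_le` the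
derivative is at most a constant times the unweighted energy on the support of $\sigma$.

To close the estimate on $M$, finitely many charts are taken for which the regions $\sigma_a=1$
cover $M$. The local energies in overlapping charts are comparable (`exists_locEn_le`), so the
unweighted energies are bounded by the sum of the weighted ones (`exists_setIntegral_chartEn_le`).
This sum vanishes at $t=0$, and Grönwall's inequality makes it vanish on $[0,T]$
(`globalEn_eq_zero`), which gives `IsTransverseRicciFlow.eq_of_initial_eq`.

The curvature identities are proved over a commutative algebra with commuting derivations and then
evaluated in the algebra of smooth functions, so that no differentiability has to be tracked in long
computations. -/

noncomputable section

namespace TransverseRicci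

/-! ### Curvature identities over a commutative algebra with commuting derivations -/

section Algebra

variable {n : ℕ} {A : Type*} [CommRing A] [Algebra ℝ A]

/-- Christoffel symbols as polynomials in the inverse metric `u` and the first derivatives
`D i j l = ∂_i g_{jl}`. -/
def chrPoly (u : Matrix (Fin n) (Fin n) A) (D : Fin n → Fin n → Fin n → A) (k i j : Fin n) : A :=
  (1 / 2 : ℝ) • ∑ l, u k l * (D i j l + D j i l - D l i j)

/-- The first derivatives of the entries of a matrix. -/
def jet (d : Fin n → Derivation ℝ A A) (G : Matrix (Fin n) (Fin n) A) (i j l : Fin n) : A :=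
  d i (G j l)

/-- The connection matrix `(Γ_i)^l_k`. -/
def connMatrix (d : Fin n → Derivation ℝ A A) (G u : Matrix (Fin n) (Fin n) A) (i : Fin n) :
    Matrix (Fin n) (Fin n) A :=
  Matrix.of fun l k => chrPoly u (jet d G) l i k

/-- The curvature matrix `(R_{ij})^l_k = R_{ijk}^l`. -/
def curvMatrix (d : Fin n → Derivation ℝ A A) (G u : Matrix (Fin n) (Fin n) A) (i j : Fin n) :
    Matrix (Fin n) (Fin n) A :=
  (connMatrix d G u j).map (d i) - (connMatrix d G u i).map (d j)
    + (connMatrix d G u i * connMatrix d G u j - connMatrix d G u j * connMatrix d G u i)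

/-- The Ricci tensor. -/
def algRicci (d : Fin n → Derivation ℝ A A) (G u : Matrix (Fin n) (Fin n) A) :
    Matrix (Fin n) (Fin n) A :=
  Matrix.of fun i j => ∑ k, ∑ l, ∑ r, u k l * curvMatrix d G u i k r l * G r j

theorem map_derivation_mul (δ : Derivation ℝ A A) (X Y : Matrix (Fin n) (Fin n) A) :
    (X * Y).map δ = X.map δ * Y + X * Y.map δ := by
  ext i j
  simp only [Matrix.map_apply, Matrix.mul_apply, Matrix.add_apply, map_sum, Derivation.leibniz,
    smul_eq_mul, ← Finset.sum_add_distrib]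
  exact Finset.sum_congr rfl fun k _ => by ring

theorem map_derivation_add (δ : Derivation ℝ A A) (X Y : Matrix (Fin n) (Fin n) A) :
    (X + Y).map δ = X.map δ + Y.map δ := by
  ext i j; simp

theorem map_derivation_sub (δ : Derivation ℝ A A) (X Y : Matrix (Fin n) (Fin n) A) :
    (X - Y).map δ = X.map δ - Y.map δ := by
  ext i j; simp

theorem map_derivation_transpose (δ : Derivation ℝ A A) (X : Matrix (Fin n) (Fin n) A) :
    (X.transpose).map δ = (X.map δ).transpose := rfl

variable (d : Fin n → Derivation ℝ A A) (G u : Matrix (Fin n) (Fin n) A)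

theorem map_derivation_inv (δ : Derivation ℝ A A) (hu : u * G = 1) :
    u.map δ = -(u * G.map δ * u) := by
  have hu' : G * u = 1 := mul_eq_one_comm.mp hu
  have h1 : (u * G).map δ = 0 := by
    rw [hu]; ext i j
    by_cases h : i = j
    · subst h; simp
    · simp [Matrix.one_apply_ne h]
  rw [map_derivation_mul] at h1
  have h2 : u.map δ * G = -(u * G.map δ) := eq_neg_of_add_eq_zero_left h1
  calc u.map δ = u.map δ * G * u := by rw [mul_assoc, hu', mul_one]
    _ = _ := by rw [h2]; simp

theorem chrPoly_symm (hG : G.transpose = G) (k i j : Fin n) :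
    chrPoly u (jet d G) k i j = chrPoly u (jet d G) k j i := by
  have hs : ∀ i j, G i j = G j i := fun i j => congrFun (congrFun hG.symm i) j
  unfold chrPoly jet
  congr 1
  refine Finset.sum_congr rfl fun l _ => ?_
  rw [hs i j]; ring

theorem metric_mul_connMatrix (hu : u * G = 1) (i j l : Fin n) :
    (G * connMatrix d G u i) j l
      = (1 / 2 : ℝ) • (d i (G l j) + d l (G i j) - d j (G i l)) := by
  have hu' : G * u = 1 := mul_eq_one_comm.mp hu
  have h : ∀ w : Fin n → A, ∑ p, G j p * ∑ q, u p q * w q = w j := by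
    intro w
    have := congrFun (congrArg (fun X : Matrix (Fin n) (Fin n) A => X.mulVec w) hu') j
    simp only [← Matrix.mulVec_mulVec, Matrix.one_mulVec] at this
    simpa [Matrix.mulVec, dotProduct] using this
  rw [Matrix.mul_apply]
  simp only [connMatrix, Matrix.of_apply, chrPoly, jet, mul_smul_comm]
  rw [← Finset.smul_sum, h (fun q => d i (G l q) + d l (G i q) - d q (G i l))]

/-- This is $\nabla g=0$. Two Koszul expressions with $j$ and $l$ exchanged are added, and all but
the derivative in direction $i$ cancels. -/
theorem metric_compatible (hG : G.transpose = G) (hu : u * G = 1) (i : Fin n) :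
    G.map (d i) = (connMatrix d G u i).transpose * G + G * connMatrix d G u i := by
  have hs : ∀ i j, G i j = G j i := fun i j => congrFun (congrFun hG.symm i) j
  have ht : (connMatrix d G u i).transpose * G = (G * connMatrix d G u i).transpose := by
    rw [Matrix.transpose_mul, hG]
  rw [ht]
  ext j l
  rw [Matrix.add_apply, Matrix.transpose_apply, metric_mul_connMatrix d G u hu,
    metric_mul_connMatrix d G u hu, Matrix.map_apply, ← smul_add, hs l j, hs i j, hs i l]
  rw [show d i (G j l) + d j (G l i) - d l (G j i) + (d i (G j l) + d l (G j i) - d j (G l i))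
    = (2 : ℝ) • d i (G j l) by rw [two_smul]; ring, smul_smul]
  norm_num

theorem inverse_compatible (hG : G.transpose = G) (hu : u * G = 1) (i : Fin n) :
    u.map (d i) = -(connMatrix d G u i * u + u * (connMatrix d G u i).transpose) := by
  have hu' : G * u = 1 := mul_eq_one_comm.mp hu
  rw [map_derivation_inv G u (d i) hu, metric_compatible d G u hG hu, mul_add, add_mul]
  congr 1
  rw [← mul_assoc u G, hu, one_mul, mul_assoc, mul_assoc, hu', mul_one, add_comm]

omit [Algebra ℝ A] in
theorem inverse_symm (hG : G.transpose = G) (hu : u * G = 1) : u.transpose = u := by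
  have hu' : G * u = 1 := mul_eq_one_comm.mp hu
  have h : u.transpose * G = 1 := by
    have := congrArg Matrix.transpose hu'
    rwa [Matrix.transpose_mul, hG, Matrix.transpose_one] at this
  calc u.transpose = u.transpose * (G * u) := by rw [hu', mul_one]
    _ = u := by rw [← mul_assoc, h, one_mul]

variable (hd : ∀ i j a, d i (d j a) = d j (d i a))

-- The second derivatives of `G` commute. Writing both through metric compatibility, applied twice,
-- leaves exactly this combination as their difference.
include hd in
theorem curvMatrix_skew (hG : G.transpose = G) (hu : u * G = 1) (i j : Fin n) :
    (curvMatrix d G u i j).transpose * G + G * curvMatrix d G u i j = 0 := by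
  have hc := metric_compatible d G u hG hu
  have h1 : (G.map (d j)).map (d i) = (G.map (d i)).map (d j) := by
    ext a b; exact hd _ _ _
  rw [hc j, hc i] at h1
  simp only [map_derivation_add, map_derivation_mul, map_derivation_transpose, hc] at h1
  rw [← sub_eq_zero] at h1
  rw [← h1]
  simp only [curvMatrix, Matrix.transpose_add, Matrix.transpose_sub, Matrix.transpose_mul]
  noncomm_ring

theorem curvMatrix_swap (i j : Fin n) : curvMatrix d G u j i = -curvMatrix d G u i j := by
  unfold curvMatrix; abel

-- Skewness carries the metric across the curvature, where it cancels against `u`. In the trace form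
-- the leading part of the Ricci tensor is visibly a divergence of Christoffel symbols.
include hd in
theorem algRicci_eq_trace (hG : G.transpose = G) (hu : u * G = 1) (i j : Fin n) :
    algRicci d G u i j = ∑ k, curvMatrix d G u k i k j := by
  have hs : ∀ i j, G i j = G j i := fun i j => congrFun (congrFun hG.symm i) j
  have h1 : ∀ k l, ∑ r, curvMatrix d G u i k r l * G r j
      = -∑ r, G l r * curvMatrix d G u i k r j := by
    intro k l
    have := congrFun (congrFun (curvMatrix_skew d G u hd hG hu i k) l) j
    simp only [Matrix.add_apply, Matrix.mul_apply, Matrix.transpose_apply, Matrix.zero_apply]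
      at this
    exact eq_neg_of_add_eq_zero_left this
  rw [algRicci, Matrix.of_apply]
  refine Finset.sum_congr rfl fun k _ => ?_
  simp only [mul_assoc, ← Finset.mul_sum, h1, mul_neg, Finset.sum_neg_distrib]
  rw [curvMatrix_swap d G u i k, Matrix.neg_apply]
  congr 1
  calc ∑ l, u k l * ∑ r, G l r * curvMatrix d G u i k r j
      = (u * (G * curvMatrix d G u i k)) k j := by simp [Matrix.mul_apply]
    _ = _ := by rw [← mul_assoc, hu, one_mul]

theorem algRicci_mul_inverse (hu : u * G = 1) (i p : Fin n) :
    ∑ l, algRicci d G u i l * u l p = ∑ k, ∑ l, u k l * curvMatrix d G u i k p l := by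
  have hu' : G * u = 1 := mul_eq_one_comm.mp hu
  simp only [algRicci, Matrix.of_apply, Finset.sum_mul]
  rw [Finset.sum_comm]
  refine Finset.sum_congr rfl fun k _ => ?_
  rw [Finset.sum_comm]
  refine Finset.sum_congr rfl fun l _ => ?_
  rw [Finset.sum_comm]
  have : ∀ r, ∑ q, G r q * u q p = if r = p then 1 else 0 := by
    intro r
    have := congrFun (congrFun hu' r) p
    rwa [Matrix.mul_apply, Matrix.one_apply] at this
  simp only [mul_assoc, ← Finset.mul_sum, this]
  simp

include hd in
/-- The second Bianchi identity in matrix form. -/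
theorem second_bianchi (a i j : Fin n) :
    (curvMatrix d G u i j).map (d a)
      + (connMatrix d G u a * curvMatrix d G u i j - curvMatrix d G u i j * connMatrix d G u a)
      + ((curvMatrix d G u j a).map (d i)
      + (connMatrix d G u i * curvMatrix d G u j a - curvMatrix d G u j a * connMatrix d G u i))
      + ((curvMatrix d G u a i).map (d j)
      + (connMatrix d G u j * curvMatrix d G u a i - curvMatrix d G u a i * connMatrix d G u j))
      = 0 := by
  have hc : ∀ (i j : Fin n) (X : Matrix (Fin n) (Fin n) A),
      (X.map (d i)).map (d j) = (X.map (d j)).map (d i) := by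
    intro i j X; ext a b; exact hd _ _ _
  simp only [curvMatrix, map_derivation_add, map_derivation_sub, map_derivation_mul]
  -- With the second derivatives matched, an identity in noncommuting matrices remains.
  -- Torsion-freeness of the connection plays no role.
  rw [hc a i, hc a j, hc i j]
  noncomm_ring

/-- The first order correction in the contracted Bianchi identity. -/
def bianchiPoly (u : Matrix (Fin n) (Fin n) A) (D : Fin n → Fin n → Fin n → A)
    (r : Matrix (Fin n) (Fin n) A) (a : Fin n) : A :=
  ∑ j, ∑ k, ∑ l, u j k * (r a l * chrPoly u D l j k)

include hd in
/-- The contracted second Bianchi identity. -/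
theorem contracted_bianchi (hG : G.transpose = G) (hu : u * G = 1)
    (hR : ∀ i j, algRicci d G u i j = algRicci d G u j i) (a : Fin n) :
    ∑ j, ∑ k, u j k * d j (algRicci d G u a k)
      = (1 / 2 : ℝ) • ∑ j, ∑ k, u j k * d a (algRicci d G u j k)
        + bianchiPoly u (jet d G) (algRicci d G u) a := by
  set Γ := connMatrix d G u with hΓ
  set R := curvMatrix d G u with hRm
  set r := algRicci d G u with hr
  have us : ∀ i j, u i j = u j i := fun i j =>
    congrFun (congrFun (inverse_symm G u hG hu).symm i) j
  have Γs : ∀ k i j, Γ i k j = Γ j k i := fun k i j => chrPoly_symm d G u hG k i j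
  have tr : ∀ i j, r i j = ∑ k, R k i k j := algRicci_eq_trace d G u hd hG hu
  have sw : ∀ i j k l, R j i k l = -R i j k l := fun i j k l => by
    rw [hRm, curvMatrix_swap d G u i j, Matrix.neg_apply]
  have ru : ∀ i p, ∑ k, ∑ l, u k l * R i k p l = ∑ l, r i l * u l p := fun i p =>
    (algRicci_mul_inverse d G u hu i p).symm
  have du : ∀ i j k, d i (u j k) = -(∑ p, Γ i j p * u p k + ∑ p, u j p * Γ i k p) := by
    intro i j k
    have := congrFun (congrFun (inverse_compatible d G u hG hu i) j) k
    simpa [Matrix.mul_apply] using this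
  have hB : ∀ i j k, d a (R i j i k) + (∑ p, Γ a i p * R i j p k - ∑ p, R i j i p * Γ a p k)
      + (d i (R j a i k) + (∑ p, Γ i i p * R j a p k - ∑ p, R j a i p * Γ i p k))
      + (d j (R a i i k) + (∑ p, Γ j i p * R a i p k - ∑ p, R a i i p * Γ j p k)) = 0 := by
    intro i j k
    have := congrFun (congrFun (second_bianchi d G u hd a i j) i) k
    simpa [Matrix.mul_apply] using this
  -- Contraction of the second Bianchi identity: the upper index is traced against $i$, and $j,k$
  -- are traced with the inverse metric.
  have hsum : ∑ j, ∑ k, ∑ i, u j k *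
      (d a (R i j i k) + (∑ p, Γ a i p * R i j p k - ∑ p, R i j i p * Γ a p k)
      + (d i (R j a i k) + (∑ p, Γ i i p * R j a p k - ∑ p, R j a i p * Γ i p k))
      + (d j (R a i i k) + (∑ p, Γ j i p * R a i p k - ∑ p, R a i i p * Γ j p k))) = 0 := by
    simp only [hB, mul_zero, Finset.sum_const_zero]
  simp only [mul_add, mul_sub, Finset.sum_add_distrib, Finset.sum_sub_distrib] at hsum
  have S1 : ∑ j, ∑ k, ∑ i, u j k * d a (R i j i k) = ∑ j, ∑ k, u j k * d a (r j k) := by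
    simp only [tr, map_sum, Finset.mul_sum]
  have S5 : ∑ j, ∑ k, ∑ i, u j k * d j (R a i i k) = -∑ j, ∑ k, u j k * d j (r a k) := by
    simp only [tr, map_sum, Finset.mul_sum, ← Finset.sum_neg_distrib]
    refine Finset.sum_congr rfl fun j _ => Finset.sum_congr rfl fun k _ =>
      Finset.sum_congr rfl fun i _ => ?_
    rw [sw i a, map_neg, mul_neg]
  -- `T1` and `T2` have the same value and enter with opposite signs, so the connection in direction
  -- $a$ drops out. This is why only the correction `bianchiPoly` survives.
  have T1 : ∑ j, ∑ k, ∑ i, u j k * ∑ p, Γ a i p * R i j p k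
      = ∑ i, ∑ p, ∑ l, Γ a i p * (r i l * u l p) := by
    simp only [← Finset.mul_sum, ← ru]
    simp only [Finset.mul_sum]
    rw [Finset.sum_congr rfl fun j _ => Finset.sum_comm, Finset.sum_comm]
    refine Finset.sum_congr rfl fun i _ => ?_
    rw [Finset.sum_congr rfl fun j _ => Finset.sum_comm, Finset.sum_comm]
    exact Finset.sum_congr rfl fun p _ => Finset.sum_congr rfl fun j _ =>
      Finset.sum_congr rfl fun k _ => by ring
  have T2 : ∑ j, ∑ k, ∑ i, u j k * ∑ p, R i j i p * Γ a p k
      = ∑ i, ∑ p, ∑ l, Γ a i p * (r i l * u l p) := by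
    have h1 : ∀ j k, ∑ i, u j k * ∑ p, R i j i p * Γ a p k = ∑ p, u j k * (r j p * Γ a p k) := by
      intro j k
      simp only [tr, Finset.mul_sum, Finset.sum_mul]
      exact Finset.sum_comm
    simp only [h1]
    rw [Finset.sum_comm, Finset.sum_congr rfl fun k _ => Finset.sum_comm, Finset.sum_comm]
    refine Finset.sum_congr rfl fun i _ => Finset.sum_congr rfl fun p _ =>
      Finset.sum_congr rfl fun l _ => ?_
    rw [hR l i]; ring
  have T3 : ∑ j, ∑ k, ∑ i, u j k * ∑ p, Γ i i p * R j a p k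
      = -∑ i, ∑ p, ∑ l, Γ i i p * (r a l * u l p) := by
    simp only [← Finset.mul_sum, ← ru]
    simp only [Finset.mul_sum, ← Finset.sum_neg_distrib]
    rw [Finset.sum_congr rfl fun j _ => Finset.sum_comm, Finset.sum_comm]
    refine Finset.sum_congr rfl fun i _ => ?_
    rw [Finset.sum_congr rfl fun j _ => Finset.sum_comm, Finset.sum_comm]
    exact Finset.sum_congr rfl fun p _ => Finset.sum_congr rfl fun j _ =>
      Finset.sum_congr rfl fun k _ => by rw [sw a j]; ring
  have T6 : ∑ j, ∑ k, ∑ i, u j k * ∑ p, R a i i p * Γ j p k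
      = -∑ j, ∑ k, ∑ l, u j k * (r a l * Γ j l k) := by
    simp only [← Finset.sum_neg_distrib]
    refine Finset.sum_congr rfl fun j _ => Finset.sum_congr rfl fun k _ => ?_
    simp only [tr, Finset.mul_sum, Finset.sum_mul, ← Finset.sum_neg_distrib]
    rw [Finset.sum_comm]
    exact Finset.sum_congr rfl fun p _ => Finset.sum_congr rfl fun i _ => by rw [sw i a]; ring
  -- The curvature appears here without a trace. The product rule moves `u` under the derivative,
  -- where by `V` the contraction is the Ricci tensor with one index raised.
  have S3 : ∑ j, ∑ k, ∑ i, u j k * d i (R j a i k)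
      = ∑ i, d i (∑ j, ∑ k, u j k * R j a i k) - ∑ j, ∑ k, ∑ i, d i (u j k) * R j a i k := by
    rw [eq_sub_iff_add_eq]
    simp only [map_sum, Derivation.leibniz, smul_eq_mul, ← Finset.sum_add_distrib]
    rw [Finset.sum_congr rfl fun j _ => Finset.sum_comm, Finset.sum_comm]
    exact Finset.sum_congr rfl fun i _ => Finset.sum_congr rfl fun j _ =>
      Finset.sum_congr rfl fun k _ => by ring
  have V : ∀ i, ∑ j, ∑ k, u j k * R j a i k = -∑ l, r a l * u l i := by
    intro i
    rw [← ru]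
    simp only [← Finset.sum_neg_distrib]
    exact Finset.sum_congr rfl fun j _ => Finset.sum_congr rfl fun k _ => by rw [sw a j]; ring
  have W : ∑ j, ∑ k, ∑ i, d i (u j k) * R j a i k
      = ∑ j, ∑ k, ∑ i, u j k * ∑ p, Γ j i p * R a i p k
        - ∑ j, ∑ k, ∑ i, u j k * ∑ p, R j a i p * Γ i p k := by
    have h1 : ∑ j, ∑ k, ∑ i, (∑ p, Γ i j p * u p k) * R j a i k
        = -∑ j, ∑ k, ∑ i, u j k * ∑ p, Γ j i p * R a i p k := by
      simp only [Finset.mul_sum, Finset.sum_mul, ← Finset.sum_neg_distrib]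
      rw [Finset.sum_comm, Finset.sum_comm (f := fun j k => ∑ i, ∑ p,
        -(u j k * (Γ j i p * R a i p k)))]
      refine Finset.sum_congr rfl fun k _ => ?_
      rw [Finset.sum_congr rfl fun j _ => Finset.sum_comm, Finset.sum_comm]
      refine Finset.sum_congr rfl fun p _ => Finset.sum_congr rfl fun j _ =>
        Finset.sum_congr rfl fun i _ => ?_
      rw [sw a j, Γs j i p]; ring
    have h2 : ∑ j, ∑ k, ∑ i, (∑ p, u j p * Γ i k p) * R j a i k
        = ∑ j, ∑ k, ∑ i, u j k * ∑ p, R j a i p * Γ i p k := by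
      refine Finset.sum_congr rfl fun j _ => ?_
      simp only [Finset.mul_sum, Finset.sum_mul]
      rw [Finset.sum_comm, Finset.sum_comm (f := fun k i => ∑ p, u j k * (R j a i p * Γ i p k))]
      refine Finset.sum_congr rfl fun i _ => ?_
      rw [Finset.sum_comm]
      exact Finset.sum_congr rfl fun p _ => Finset.sum_congr rfl fun k _ => by ring
    simp only [du, neg_mul, add_mul, Finset.sum_neg_distrib, Finset.sum_add_distrib, h1, h2]
    ring
  have X : ∑ i, d i (∑ j, ∑ k, u j k * R j a i k)
      = -∑ j, ∑ k, u j k * d j (r a k) + ∑ j, ∑ k, ∑ l, u j k * (r a l * Γ j l k)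
        + ∑ i, ∑ p, ∑ l, Γ i i p * (r a l * u l p) := by
    simp only [V, map_neg, map_sum, Derivation.leibniz, smul_eq_mul, du, Finset.sum_add_distrib,
      mul_neg, mul_add, Finset.sum_neg_distrib, Finset.mul_sum]
    have e1 : ∑ i, ∑ l, u l i * d i (r a l) = ∑ j, ∑ k, u j k * d j (r a k) :=
      Finset.sum_congr rfl fun i _ => Finset.sum_congr rfl fun l _ => by rw [us]
    have e2 : ∑ i, ∑ l, ∑ p, r a l * (Γ i l p * u p i)
        = ∑ j, ∑ k, ∑ l, u j k * (r a l * Γ j l k) := by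
      refine Finset.sum_congr rfl fun i _ => ?_
      rw [Finset.sum_comm]
      exact Finset.sum_congr rfl fun l _ => Finset.sum_congr rfl fun p _ => by rw [us l i]; ring
    have e3 : ∑ i, ∑ l, ∑ p, r a l * (u l p * Γ i i p)
        = ∑ i, ∑ p, ∑ l, Γ i i p * (r a l * u l p) := by
      refine Finset.sum_congr rfl fun i _ => ?_
      rw [Finset.sum_comm]
      exact Finset.sum_congr rfl fun l _ => Finset.sum_congr rfl fun p _ => by ring
    rw [e1, e2, e3]; ring
  have hb : bianchiPoly u (jet d G) r a = ∑ j, ∑ k, ∑ l, u j k * (r a l * Γ j l k) := rfl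
  rw [S1, S5, T1, T2, T3, T6, S3, W, X] at hsum
  rw [hb]
  have h2 : (2 : ℝ) • ∑ j, ∑ k, u j k * d j (r a k) = ∑ j, ∑ k, u j k * d a (r j k)
      + (2 : ℝ) • ∑ j, ∑ k, ∑ l, u j k * (r a l * Γ j l k) := by
    rw [two_smul, two_smul]
    linear_combination -hsum
  have h3 := congrArg (fun x => (1 / 2 : ℝ) • x) h2
  simpa [smul_smul] using h3

/-- The derivatives `∂_i u^{kl}` of the inverse metric. -/
def invJetPoly (u : Matrix (Fin n) (Fin n) A) (D : Fin n → Fin n → Fin n → A) (i k l : Fin n) : A :=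
  -∑ b, (∑ a, u k a * D i a b) * u b l

/-- The zeroth order part of the time derivative of the Christoffel symbols under the flow. -/
def chrDotPoly (u : Matrix (Fin n) (Fin n) A) (D : Fin n → Fin n → Fin n → A)
    (r : Matrix (Fin n) (Fin n) A) (k i j : Fin n) : A :=
  (2 : ℝ) • chrPoly (u * r * u) D k i j

/-- The time derivative of the quadratic part of the Ricci tensor under the flow. -/
def quadDotPoly (u : Matrix (Fin n) (Fin n) A) (D : Fin n → Fin n → Fin n → A)
    (r : Matrix (Fin n) (Fin n) A) (dr : Fin n → Fin n → Fin n → A) (i j : Fin n) : A :=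
  ∑ k, ∑ p, ((chrDotPoly u D r k k p - (2 : ℝ) • chrPoly u dr k k p) * chrPoly u D p i j
    + chrPoly u D k k p * (chrDotPoly u D r p i j - (2 : ℝ) • chrPoly u dr p i j)
    - (chrDotPoly u D r k i p - (2 : ℝ) • chrPoly u dr k i p) * chrPoly u D p k j
    - chrPoly u D k i p * (chrDotPoly u D r p k j - (2 : ℝ) • chrPoly u dr p k j))

/-- The lower order part of the flux in the evolution equation of the Ricci tensor. -/
def fluxPoly (u : Matrix (Fin n) (Fin n) A) (D : Fin n → Fin n → Fin n → A)
    (r : Matrix (Fin n) (Fin n) A) (k i j : Fin n) : A :=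
  chrDotPoly u D r k i j
    - (if k = i then ∑ l, chrDotPoly u D r l l j + bianchiPoly u D r j else 0)
    - (if k = j then bianchiPoly u D r i else 0)

/-- The lower order source in the evolution equation of the Ricci tensor. -/
def sourcePoly (u : Matrix (Fin n) (Fin n) A) (D : Fin n → Fin n → Fin n → A)
    (r : Matrix (Fin n) (Fin n) A) (dr : Fin n → Fin n → Fin n → A) (i j : Fin n) : A :=
  quadDotPoly u D r dr i j
    - ∑ k, ∑ l, (invJetPoly u D k k l * dr i j l - invJetPoly u D i k l * dr k j l)
    - ∑ k, ∑ l, (invJetPoly u D k k l * dr j i l - invJetPoly u D j k l * dr k i l)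
    - (1 / 2 : ℝ) • ∑ k, ∑ l, (invJetPoly u D j k l * dr i k l - invJetPoly u D i k l * dr j k l)

theorem derivation_inverse (δ : Derivation ℝ A A) (hu : u * G = 1) (k l : Fin n) :
    δ (u k l) = -∑ b, (∑ a, u k a * δ (G a b)) * u b l := by
  have := congrFun (congrFun (map_derivation_inv G u δ hu) k) l
  simpa [Matrix.mul_apply] using this

include hd in
theorem algRicci_eq (hG : G.transpose = G) (hu : u * G = 1) (i j : Fin n) :
    algRicci d G u i j = ∑ k, d k (chrPoly u (jet d G) k i j)
      - d i (∑ k, chrPoly u (jet d G) k k j)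
      + ∑ k, ∑ p, (chrPoly u (jet d G) k k p * chrPoly u (jet d G) p i j
        - chrPoly u (jet d G) k i p * chrPoly u (jet d G) p k j) := by
  rw [algRicci_eq_trace d G u hd hG hu, map_sum, ← Finset.sum_sub_distrib,
    ← Finset.sum_add_distrib]
  refine Finset.sum_congr rfl fun k _ => ?_
  simp [curvMatrix, connMatrix, Matrix.mul_apply, Finset.sum_sub_distrib]

variable (τ : Derivation ℝ A A) (hτ : ∀ i a, τ (d i a) = d i (τ a))

-- Differentiating $uG=1$ along the flow gives $\tau u=2\,u\,r\,u$, the source of `chrDotPoly`. The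
-- other term comes from exchanging `τ` with the spatial derivations.
include hτ in
theorem time_deriv_chrPoly (hu : u * G = 1)
    (hflow : ∀ i j, τ (G i j) = (-2 : ℝ) • algRicci d G u i j) (k i j : Fin n) :
    τ (chrPoly u (jet d G) k i j) = chrDotPoly u (jet d G) (algRicci d G u) k i j
      - (2 : ℝ) • chrPoly u (jet d (algRicci d G u)) k i j := by
  have h1 : ∀ k l, τ (u k l)
      = (2 : ℝ) • (u * algRicci d G u * u) k l := by
    intro k l
    rw [derivation_inverse G u τ hu]
    simp only [hflow, Matrix.mul_apply, mul_smul_comm, ← Finset.smul_sum, smul_mul_assoc]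
    rw [← neg_smul]; norm_num
  have h2 : ∀ i j l, τ (jet d G i j l) = (-2 : ℝ) • jet d (algRicci d G u) i j l := by
    intro i j l
    rw [jet, hτ, hflow, Derivation.map_smul]; rfl
  have key : ∀ l, τ (u k l * (jet d G i j l + jet d G j i l - jet d G l i j))
      = (2 : ℝ) • ((u * algRicci d G u * u) k l
          * (jet d G i j l + jet d G j i l - jet d G l i j))
        - (2 : ℝ) • (u k l * (jet d (algRicci d G u) i j l + jet d (algRicci d G u) j i l
          - jet d (algRicci d G u) l i j)) := by
    intro l
    rw [Derivation.leibniz, map_sub, map_add, h1, h2, h2, h2]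
    simp only [smul_eq_mul, neg_smul, two_smul]
    ring
  unfold chrDotPoly chrPoly
  rw [Derivation.map_smul, map_sum]
  simp only [key, Finset.sum_sub_distrib, ← Finset.smul_sum, smul_sub]
  rw [smul_comm (1 / 2 : ℝ) (2 : ℝ), smul_comm (1 / 2 : ℝ) (2 : ℝ)]

include hd hτ in
/-- The evolution equation of the Ricci tensor under the Ricci flow, in divergence form. -/
theorem time_deriv_algRicci (hG : G.transpose = G) (hu : u * G = 1)
    (hR : ∀ i j, algRicci d G u i j = algRicci d G u j i)
    (hflow : ∀ i j, τ (G i j) = (-2 : ℝ) • algRicci d G u i j) (i j : Fin n) :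
    τ (algRicci d G u i j)
      = ∑ k, d k (∑ l, u k l * d l (algRicci d G u i j)
          + fluxPoly u (jet d G) (algRicci d G u) k i j)
        + sourcePoly u (jet d G) (algRicci d G u) (jet d (algRicci d G u)) i j := by
  set r := algRicci d G u with hr
  set D := jet d G with hD
  have us : ∀ i j, u i j = u j i := fun i j =>
    congrFun (congrFun (inverse_symm G u hG hu).symm i) j
  have hc : ∀ k i j, τ (chrPoly u D k i j)
      = chrDotPoly u D r k i j - (2 : ℝ) • chrPoly u (jet d r) k i j :=
    time_deriv_chrPoly d G u τ hτ hu hflow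
  have du : ∀ i k l, d i (u k l) = invJetPoly u D i k l := fun i k l =>
    derivation_inverse G u (d i) hu k l
  have hB : ∀ a, ∑ k, ∑ l, u k l * d k (r a l)
      = (1 / 2 : ℝ) • ∑ k, ∑ l, u k l * d a (r k l) + bianchiPoly u D r a :=
    contracted_bianchi d G u hd hG hu hR
  have hq : τ (∑ k, ∑ p, (chrPoly u D k k p * chrPoly u D p i j
        - chrPoly u D k i p * chrPoly u D p k j))
      = quadDotPoly u D r (jet d r) i j := by
    simp only [map_sum, map_sub, Derivation.leibniz, hc, smul_eq_mul]
    unfold quadDotPoly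
    exact Finset.sum_congr rfl fun k _ => Finset.sum_congr rfl fun p _ => by ring
  have hdr : ∀ k i j, (2 : ℝ) • chrPoly u (jet d r) k i j
      = ∑ l, u k l * (d i (r j l) + d j (r i l) - d l (r i j)) := by
    intro k i j
    unfold chrPoly jet
    rw [smul_smul]; norm_num
  have htr : ∑ k, (2 : ℝ) • chrPoly u (jet d r) k k j
      = ∑ k, ∑ l, u k l * d j (r k l) := by
    simp only [hdr, mul_add, mul_sub, Finset.sum_add_distrib, Finset.sum_sub_distrib]
    have : ∑ k, ∑ l, u k l * d k (r j l) = ∑ k, ∑ l, u k l * d l (r k j) := by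
      rw [Finset.sum_comm]
      exact Finset.sum_congr rfl fun k _ => Finset.sum_congr rfl fun l _ => by rw [us, hR j]
    rw [this]; ring
  -- Exchanging the two derivations costs only products of first derivatives of `u` and `r`. The
  -- inner sum then has the shape required by the contracted Bianchi identity.
  have comm1 : ∀ i j, ∑ k, d k (∑ l, u k l * d i (r j l)) = d i (∑ k, ∑ l, u k l * d k (r j l))
      + ∑ k, ∑ l, (invJetPoly u D k k l * jet d r i j l - invJetPoly u D i k l * jet d r k j l) := by
    intro i j
    simp only [map_sum, ← Finset.sum_add_distrib, Derivation.leibniz, smul_eq_mul, du]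
    refine Finset.sum_congr rfl fun k _ => Finset.sum_congr rfl fun l _ => ?_
    rw [hd k i]; unfold jet; ring
  have comm2 : d j (∑ k, ∑ l, u k l * d i (r k l)) = d i (∑ k, ∑ l, u k l * d j (r k l))
      + ∑ k, ∑ l, (invJetPoly u D j k l * jet d r i k l - invJetPoly u D i k l * jet d r j k l) := by
    simp only [map_sum, ← Finset.sum_add_distrib, Derivation.leibniz, smul_eq_mul, du]
    refine Finset.sum_congr rfl fun k _ => Finset.sum_congr rfl fun l _ => ?_
    rw [hd j i]; unfold jet; ring
  have hflux : ∑ k, d k (fluxPoly u D r k i j) = ∑ k, d k (chrDotPoly u D r k i j)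
      - d i (∑ l, chrDotPoly u D r l l j) - d i (bianchiPoly u D r j)
      - d j (bianchiPoly u D r i) := by
    have e : ∀ (i : Fin n) (x : A), ∑ k, d k (if k = i then x else 0) = d i x := by
      intro i x
      rw [Finset.sum_eq_single i]
      · simp
      · intro k _ hk; simp [hk]
      · simp
    unfold fluxPoly
    simp only [map_sub, Finset.sum_sub_distrib, e, map_add]
    ring
  have h1 : τ (r i j) = ∑ k, d k (chrDotPoly u D r k i j)
      - ∑ k, d k ((2 : ℝ) • chrPoly u (jet d r) k i j)
      - (d i (∑ k, chrDotPoly u D r k k j)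
        - d i (∑ k, (2 : ℝ) • chrPoly u (jet d r) k k j))
      + quadDotPoly u D r (jet d r) i j := by
    have h0 : r i j = _ := algRicci_eq d G u hd hG hu i j
    rw [← hD] at h0
    rw [h0, map_add, map_sub, hτ, hq]
    simp only [map_sum, hτ, hc, map_sub, Finset.sum_sub_distrib]
  rw [h1, htr]
  simp only [map_add, Finset.sum_add_distrib, hflux]
  have h2 : ∑ k, d k ((2 : ℝ) • chrPoly u (jet d r) k i j)
      = ∑ k, d k (∑ l, u k l * d i (r j l)) + ∑ k, d k (∑ l, u k l * d j (r i l))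
        - ∑ k, d k (∑ l, u k l * d l (r i j)) := by
    simp only [hdr, mul_add, mul_sub, Finset.sum_add_distrib, Finset.sum_sub_distrib, map_add,
      map_sub]
  have h3 : (1 / 2 : ℝ) • d j (∑ k, ∑ l, u k l * d i (r k l))
      = (1 / 2 : ℝ) • d i (∑ k, ∑ l, u k l * d j (r k l))
      + (1 / 2 : ℝ) • ∑ k, ∑ l,
        (invJetPoly u D j k l * jet d r i k l - invJetPoly u D i k l * jet d r j k l) := by
    rw [comm2, smul_add]
  have h4 : (1 / 2 : ℝ) • d i (∑ k, ∑ l, u k l * d j (r k l))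
      + (1 / 2 : ℝ) • d i (∑ k, ∑ l, u k l * d j (r k l))
      = d i (∑ k, ∑ l, u k l * d j (r k l)) := by
    rw [← add_smul]; norm_num
  -- The two uses of the Bianchi identity produce two halves of
  -- $\partial_i(u^{kl}\partial_jr_{kl})$, up to lower order. They cancel the same term coming from
  -- the trace of the Christoffel symbols, so only the Laplacian of `r i j` remains at second order.
  rw [h2, comm1 i j, comm1 j i, hB i, hB j]
  simp only [map_add, Derivation.map_smul]
  unfold sourcePoly
  rw [h3]
  linear_combination (-1 : A) * h4

end Algebra

/-! ### The algebra of smooth functions on an open set -/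

/-! ### Compatibility of the polynomial expressions with evaluation homomorphisms. -/

section PolyMap

variable {n : ℕ} {A B : Type*} [CommRing A] [Algebra ℝ A] [CommRing B] [Algebra ℝ B]
  (φ : A →ₐ[ℝ] B) (u : Matrix (Fin n) (Fin n) A) (D : Fin n → Fin n → Fin n → A)
  (r : Matrix (Fin n) (Fin n) A) (dr : Fin n → Fin n → Fin n → A)

theorem map_chrPoly (k i j : Fin n) :
    φ (chrPoly u D k i j) = chrPoly (u.map φ) (fun a b c => φ (D a b c)) k i j := by
  simp [chrPoly]

theorem map_mul_mul : (u * r * u).map φ = u.map φ * r.map φ * u.map φ := by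
  rw [Matrix.map_mul, Matrix.map_mul]

theorem map_chrDotPoly (k i j : Fin n) :
    φ (chrDotPoly u D r k i j)
      = chrDotPoly (u.map φ) (fun a b c => φ (D a b c)) (r.map φ) k i j := by
  simp only [chrDotPoly, map_smul, map_chrPoly, map_mul_mul]

theorem map_bianchiPoly (a : Fin n) :
    φ (bianchiPoly u D r a)
      = bianchiPoly (u.map φ) (fun a b c => φ (D a b c)) (r.map φ) a := by
  simp [bianchiPoly, map_chrPoly]

theorem map_fluxPoly (k i j : Fin n) :
    φ (fluxPoly u D r k i j)
      = fluxPoly (u.map φ) (fun a b c => φ (D a b c)) (r.map φ) k i j := by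
  simp only [fluxPoly, map_sub, apply_ite φ, map_add, map_sum, map_zero, map_chrDotPoly,
    map_bianchiPoly]

theorem map_invJetPoly (k i j : Fin n) :
    φ (invJetPoly u D k i j) = invJetPoly (u.map φ) (fun a b c => φ (D a b c)) k i j := by
  simp [invJetPoly]

theorem map_sourcePoly (i j : Fin n) :
    φ (sourcePoly u D r dr i j)
      = sourcePoly (u.map φ) (fun a b c => φ (D a b c)) (r.map φ) (fun a b c => φ (dr a b c))
        i j := by
  simp only [sourcePoly, quadDotPoly, map_sub, map_add, map_mul, map_sum, map_smul, map_chrDotPoly,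
    map_chrPoly, map_invJetPoly]

end PolyMap

/-! ### Smooth functions on an open set as an algebra with commuting derivations. -/

section SmoothAlgebra

variable {E : Type*} [NormedAddCommGroup E] [NormedSpace ℝ E]

/-- The algebra of functions that are smooth on `O`. -/
def smoothAlg (O : Set E) : Subalgebra ℝ (E → ℝ) where
  carrier := {f | ContDiffOn ℝ ∞ f O}
  mul_mem' hf hg := ContDiffOn.mul hf hg
  add_mem' hf hg := ContDiffOn.add hf hg
  algebraMap_mem' _ := contDiffOn_const

/-- Evaluation at a point. -/
def evalAlg (O : Set E) (q : E) : smoothAlg O →ₐ[ℝ] ℝ :=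
  (Pi.evalAlgHom ℝ (fun _ : E => ℝ) q).comp (smoothAlg O).val

theorem evalAlg_apply (O : Set E) (q : E) (f : smoothAlg O) : evalAlg O q f = f.1 q := rfl

theorem differentiableAt_smoothAlg {O : Set E} (hO : IsOpen O) (f : smoothAlg O) {q : E}
    (hq : q ∈ O) : DifferentiableAt ℝ f.1 q :=
  ((f.2.differentiableOn (by simp)) q hq).differentiableAt (hO.mem_nhds hq)

open Classical in
/-- The directional derivative along a constant vector, set to zero outside of `O`. -/
def dirDeriv {O : Set E} (hO : IsOpen O) (v : E) : Derivation ℝ (smoothAlg O) (smoothAlg O) :=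
  Derivation.mk'
    -- Elements of the algebra are total functions, arbitrary outside `O`. The value zero there
    -- makes linearity, the Leibniz rule and commutation hold as equalities of total functions.
    { toFun := fun f => ⟨fun q => if q ∈ O then fderiv ℝ f.1 q v else 0, by
        have h : ContDiffOn ℝ ∞ (fun q => fderiv ℝ f.1 q v) O :=
          (f.2.fderiv_of_isOpen hO (by simp)).clm_apply contDiffOn_const
        exact h.congr fun q hq => if_pos hq⟩
      map_add' := fun f g => by
        ext q
        by_cases hq : q ∈ O
        · have := fderiv_add (differentiableAt_smoothAlg hO f hq)
            (differentiableAt_smoothAlg hO g hq)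
          simp [hq, this]
        · simp [hq]
      map_smul' := fun c f => by
        ext q
        by_cases hq : q ∈ O
        · have := fderiv_const_smul (differentiableAt_smoothAlg hO f hq) c
          simp [hq, this]
        · simp [hq] }
    fun f g => by
      ext q
      by_cases hq : q ∈ O
      · have := fderiv_mul (differentiableAt_smoothAlg hO f hq)
          (differentiableAt_smoothAlg hO g hq)
        simp [hq, this]
      · simp [hq]

theorem dirDeriv_apply {O : Set E} (hO : IsOpen O) (v : E) (f : smoothAlg O) {q : E}
    (hq : q ∈ O) : (dirDeriv hO v f).1 q = fderiv ℝ f.1 q v := by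
  simp [dirDeriv, hq]

theorem dirDeriv_apply_of_notMem {O : Set E} (hO : IsOpen O) (v : E) (f : smoothAlg O) {q : E}
    (hq : q ∉ O) : (dirDeriv hO v f).1 q = 0 := by
  simp [dirDeriv, hq]

theorem dirDeriv_comm {O : Set E} (hO : IsOpen O) (v w : E) (f : smoothAlg O) :
    dirDeriv hO v (dirDeriv hO w f) = dirDeriv hO w (dirDeriv hO v f) := by
  have key : ∀ v w : E, ∀ q ∈ O, (dirDeriv hO v (dirDeriv hO w f)).1 q
      = fderiv ℝ (fderiv ℝ f.1) q v w := by
    intro v w q hq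
    rw [dirDeriv_apply hO v _ hq]
    have h1 : (dirDeriv hO w f).1 =ᶠ[𝓝 q] fun x => fderiv ℝ f.1 x w := by
      filter_upwards [hO.mem_nhds hq] with x hx
      exact dirDeriv_apply hO w f hx
    have h2 : DifferentiableAt ℝ (fderiv ℝ f.1) q :=
      (((f.2.fderiv_of_isOpen hO (m := ∞) (by simp)).differentiableOn (by simp)) q
        hq).differentiableAt (hO.mem_nhds hq)
    rw [h1.fderiv_eq, fderiv_clm_apply h2 (differentiableAt_const w)]
    simp
  ext q
  by_cases hq : q ∈ O
  · rw [key v w q hq, key w v q hq]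
    have h : IsSymmSndFDerivAt ℝ f.1 q :=
      (f.2.contDiffAt (hO.mem_nhds hq)).isSymmSndFDerivAt (by
        rw [minSmoothness_of_isRCLikeNormedField]; exact WithTop.coe_le_coe.mpr le_top)
    exact h v w
  · rw [dirDeriv_apply_of_notMem hO v _ hq, dirDeriv_apply_of_notMem hO w _ hq]

end SmoothAlgebra

/-! ### Ricci flow of matrix functions on an open subset of the model -/

section LocalFlow

variable {m n : ℕ}

/-- A smooth solution of the transverse Ricci flow in foliated coordinates. -/
structure IsLocalFlow (T : ℝ) (U : Set (Model m n))
    (G : ℝ → Model m n → Matrix (Fin n) (Fin n) ℝ) : Prop where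
  smooth : ∀ i j, ContDiffOn ℝ ∞ (fun q : ℝ × Model m n => G q.1 q.2 i j) (Icc 0 T ×ˢ U)
  posDef : ∀ t ∈ Icc 0 T, ∀ z ∈ U, (G t z).PosDef
  flow : ∀ z ∈ U, ∀ t ∈ Icc 0 T, ∀ i j,
    HasDerivWithinAt (fun s => G s z i j) (-2 * ricci (G t) z i j) (Icc 0 T) t

/-- The first transverse derivatives of a matrix function. -/
def metricJet (G : Model m n → Matrix (Fin n) (Fin n) ℝ) (z : Model m n) (i j l : Fin n) : ℝ :=
  pd i (fun w => G w j l) z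

/-- The Ricci tensor as a matrix function. -/
def ricciMatrix (G : Model m n → Matrix (Fin n) (Fin n) ℝ) (z : Model m n) :
    Matrix (Fin n) (Fin n) ℝ :=
  Matrix.of fun i j => ricci G z i j

/-- The flux in the evolution equation of the Ricci tensor. -/
def ricciFlux (G : Model m n → Matrix (Fin n) (Fin n) ℝ) (z : Model m n) (k i j : Fin n) : ℝ :=
  ∑ l, (G z)⁻¹ k l * metricJet (ricciMatrix G) z l i j
    + fluxPoly (G z)⁻¹ (metricJet G z) (ricciMatrix G z) k i j

/-- The source in the evolution equation of the Ricci tensor. -/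
def ricciSource (G : Model m n → Matrix (Fin n) (Fin n) ℝ) (z : Model m n) (i j : Fin n) : ℝ :=
  sourcePoly (G z)⁻¹ (metricJet G z) (ricciMatrix G z) (metricJet (ricciMatrix G) z) i j

section Smoothness

variable {E : Type*} [NormedAddCommGroup E] [NormedSpace ℝ E] {s : Set E}

theorem contDiffOn_det {M : E → Matrix (Fin n) (Fin n) ℝ}
    (hM : ∀ i j, ContDiffOn ℝ ∞ (fun q => M q i j) s) :
    ContDiffOn ℝ ∞ (fun q => (M q).det) s := by
  simp only [Matrix.det_apply]
  refine ContDiffOn.sum fun σ _ => ?_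
  exact (contDiffOn_prod fun i _ => hM _ _).const_smul _

theorem contDiffOn_matrix_inv {M : E → Matrix (Fin n) (Fin n) ℝ}
    (hM : ∀ i j, ContDiffOn ℝ ∞ (fun q => M q i j) s) (hdet : ∀ q ∈ s, (M q).det ≠ 0)
    (i j : Fin n) : ContDiffOn ℝ ∞ (fun q => (M q)⁻¹ i j) s := by
  simp only [Matrix.inv_def, Matrix.smul_apply, smul_eq_mul, Ring.inverse_eq_inv',
    Matrix.adjugate_apply]
  refine ((contDiffOn_det hM).inv hdet).mul (contDiffOn_det fun a b => ?_)
  simp only [Matrix.updateRow_apply]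
  split_ifs
  · exact contDiffOn_const
  · exact hM a b

end Smoothness

theorem uniqueDiffOn_slab {T : ℝ} (hT : 0 < T) {U : Set (Model m n)} (hU : IsOpen U) :
    UniqueDiffOn ℝ (Icc 0 T ×ˢ U) :=
  (uniqueDiffOn_Icc hT).prod hU.uniqueDiffOn

/-- The slices of a function smooth on a slab are smooth. -/
theorem contDiffOn_slice {T : ℝ} {U : Set (Model m n)} {F : ℝ → Model m n → ℝ}
    (hF : ContDiffOn ℝ ∞ (fun q : ℝ × Model m n => F q.1 q.2) (Icc 0 T ×ˢ U)) {t : ℝ}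
    (ht : t ∈ Icc 0 T) : ContDiffOn ℝ ∞ (F t) U :=
  hF.comp (f := fun w : Model m n => (t, w)) (contDiff_const.prodMk contDiff_id).contDiffOn
    fun _ hw => ⟨ht, hw⟩

/-- At $t=0$ and $t=T$ the slab is not a neighbourhood of the point. Reading spatial derivatives
from the derivative within the slab gives smoothness up to both end times. -/
theorem pd_eq_fderivWithin {T : ℝ} {U : Set (Model m n)} (hU : IsOpen U)
    {F : ℝ → Model m n → ℝ}
    (hF : ContDiffOn ℝ ∞ (fun q : ℝ × Model m n => F q.1 q.2) (Icc 0 T ×ˢ U))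
    {t : ℝ} (ht : t ∈ Icc 0 T) {z : Model m n} (hz : z ∈ U) (k : Fin n) :
    pd k (F t) z
      = fderivWithin ℝ (fun q : ℝ × Model m n => F q.1 q.2) (Icc 0 T ×ˢ U) (t, z)
        (0, dy m n k) := by
  have h1 := ((hF.differentiableOn (by simp)) (t, z) ⟨ht, hz⟩).hasFDerivWithinAt
  have h2 : HasFDerivAt (fun w : Model m n => (t, w))
      ((0 : Model m n →L[ℝ] ℝ).prod (ContinuousLinearMap.id ℝ (Model m n))) z :=
    (hasFDerivAt_const t z).prodMk (hasFDerivAt_id z)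
  have h3 := HasFDerivWithinAt.comp (f := fun w : Model m n => (t, w)) z h1
    (h2.hasFDerivWithinAt (s := U)) fun w hw => ⟨ht, hw⟩
  have h4 := (h3.hasFDerivAt (hU.mem_nhds hz)).fderiv
  rw [pd, show F t = (fun q : ℝ × Model m n => F q.1 q.2) ∘ fun w => (t, w) from rfl, h4]
  simp

theorem contDiffOn_pd {T : ℝ} (hT : 0 < T) {U : Set (Model m n)} (hU : IsOpen U)
    {F : ℝ → Model m n → ℝ}
    (hF : ContDiffOn ℝ ∞ (fun q : ℝ × Model m n => F q.1 q.2) (Icc 0 T ×ˢ U)) (k : Fin n) :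
    ContDiffOn ℝ ∞ (fun q : ℝ × Model m n => pd k (F q.1) q.2) (Icc 0 T ×ˢ U) := by
  have h := (hF.fderivWithin (uniqueDiffOn_slab hT hU) (m := ∞) (by simp)).clm_apply
    (contDiffOn_const (c := ((0 : ℝ), dy m n k)))
  exact h.congr fun q hq => pd_eq_fderivWithin hU hF hq.1 hq.2 k

namespace IsLocalFlow

variable {T : ℝ} {U : Set (Model m n)} {G : ℝ → Model m n → Matrix (Fin n) (Fin n) ℝ}
  (hG : IsLocalFlow T U G)

include hG

theorem isUnit_det {t : ℝ} (ht : t ∈ Icc 0 T) {z : Model m n} (hz : z ∈ U) :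
    (G t z).det ≠ 0 := (hG.posDef t ht z hz).det_pos.ne'

theorem entry_symm {t : ℝ} (ht : t ∈ Icc 0 T) {z : Model m n} (hz : z ∈ U) (i j : Fin n) :
    G t z i j = G t z j i := by
  simpa using (hG.posDef t ht z hz).isHermitian.apply j i

theorem smooth_inv (i j : Fin n) :
    ContDiffOn ℝ ∞ (fun q : ℝ × Model m n => (G q.1 q.2)⁻¹ i j) (Icc 0 T ×ˢ U) :=
  contDiffOn_matrix_inv hG.smooth (fun _ hq => hG.isUnit_det hq.1 hq.2) i j

variable (hT : 0 < T) (hU : IsOpen U)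
include hT hU

theorem smooth_jet (k i j : Fin n) :
    ContDiffOn ℝ ∞ (fun q : ℝ × Model m n => metricJet (G q.1) q.2 k i j) (Icc 0 T ×ˢ U) :=
  contDiffOn_pd (F := fun t w => G t w i j) hT hU (hG.smooth i j) k

theorem smooth_christoffel (k i j : Fin n) :
    ContDiffOn ℝ ∞ (fun q : ℝ × Model m n => christoffel (G q.1) q.2 k i j) (Icc 0 T ×ˢ U) := by
  unfold christoffel
  refine contDiffOn_const.mul (ContDiffOn.sum fun l _ => (hG.smooth_inv k l).mul ?_)
  exact ((hG.smooth_jet hT hU i j l).add (hG.smooth_jet hT hU j i l)).sub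
    (hG.smooth_jet hT hU l i j)

theorem smooth_riemann (i j k l : Fin n) :
    ContDiffOn ℝ ∞ (fun q : ℝ × Model m n => riemann (G q.1) q.2 i j k l) (Icc 0 T ×ˢ U) := by
  have hc := hG.smooth_christoffel hT hU
  unfold riemann
  refine ((contDiffOn_pd (F := fun t w => christoffel (G t) w l j k) hT hU (hc l j k) i).sub
    (contDiffOn_pd (F := fun t w => christoffel (G t) w l i k) hT hU (hc l i k) j)).add
    (ContDiffOn.sum fun p _ => ?_)
  exact ((hc _ _ _).mul (hc _ _ _)).sub ((hc _ _ _).mul (hc _ _ _))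

theorem smooth_ricci (i j : Fin n) :
    ContDiffOn ℝ ∞ (fun q : ℝ × Model m n => ricci (G q.1) q.2 i j) (Icc 0 T ×ˢ U) := by
  unfold ricci
  refine ContDiffOn.sum fun k _ => ContDiffOn.sum fun l _ => ContDiffOn.sum fun r _ => ?_
  exact ((hG.smooth_inv _ _).mul (hG.smooth_riemann hT hU _ _ _ _)).mul (hG.smooth _ _)

theorem smooth_ricciJet (k i j : Fin n) :
    ContDiffOn ℝ ∞ (fun q : ℝ × Model m n => metricJet (ricciMatrix (G q.1)) q.2 k i j)
      (Icc 0 T ×ˢ U) :=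
  contDiffOn_pd (F := fun t w => ricci (G t) w i j) hT hU (hG.smooth_ricci hT hU i j) k

end IsLocalFlow

end LocalFlow

/-! ### Evolution of the metric jets and of the Ricci tensor in foliated coordinates. -/

section Evolution

variable {m n : ℕ} {T : ℝ} {U : Set (Model m n)}

theorem dirDeriv_eq_pd {O : Set (ℝ × Model m n)} (hO : IsOpen O) (f : smoothAlg O)
    {F : ℝ → Model m n → ℝ} (h : ∀ q ∈ O, f.1 q = F q.1 q.2) (k : Fin n)
    {q : ℝ × Model m n} (hq : q ∈ O) :
    (dirDeriv hO (0, dy m n k) f).1 q = pd k (F q.1) q.2 := by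
  rw [dirDeriv_apply hO _ _ hq]
  have h1 := (differentiableAt_smoothAlg hO f hq).hasFDerivAt
  have h2 : HasFDerivAt (fun w : Model m n => (q.1, w))
      ((0 : Model m n →L[ℝ] ℝ).prod (ContinuousLinearMap.id ℝ (Model m n))) q.2 :=
    (hasFDerivAt_const q.1 q.2).prodMk (hasFDerivAt_id q.2)
  have h3 := HasFDerivAt.comp (f := fun w : Model m n => (q.1, w)) q.2 h1 h2
  have h4 : F q.1 =ᶠ[𝓝 q.2] f.1 ∘ fun w => (q.1, w) := by
    have : ∀ᶠ w in 𝓝 q.2, (q.1, w) ∈ O := h2.continuousAt.eventually (hO.mem_nhds hq)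
    filter_upwards [this] with w hw
    exact (h _ hw).symm
  rw [pd, h4.fderiv_eq, h3.fderiv]
  simp

theorem hasDerivAt_dirDeriv {O : Set (ℝ × Model m n)} (hO : IsOpen O) (f : smoothAlg O)
    {F : ℝ → Model m n → ℝ} (h : ∀ q ∈ O, f.1 q = F q.1 q.2)
    {q : ℝ × Model m n} (hq : q ∈ O) :
    HasDerivAt (fun s => F s q.2) ((dirDeriv hO (1, 0) f).1 q) q.1 := by
  rw [dirDeriv_apply hO _ _ hq]
  have h1 := (differentiableAt_smoothAlg hO f hq).hasFDerivAt
  have h2 : HasDerivAt (fun s : ℝ => (s, q.2)) ((1 : ℝ), (0 : Model m n)) q.1 :=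
    (hasDerivAt_id q.1).prodMk (hasDerivAt_const q.1 q.2)
  have h3 := HasFDerivAt.comp_hasDerivAt (f := fun s : ℝ => (s, q.2)) q.1 h1 h2
  refine h3.congr_of_eventuallyEq ?_
  have : ∀ᶠ s in 𝓝 q.1, (s, q.2) ∈ O := h2.continuousAt.eventually (hO.mem_nhds hq)
  filter_upwards [this] with s hs
  exact (h _ hs).symm

theorem isOpen_slab (hU : IsOpen U) : IsOpen (Ioo 0 T ×ˢ U) := isOpen_Ioo.prod hU

/-- A matrix function on the slab as a matrix over the algebra of smooth functions in its interior,
extended by the identity matrix. -/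
def liftMatrix (X : ℝ → Model m n → Matrix (Fin n) (Fin n) ℝ)
    (hX : ∀ i j, ContDiffOn ℝ ∞ (fun q : ℝ × Model m n => X q.1 q.2 i j) (Icc 0 T ×ˢ U)) :
    Matrix (Fin n) (Fin n) (smoothAlg (Ioo 0 T ×ˢ U)) :=
  open Classical in Matrix.of fun i j =>
    -- The identity is symmetric and its own inverse, so symmetry of the metric and the relation
    -- between metric and inverse persist off the slab, as the algebraic lemmas require.
    ⟨fun q => if q ∈ Ioo 0 T ×ˢ U then X q.1 q.2 i j else (1 : Matrix (Fin n) (Fin n) ℝ) i j,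
      ((hX i j).mono (prod_mono_left Ioo_subset_Icc_self)).congr fun _ hq => if_pos hq⟩

theorem liftMatrix_apply {X : ℝ → Model m n → Matrix (Fin n) (Fin n) ℝ}
    (hX : ∀ i j, ContDiffOn ℝ ∞ (fun q : ℝ × Model m n => X q.1 q.2 i j) (Icc 0 T ×ˢ U))
    (i j : Fin n) {q : ℝ × Model m n} (hq : q ∈ Ioo 0 T ×ˢ U) :
    (liftMatrix X hX i j).1 q = X q.1 q.2 i j := by
  simp only [liftMatrix, Matrix.of_apply, if_pos hq]

theorem liftMatrix_apply_of_notMem {X : ℝ → Model m n → Matrix (Fin n) (Fin n) ℝ}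
    (hX : ∀ i j, ContDiffOn ℝ ∞ (fun q : ℝ × Model m n => X q.1 q.2 i j) (Icc 0 T ×ˢ U))
    (i j : Fin n) {q : ℝ × Model m n} (hq : q ∉ Ioo 0 T ×ˢ U) :
    (liftMatrix X hX i j).1 q = (1 : Matrix (Fin n) (Fin n) ℝ) i j := by
  simp only [liftMatrix, Matrix.of_apply, if_neg hq]

theorem smoothAlg_sum_apply {E ι : Type*} [NormedAddCommGroup E] [NormedSpace ℝ E] {O : Set E}
    (s : Finset ι) (f : ι → smoothAlg O) (q : E) : (∑ i ∈ s, f i).1 q = ∑ i ∈ s, (f i).1 q :=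
  map_sum (evalAlg O q) f s

namespace IsLocalFlow

variable {G : ℝ → Model m n → Matrix (Fin n) (Fin n) ℝ}
  (hG : IsLocalFlow T U G) (hU : IsOpen U)

/-- The transverse derivations of the algebra of smooth functions. -/
abbrev transDeriv (hU : IsOpen U) (k : Fin n) :
    Derivation ℝ (smoothAlg (Ioo 0 T ×ˢ U)) (smoothAlg (Ioo 0 T ×ˢ U)) :=
  dirDeriv (isOpen_slab hU) (0, dy m n k)

/-- The metric over the algebra of smooth functions. -/
abbrev metricLift (hG : IsLocalFlow T U G) := liftMatrix G hG.smooth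

/-- The inverse metric over the algebra of smooth functions. -/
abbrev inverseLift (hG : IsLocalFlow T U G) := liftMatrix (fun t z => (G t z)⁻¹) hG.smooth_inv

theorem inverseLift_mul : hG.inverseLift * hG.metricLift = 1 := by
  ext i j q
  have h0 : ((1 : Matrix (Fin n) (Fin n) (smoothAlg (Ioo 0 T ×ˢ U))) i j).1 q
      = (1 : Matrix (Fin n) (Fin n) ℝ) i j := by
    by_cases h : i = j
    · subst h; simp
    · simp [Matrix.one_apply_ne h]
  rw [h0, Matrix.mul_apply, smoothAlg_sum_apply]
  by_cases hq : q ∈ Ioo 0 T ×ˢ U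
  · have h1 : (G q.1 q.2)⁻¹ * G q.1 q.2 = 1 := Matrix.nonsing_inv_mul _
      (hG.isUnit_det (Ioo_subset_Icc_self hq.1) hq.2).isUnit
    rw [← h1, Matrix.mul_apply]
    refine Finset.sum_congr rfl fun k _ => ?_
    rw [← liftMatrix_apply (X := fun t z => (G t z)⁻¹) hG.smooth_inv i k hq, ← liftMatrix_apply hG.smooth k j hq]
    rfl
  · have h1 : (1 : Matrix (Fin n) (Fin n) ℝ) * 1 = 1 := one_mul _
    conv_rhs => rw [← h1, Matrix.mul_apply]
    refine Finset.sum_congr rfl fun k _ => ?_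
    rw [← liftMatrix_apply_of_notMem (X := fun t z => (G t z)⁻¹) hG.smooth_inv i k hq,
      ← liftMatrix_apply_of_notMem hG.smooth k j hq]
    rfl

theorem metricLift_transpose : hG.metricLift.transpose = hG.metricLift := by
  ext i j q
  rw [Matrix.transpose_apply]
  by_cases hq : q ∈ Ioo 0 T ×ˢ U
  · rw [liftMatrix_apply _ _ _ hq, liftMatrix_apply _ _ _ hq,
      hG.entry_symm (Ioo_subset_Icc_self hq.1) hq.2]
  · rw [liftMatrix_apply_of_notMem _ _ _ hq, liftMatrix_apply_of_notMem _ _ _ hq]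
    simp only [Matrix.one_apply, eq_comm]

theorem jet_lift (k i j : Fin n) {q : ℝ × Model m n} (hq : q ∈ Ioo 0 T ×ˢ U) :
    (jet (transDeriv hU) hG.metricLift k i j).1 q = metricJet (G q.1) q.2 k i j :=
  dirDeriv_eq_pd (F := fun t w => G t w i j) (isOpen_slab hU) _
    (fun _ hq => liftMatrix_apply hG.smooth i j hq) k hq

theorem eval_inverseLift {q : ℝ × Model m n} (hq : q ∈ Ioo 0 T ×ˢ U) :
    hG.inverseLift.map (evalAlg (Ioo 0 T ×ˢ U) q) = (G q.1 q.2)⁻¹ := by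
  ext i j
  exact liftMatrix_apply (X := fun t z => (G t z)⁻¹) hG.smooth_inv i j hq

theorem eval_jet {q : ℝ × Model m n} (hq : q ∈ Ioo 0 T ×ˢ U) :
    (fun a b c => evalAlg (Ioo 0 T ×ˢ U) q (jet (transDeriv hU) hG.metricLift a b c))
      = metricJet (G q.1) q.2 := by
  ext a b c
  exact hG.jet_lift hU a b c hq

theorem chrPoly_lift (k i j : Fin n) {q : ℝ × Model m n} (hq : q ∈ Ioo 0 T ×ˢ U) :
    (chrPoly hG.inverseLift (jet (transDeriv hU) hG.metricLift) k i j).1 q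
      = christoffel (G q.1) q.2 k i j := by
  rw [← evalAlg_apply, map_chrPoly, hG.eval_inverseLift hq, hG.eval_jet hU hq]
  rfl

theorem curvMatrix_lift (i j k l : Fin n) {q : ℝ × Model m n} (hq : q ∈ Ioo 0 T ×ˢ U) :
    (curvMatrix (transDeriv hU) hG.metricLift hG.inverseLift i j l k).1 q
      = riemann (G q.1) q.2 i j k l := by
  have h : ∀ i l j k, (transDeriv (T := T) hU i
      (chrPoly hG.inverseLift (jet (transDeriv hU) hG.metricLift) l j k)).1 q
      = pd i (fun w => christoffel (G q.1) w l j k) q.2 := fun i l j k =>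
    dirDeriv_eq_pd (F := fun t w => christoffel (G t) w l j k) (isOpen_slab hU) _
      (fun _ hq => hG.chrPoly_lift hU l j k hq) i hq
  rw [← evalAlg_apply]
  simp only [curvMatrix, Matrix.add_apply, Matrix.sub_apply, Matrix.map_apply, Matrix.mul_apply,
    connMatrix, Matrix.of_apply, map_add, map_sub, map_sum, map_mul]
  simp only [evalAlg_apply, h, hG.chrPoly_lift hU _ _ _ hq]
  rw [riemann, Finset.sum_sub_distrib]
  simp only [mul_comm]

theorem algRicci_lift (i j : Fin n) {q : ℝ × Model m n} (hq : q ∈ Ioo 0 T ×ˢ U) :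
    (algRicci (transDeriv hU) hG.metricLift hG.inverseLift i j).1 q = ricci (G q.1) q.2 i j := by
  rw [← evalAlg_apply]
  simp only [algRicci, Matrix.of_apply, map_sum, map_mul]
  simp only [evalAlg_apply, hG.curvMatrix_lift hU _ _ _ _ hq, liftMatrix_apply _ _ _ hq]
  rfl

theorem flow_lift (i j : Fin n) : dirDeriv (isOpen_slab hU) (1, 0) (hG.metricLift i j)
    = (-2 : ℝ) • algRicci (transDeriv hU) hG.metricLift hG.inverseLift i j := by
  ext q
  by_cases hq : q ∈ Ioo 0 T ×ˢ U
  · have h1 := hasDerivAt_dirDeriv (F := fun t w => G t w i j) (isOpen_slab hU) _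
      (fun _ hq => liftMatrix_apply hG.smooth i j hq) hq
    have h2 := (hG.flow q.2 hq.2 q.1 (Ioo_subset_Icc_self hq.1) i j).hasDerivAt
      (Icc_mem_nhds hq.1.1 hq.1.2)
    rw [h1.unique h2, ← hG.algRicci_lift hU i j hq]
    rfl
  -- Off the slab every derivation gives zero, hence so do the Christoffel symbols, the curvature
  -- and both sides of the flow equation.
  · rw [dirDeriv_apply_of_notMem _ _ _ hq]
    have h2 : evalAlg (Ioo 0 T ×ˢ U) q
        (algRicci (transDeriv hU) hG.metricLift hG.inverseLift i j) = 0 := by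
      have h3 : ∀ k f, evalAlg (Ioo 0 T ×ˢ U) q (transDeriv hU k f) = 0 := fun k f =>
        dirDeriv_apply_of_notMem (isOpen_slab hU) _ _ hq
      have h4 : (fun a b c => evalAlg (Ioo 0 T ×ˢ U) q
          (jet (transDeriv hU) hG.metricLift a b c)) = fun _ _ _ => 0 := by
        ext a b c; exact h3 _ _
      simp only [algRicci, curvMatrix, connMatrix, Matrix.of_apply, Matrix.add_apply,
        Matrix.sub_apply, Matrix.map_apply, Matrix.mul_apply, map_sum, map_mul, map_add, map_sub,
        h3, map_chrPoly, h4]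
      simp [chrPoly]
    rw [← evalAlg_apply _ _ ((-2 : ℝ) • _), map_smul, h2, smul_zero]

/-- The flow identifies the Ricci tensor with $-\tfrac12\tau G$, and `G` is symmetric. The first
Bianchi identity is thereby avoided. -/
theorem algRicci_symm (i j : Fin n) :
    algRicci (transDeriv hU) hG.metricLift hG.inverseLift i j
      = algRicci (transDeriv hU) hG.metricLift hG.inverseLift j i := by
  have h1 := hG.flow_lift hU i j
  have h2 := hG.flow_lift hU j i
  have hs : hG.metricLift i j = hG.metricLift j i :=
    congrFun (congrFun hG.metricLift_transpose.symm i) j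
  rw [hs, h2] at h1
  have h3 := congrArg (fun x => (-1 / 2 : ℝ) • x) h1
  simpa [smul_smul] using h3.symm

include hG hU in
/-- Evolution of the first derivatives of the metric. -/
theorem hasDerivAt_jet {t : ℝ} (ht : t ∈ Ioo 0 T) {z : Model m n} (hz : z ∈ U) (k i j : Fin n) :
    HasDerivAt (fun s => metricJet (G s) z k i j)
      (-2 * metricJet (ricciMatrix (G t)) z k i j) t := by
  have hq : (t, z) ∈ Ioo 0 T ×ˢ U := ⟨ht, hz⟩
  have h1 := hasDerivAt_dirDeriv (F := fun t w => metricJet (G t) w k i j) (isOpen_slab hU) _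
    (fun _ hq => hG.jet_lift hU k i j hq) hq
  convert h1 using 1
  rw [jet, dirDeriv_comm, hG.flow_lift hU, Derivation.map_smul, ← evalAlg_apply, map_smul,
    smul_eq_mul, evalAlg_apply, dirDeriv_eq_pd (F := fun t w => ricci (G t) w i j) (isOpen_slab hU)
    _ (fun _ hq => hG.algRicci_lift hU i j hq) k hq]
  rfl

include hG hU in
/-- Evolution of the Ricci tensor, in divergence form. -/
theorem hasDerivAt_ricci {t : ℝ} (ht : t ∈ Ioo 0 T) {z : Model m n} (hz : z ∈ U) (i j : Fin n) :
    HasDerivAt (fun s => ricci (G s) z i j)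
      (∑ k, pd k (fun w => ricciFlux (G t) w k i j) z + ricciSource (G t) z i j) t := by
  have hq : (t, z) ∈ Ioo 0 T ×ˢ U := ⟨ht, hz⟩
  have h1 := hasDerivAt_dirDeriv (F := fun t w => ricci (G t) w i j) (isOpen_slab hU) _
    (fun _ hq => hG.algRicci_lift hU i j hq) hq
  convert h1 using 1
  rw [time_deriv_algRicci (transDeriv hU) hG.metricLift hG.inverseLift
    (fun i j a => dirDeriv_comm _ _ _ a) (dirDeriv (isOpen_slab hU) (1, 0))
    (fun i a => dirDeriv_comm _ _ _ a) hG.metricLift_transpose hG.inverseLift_mul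
    (hG.algRicci_symm hU) (hG.flow_lift hU), ← evalAlg_apply, map_add, map_sum]
  have hr : ∀ q ∈ Ioo 0 T ×ˢ U,
      (algRicci (transDeriv hU) hG.metricLift hG.inverseLift).map (evalAlg (Ioo 0 T ×ˢ U) q)
        = ricciMatrix (G q.1) q.2 := by
    intro q hq
    ext a b
    exact hG.algRicci_lift hU a b hq
  have hdr : ∀ a b c, ∀ q ∈ Ioo 0 T ×ˢ U, evalAlg (Ioo 0 T ×ˢ U) q
      (jet (transDeriv hU) (algRicci (transDeriv hU) hG.metricLift hG.inverseLift) a b c)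
        = metricJet (ricciMatrix (G q.1)) q.2 a b c := by
    intro a b c q hq
    exact dirDeriv_eq_pd (F := fun t w => ricci (G t) w b c) (isOpen_slab hU) _
      (fun _ hq => hG.algRicci_lift hU b c hq) a hq
  congr 1
  · refine Finset.sum_congr rfl fun k _ => ?_
    rw [evalAlg_apply, dirDeriv_eq_pd (F := fun t w => ricciFlux (G t) w k i j) (isOpen_slab hU)
      _ _ k hq]
    intro q hq
    rw [← evalAlg_apply, map_add, map_fluxPoly, hG.eval_inverseLift hq, hG.eval_jet hU hq, hr q hq,
      map_sum, ricciFlux]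
    congr 1
    refine Finset.sum_congr rfl fun l _ => ?_
    rw [map_mul, ← hdr l i j q hq]
    congr 1
    exact liftMatrix_apply (X := fun t z => (G t z)⁻¹) hG.smooth_inv k l hq
  · rw [map_sourcePoly, hG.eval_inverseLift hq, hG.eval_jet hU hq, hr _ hq, ricciSource]
    congr 1
    ext a b c
    exact (hdr a b c _ hq).symm

end IsLocalFlow

end Evolution

/-! ### Integrals with a cutoff function -/

section Cutoff

variable {E : Type*} [NormedAddCommGroup E] [NormedSpace ℝ E]

theorem contDiff_mul_of_tsupport_subset {σ f : E → ℝ} {U : Set E} (hU : IsOpen U)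
    (hσ : ContDiff ℝ ∞ σ) (hs : tsupport σ ⊆ U) (hf : ContDiffOn ℝ ∞ f U) :
    ContDiff ℝ ∞ fun z => σ z * f z := by
  refine contDiff_iff_contDiffAt.mpr fun z => ?_
  by_cases hz : z ∈ U
  · exact hσ.contDiffAt.mul (hf.contDiffAt (hU.mem_nhds hz))
  · have hz' : z ∉ tsupport σ := fun h => hz (hs h)
    refine (contDiffAt_const (c := (0 : ℝ))).congr_of_eventuallyEq ?_
    filter_upwards [(isClosed_tsupport σ).isOpen_compl.mem_nhds hz'] with w hw
    simp [image_eq_zero_of_notMem_tsupport hw]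

omit [NormedSpace ℝ E] in
theorem continuous_mul_of_tsupport_subset {σ f : E → ℝ} {U : Set E} (hU : IsOpen U)
    (hσ : Continuous σ) (hs : tsupport σ ⊆ U) (hf : ContinuousOn f U) :
    Continuous fun z => σ z * f z := by
  refine continuous_of_tsupport fun z hz => ?_
  have hzU : z ∈ U := hs (closure_mono (Function.support_mul_subset_left σ f) hz)
  exact hσ.continuousAt.mul (hf.continuousAt (hU.mem_nhds hzU))

variable [MeasurableSpace E] [BorelSpace E] (μ : Measure E)
  [IsFiniteMeasureOnCompacts μ]

omit [NormedSpace ℝ E] in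
theorem integrable_cutoff_mul {σ f : E → ℝ} {U : Set E} (hU : IsOpen U)
    (hσ : Continuous σ) (hc : HasCompactSupport σ) (hs : tsupport σ ⊆ U) (hf : ContinuousOn f U) :
    Integrable (fun z => σ z * f z) μ :=
  (continuous_mul_of_tsupport_subset hU hσ hs hf).integrable_of_hasCompactSupport hc.mul_right

variable {T : ℝ} {U : Set E} {σ : E → ℝ} {L : ℝ → E → ℝ}

-- The cutoff extends the integrand by zero to a continuous one with fixed compact support. The end
-- times are included because Grönwall's argument starts at $t=0$.
omit [NormedSpace ℝ E] in
theorem continuousOn_integral_cutoff_mul (hU : IsOpen U) (hσ : Continuous σ)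
    (hc : HasCompactSupport σ) (hs : tsupport σ ⊆ U)
    (hL : ContinuousOn (fun q : ℝ × E => L q.1 q.2) (Icc 0 T ×ˢ U)) :
    ContinuousOn (fun t => ∫ z, σ z * L t z ∂μ) (Icc 0 T) := by
  refine continuousOn_integral_of_compact_support hc ?_ ?_
  · rintro ⟨t, z⟩ ⟨ht, -⟩
    by_cases hz : z ∈ U
    · have h1 : ContinuousWithinAt (fun q : ℝ × E => σ q.2 * L q.1 q.2) (Icc 0 T ×ˢ U) (t, z) :=
        (hσ.comp continuous_snd).continuousWithinAt.mul (hL (t, z) ⟨ht, hz⟩)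
      refine h1.mono_of_mem_nhdsWithin ?_
      have h2 : (univ ×ˢ U : Set (ℝ × E)) ∈ 𝓝 (t, z) :=
        (isOpen_univ.prod hU).mem_nhds ⟨mem_univ _, hz⟩
      filter_upwards [self_mem_nhdsWithin, mem_nhdsWithin_of_mem_nhds h2] with q hq1 hq2
      exact ⟨hq1.1, hq2.2⟩
    · have hz' : z ∉ tsupport σ := fun h => hz (hs h)
      have h2 : (univ ×ˢ (tsupport σ)ᶜ : Set (ℝ × E)) ∈ 𝓝 (t, z) :=
        (isOpen_univ.prod (isClosed_tsupport σ).isOpen_compl).mem_nhds ⟨mem_univ _, hz'⟩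
      refine ContinuousAt.continuousWithinAt ?_
      refine (continuousAt_const (y := (0 : ℝ))).congr ?_
      filter_upwards [h2] with q hq
      simp [Function.uncurry, image_eq_zero_of_notMem_tsupport hq.2]
  · intro t z _ hz
    simp [image_eq_zero_of_notMem_tsupport hz]

/-- Differentiation under the integral. The dominating function is $|\sigma|$ times a bound for the
time derivative on the compact set $[0,T]\times\operatorname{supp}\sigma$. -/
theorem hasDerivAt_integral_cutoff_mul (hT : 0 < T) (hU : IsOpen U) (hσ : Continuous σ)
    (hc : HasCompactSupport σ) (hs : tsupport σ ⊆ U)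
    (hL : ContDiffOn ℝ ∞ (fun q : ℝ × E => L q.1 q.2) (Icc 0 T ×ˢ U)) {t : ℝ}
    (ht : t ∈ Ioo 0 T) {L' : E → ℝ} (hL' : ∀ z ∈ U, HasDerivAt (fun s => L s z) (L' z) t) :
    HasDerivAt (fun s => ∫ z, σ z * L s z ∂μ) (∫ z, σ z * L' z ∂μ) t := by
  set W : Set (ℝ × E) := Icc 0 T ×ˢ U with hW
  have hWu : UniqueDiffOn ℝ W := (uniqueDiffOn_Icc hT).prod hU.uniqueDiffOn
  set dL : ℝ → E → ℝ := fun s z => fderivWithin ℝ (fun q : ℝ × E => L q.1 q.2) W (s, z) (1, 0)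
    with hdL
  have hdLc : ContinuousOn (fun q : ℝ × E => dL q.1 q.2) W :=
    ((hL.fderivWithin hWu (m := ∞) (by simp)).clm_apply
      (contDiffOn_const (c := ((1 : ℝ), (0 : E))))).continuousOn
  have hd : ∀ s ∈ Ioo 0 T, ∀ z ∈ U, HasDerivAt (fun s => L s z) (dL s z) s := by
    intro s hs z hz
    have h1 := ((hL.differentiableOn (by simp)) (s, z)
      ⟨Ioo_subset_Icc_self hs, hz⟩).hasFDerivWithinAt
    have h2 := h1.hasFDerivAt (prod_mem_nhds (Icc_mem_nhds hs.1 hs.2) (hU.mem_nhds hz))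
    exact h2.comp_hasDerivAt (f := fun s : ℝ => (s, z)) s
      ((hasDerivAt_id s).prodMk (hasDerivAt_const s z))
  have heq : (fun z => σ z * L' z) = fun z => σ z * dL t z := by
    ext z
    by_cases hz : z ∈ U
    · rw [(hL' z hz).unique (hd t ht z hz)]
    · simp [image_eq_zero_of_notMem_tsupport fun h => hz (hs h)]
  rw [heq]
  obtain ⟨C, hC⟩ := (isCompact_Icc.prod hc).exists_bound_of_continuousOn
    (hdLc.mono (prod_mono_right hs))
  have hLt : ∀ s ∈ Ioo 0 T, ContinuousOn (L s) U := fun s hs =>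
    hL.continuousOn.comp (f := fun w : E => (s, w)) (by fun_prop)
      fun w hw => ⟨Ioo_subset_Icc_self hs, hw⟩
  refine (hasDerivAt_integral_of_dominated_loc_of_deriv_le (𝕜 := ℝ)
    (bound := fun z => |σ z| * C) (F' := fun s z => σ z * dL s z)
    (Ioo_mem_nhds ht.1 ht.2) ?_ ?_ ?_ ?_ ?_ ?_).2
  · filter_upwards [Ioo_mem_nhds ht.1 ht.2] with s hs'
    exact (integrable_cutoff_mul μ hU hσ hc hs (hLt s hs')).aestronglyMeasurable
  · exact integrable_cutoff_mul μ hU hσ hc hs (hLt t ht)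
  · refine (integrable_cutoff_mul μ hU hσ hc hs ?_).aestronglyMeasurable
    exact hdLc.comp (f := fun w : E => (t, w)) (by fun_prop)
      fun w hw => ⟨Ioo_subset_Icc_self ht, hw⟩
  · refine Filter.Eventually.of_forall fun z s hs' => ?_
    by_cases hz : z ∈ tsupport σ
    · have h1 := hC (s, z) ⟨Ioo_subset_Icc_self hs', hz⟩
      rw [norm_mul, Real.norm_eq_abs (σ z)]
      exact mul_le_mul_of_nonneg_left h1 (abs_nonneg _)
    · simp [image_eq_zero_of_notMem_tsupport hz]
  · exact ((hσ.integrable_of_hasCompactSupport hc).abs).mul_const C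
  · refine Filter.Eventually.of_forall fun z s hs' => ?_
    by_cases hz : z ∈ U
    · exact (hd s hs' z hz).const_mul _
    · simp only [image_eq_zero_of_notMem_tsupport fun h => hz (hs h), zero_mul]
      exact hasDerivAt_const _ _

omit [IsFiniteMeasureOnCompacts μ] in
/-- Integration by parts against a squared cutoff function. -/
theorem integral_cutoff_sq_mul_fderiv [FiniteDimensional ℝ E] [μ.IsAddHaarMeasure] {b X : E → ℝ}
    (hU : IsOpen U) (hσ : ContDiff ℝ ∞ σ) (hc : HasCompactSupport σ) (hs : tsupport σ ⊆ U)
    (hb : ContDiffOn ℝ ∞ b U) (hX : ContDiffOn ℝ ∞ X U) (v : E) :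
    ∫ z, σ z ^ 2 * (b z * fderiv ℝ X z v) ∂μ
      = ∫ z, σ z * (-((σ z * fderiv ℝ b z v + 2 * fderiv ℝ σ z v * b z) * X z)) ∂μ := by
  set f : E → ℝ := fun z => σ z * (σ z * b z) with hf
  have hfs : ContDiff ℝ ∞ f :=
    contDiff_mul_of_tsupport_subset hU hσ hs (hσ.contDiffOn.mul hb)
  have hft : tsupport f ⊆ tsupport σ := closure_mono (Function.support_mul_subset_left σ _)
  have hfc : HasCompactSupport f := hc.mul_right
  have hX' : ContDiffOn ℝ ∞ (fun z => fderiv ℝ X z v) U :=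
    (hX.fderiv_of_isOpen hU (m := ∞) (by simp)).clm_apply contDiffOn_const
  -- Because the cutoff is squared, a factor `σ` survives even where the derivative falls on it.
  -- That factor stays with `X` and later allows the gradient inside the flux to be absorbed.
  have hf' : ∀ z, fderiv ℝ f z v = σ z * (σ z * fderiv ℝ b z v + 2 * fderiv ℝ σ z v * b z) := by
    intro z
    by_cases hz : z ∈ U
    · have hσd : DifferentiableAt ℝ σ z := hσ.differentiable (by simp) z
      have hbd : DifferentiableAt ℝ b z :=
        (hb.differentiableOn (by simp) z hz).differentiableAt (hU.mem_nhds hz)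
      rw [hf, fderiv_fun_mul hσd (hσd.fun_mul hbd), fderiv_fun_mul hσd hbd]
      simp only [add_apply, smul_apply, smul_eq_mul]
      ring
    · have hz' : z ∉ tsupport σ := fun h => hz (hs h)
      have : f =ᶠ[𝓝 z] fun _ => 0 := by
        filter_upwards [(isClosed_tsupport σ).isOpen_compl.mem_nhds hz'] with w hw
        simp [hf, image_eq_zero_of_notMem_tsupport hw]
      rw [this.fderiv_eq]
      simp [image_eq_zero_of_notMem_tsupport hz']
  have h := integral_mul_fderiv_eq_neg_fderiv_mul_of_integrable (μ := μ) (f := f) (g := X) (v := v)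
    ?_ ?_ ?_ ?_ ?_
  · rw [← integral_neg] at h
    have e1 : (fun z => σ z ^ 2 * (b z * fderiv ℝ X z v)) = fun z => f z * fderiv ℝ X z v := by
      ext z; simp only [hf]; ring
    have e2 : (fun z => σ z * (-((σ z * fderiv ℝ b z v + 2 * fderiv ℝ σ z v * b z) * X z)))
        = fun z => -(fderiv ℝ f z v * X z) := by
      ext z; rw [hf']; ring
    rw [e1, e2]
    exact h
  · exact integrable_cutoff_mul μ hU (by
      have := hfs.fderiv_right (m := ∞) (by simp)
      exact (this.clm_apply contDiff_const).continuous) (hfc.fderiv_apply ℝ v)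
      ((tsupport_fderiv_apply_subset ℝ v).trans (hft.trans hs)) hX.continuousOn
  · exact integrable_cutoff_mul μ hU hfs.continuous hfc (hft.trans hs) hX'.continuousOn
  · exact integrable_cutoff_mul μ hU hfs.continuous hfc (hft.trans hs) hX.continuousOn
  · exact fun z _ => hfs.differentiable (by simp) z
  · intro z hz
    have hzU := hs (hft hz)
    exact (hX.differentiableOn (by simp) z hzU).differentiableAt (hU.mem_nhds hzU)

end Cutoff

/-! ### The local energy inequality -/

section LocalEnergy

variable {m n : ℕ}

/-- The energy density of the difference of two metrics in foliated coordinates. -/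
def locEn (G H : Model m n → Matrix (Fin n) (Fin n) ℝ) (z : Model m n) : ℝ :=
  ∑ i, ∑ j, ((G z i j - H z i j) ^ 2
    + ∑ k, (metricJet G z k i j - metricJet H z k i j) ^ 2 + (ricci G z i j - ricci H z i j) ^ 2)

/-- The squared norm of the first derivatives of the difference of the Ricci tensors. -/
def locGrad (G H : Model m n → Matrix (Fin n) (Fin n) ℝ) (z : Model m n) : ℝ :=
  ∑ i, ∑ j, ∑ k, (metricJet (ricciMatrix G) z k i j - metricJet (ricciMatrix H) z k i j) ^ 2

theorem locEn_term_le (G H : Model m n → Matrix (Fin n) (Fin n) ℝ) (z : Model m n)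
    (i j : Fin n) :
    (G z i j - H z i j) ^ 2 + ∑ k, (metricJet G z k i j - metricJet H z k i j) ^ 2
      + (ricci G z i j - ricci H z i j) ^ 2 ≤ locEn G H z := by
  unfold locEn
  refine le_trans ?_ (Finset.single_le_sum (f := fun i => ∑ j, ((G z i j - H z i j) ^ 2
    + ∑ k, (metricJet G z k i j - metricJet H z k i j) ^ 2 + (ricci G z i j - ricci H z i j) ^ 2))
    (fun i _ => ?_) (Finset.mem_univ i))
  · exact Finset.single_le_sum (f := fun j => ((G z i j - H z i j) ^ 2
      + ∑ k, (metricJet G z k i j - metricJet H z k i j) ^ 2 + (ricci G z i j - ricci H z i j) ^ 2))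
      (fun j _ => by positivity) (Finset.mem_univ j)
  · positivity

theorem locEn_nonneg (G H : Model m n → Matrix (Fin n) (Fin n) ℝ) (z : Model m n) :
    0 ≤ locEn G H z := by
  unfold locEn; positivity

theorem abs_metric_sub_le (G H : Model m n → Matrix (Fin n) (Fin n) ℝ) (z : Model m n)
    (i j : Fin n) : |G z i j - H z i j| ≤ √(locEn G H z) := by
  refine Real.abs_le_sqrt (le_trans ?_ (locEn_term_le G H z i j))
  have h1 : 0 ≤ ∑ k, (metricJet G z k i j - metricJet H z k i j) ^ 2 := by positivity
  have h2 := sq_nonneg (ricci G z i j - ricci H z i j)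
  linarith

theorem abs_jet_sub_le (G H : Model m n → Matrix (Fin n) (Fin n) ℝ) (z : Model m n)
    (k i j : Fin n) : |metricJet G z k i j - metricJet H z k i j| ≤ √(locEn G H z) := by
  refine Real.abs_le_sqrt (le_trans ?_ (locEn_term_le G H z i j))
  have h1 := Finset.single_le_sum (f := fun k => (metricJet G z k i j - metricJet H z k i j) ^ 2)
    (fun k _ => sq_nonneg _) (Finset.mem_univ k)
  have h2 := sq_nonneg (ricci G z i j - ricci H z i j)
  have h3 := sq_nonneg (G z i j - H z i j)
  linarith [h1]

theorem abs_ricci_sub_le (G H : Model m n → Matrix (Fin n) (Fin n) ℝ) (z : Model m n)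
    (i j : Fin n) : |ricci G z i j - ricci H z i j| ≤ √(locEn G H z) := by
  refine Real.abs_le_sqrt (le_trans ?_ (locEn_term_le G H z i j))
  have h1 : 0 ≤ ∑ k, (metricJet G z k i j - metricJet H z k i j) ^ 2 := by positivity
  have h2 := sq_nonneg (G z i j - H z i j)
  linarith

theorem abs_ricciJet_sub_le (G H : Model m n → Matrix (Fin n) (Fin n) ℝ) (z : Model m n)
    (k i j : Fin n) :
    |metricJet (ricciMatrix G) z k i j - metricJet (ricciMatrix H) z k i j|
      ≤ √(locGrad G H z) := by
  refine Real.abs_le_sqrt ?_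
  unfold locGrad
  refine le_trans ?_ (Finset.single_le_sum (f := fun i => ∑ j, ∑ k,
    (metricJet (ricciMatrix G) z k i j - metricJet (ricciMatrix H) z k i j) ^ 2)
    (fun i _ => by positivity) (Finset.mem_univ i))
  refine le_trans ?_ (Finset.single_le_sum (f := fun j => ∑ k,
    (metricJet (ricciMatrix G) z k i j - metricJet (ricciMatrix H) z k i j) ^ 2)
    (fun i _ => by positivity) (Finset.mem_univ j))
  exact Finset.single_le_sum (f := fun k =>
    (metricJet (ricciMatrix G) z k i j - metricJet (ricciMatrix H) z k i j) ^ 2)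
    (fun i _ => by positivity) (Finset.mem_univ k)

/-- Mean value inequality on a ball. It is applied to the flux and source polynomials, whose
arguments stay bounded over a compact part of the slab. -/
theorem exists_lipschitz_bound {X Y : Type*} [NormedAddCommGroup X] [NormedSpace ℝ X]
    [ProperSpace X] [NormedAddCommGroup Y] [NormedSpace ℝ Y] {f : X → Y} (hf : ContDiff ℝ ∞ f)
    (R : ℝ) : ∃ C, 0 ≤ C ∧ ∀ x y, ‖x‖ ≤ R → ‖y‖ ≤ R → ‖f x - f y‖ ≤ C * ‖x - y‖ := by
  obtain ⟨C, hC⟩ := (isCompact_closedBall (0 : X) R).exists_bound_of_continuousOn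
    (hf.continuous_fderiv (by simp)).continuousOn
  refine ⟨max C 0, le_max_right _ _, fun x y hx hy => ?_⟩
  refine (convex_closedBall (0 : X) R).norm_image_sub_le_of_norm_fderiv_le (𝕜 := ℝ)
    (fun z _ => hf.differentiable (by simp) z) (fun z hz => (hC z hz).trans (le_max_left _ _))
    ?_ ?_
  · simpa using hy
  · simpa using hx

/-- The space of the quantities entering the lower order terms. -/
abbrev StateSpace (n : ℕ) : Type :=
  (Fin n → Fin n → ℝ) × (Fin n → Fin n → Fin n → ℝ) × (Fin n → Fin n → ℝ)
    × (Fin n → Fin n → Fin n → ℝ)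

theorem contDiff_chrPoly (k i j : Fin n) {E : Type*} [NormedAddCommGroup E] [NormedSpace ℝ E]
    {u : E → Matrix (Fin n) (Fin n) ℝ} {D : E → Fin n → Fin n → Fin n → ℝ}
    (hu : ∀ a b, ContDiff ℝ ∞ fun x => u x a b) (hD : ∀ a b c, ContDiff ℝ ∞ fun x => D x a b c) :
    ContDiff ℝ ∞ fun x => chrPoly (u x) (D x) k i j := by
  unfold chrPoly
  exact (ContDiff.sum fun l _ => (hu _ _).mul (((hD _ _ _).add (hD _ _ _)).sub
    (hD _ _ _))).const_smul _

theorem contDiff_chrDotPoly (k i j : Fin n) {E : Type*} [NormedAddCommGroup E] [NormedSpace ℝ E]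
    {u : E → Matrix (Fin n) (Fin n) ℝ} {D : E → Fin n → Fin n → Fin n → ℝ}
    {r : E → Matrix (Fin n) (Fin n) ℝ}
    (hu : ∀ a b, ContDiff ℝ ∞ fun x => u x a b) (hD : ∀ a b c, ContDiff ℝ ∞ fun x => D x a b c)
    (hr : ∀ a b, ContDiff ℝ ∞ fun x => r x a b) :
    ContDiff ℝ ∞ fun x => chrDotPoly (u x) (D x) (r x) k i j := by
  unfold chrDotPoly
  refine (contDiff_chrPoly k i j (fun a b => ?_) hD).const_smul _
  simp only [Matrix.mul_apply]
  exact ContDiff.sum fun l _ => (ContDiff.sum fun l _ => (hu _ _).mul (hr _ _)).mul (hu _ _)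

theorem contDiff_bianchiPoly (i : Fin n) {E : Type*} [NormedAddCommGroup E] [NormedSpace ℝ E]
    {u : E → Matrix (Fin n) (Fin n) ℝ} {D : E → Fin n → Fin n → Fin n → ℝ}
    {r : E → Matrix (Fin n) (Fin n) ℝ}
    (hu : ∀ a b, ContDiff ℝ ∞ fun x => u x a b) (hD : ∀ a b c, ContDiff ℝ ∞ fun x => D x a b c)
    (hr : ∀ a b, ContDiff ℝ ∞ fun x => r x a b) :
    ContDiff ℝ ∞ fun x => bianchiPoly (u x) (D x) (r x) i := by
  unfold bianchiPoly
  exact ContDiff.sum fun j _ => ContDiff.sum fun k _ => ContDiff.sum fun l _ =>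
    (hu _ _).mul ((hr _ _).mul (contDiff_chrPoly _ _ _ hu hD))

theorem contDiff_fluxPoly (k i j : Fin n) {E : Type*} [NormedAddCommGroup E] [NormedSpace ℝ E]
    {u : E → Matrix (Fin n) (Fin n) ℝ} {D : E → Fin n → Fin n → Fin n → ℝ}
    {r : E → Matrix (Fin n) (Fin n) ℝ}
    (hu : ∀ a b, ContDiff ℝ ∞ fun x => u x a b) (hD : ∀ a b c, ContDiff ℝ ∞ fun x => D x a b c)
    (hr : ∀ a b, ContDiff ℝ ∞ fun x => r x a b) :
    ContDiff ℝ ∞ fun x => fluxPoly (u x) (D x) (r x) k i j := by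
  unfold fluxPoly
  refine ((contDiff_chrDotPoly k i j hu hD hr).sub ?_).sub ?_
  · split_ifs
    · exact (ContDiff.sum fun l _ => contDiff_chrDotPoly _ _ _ hu hD hr).add
        (contDiff_bianchiPoly _ hu hD hr)
    · exact contDiff_const
  · split_ifs
    · exact contDiff_bianchiPoly _ hu hD hr
    · exact contDiff_const

theorem contDiff_sourcePoly (i j : Fin n) {E : Type*} [NormedAddCommGroup E] [NormedSpace ℝ E]
    {u : E → Matrix (Fin n) (Fin n) ℝ} {D dr : E → Fin n → Fin n → Fin n → ℝ}
    {r : E → Matrix (Fin n) (Fin n) ℝ}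
    (hu : ∀ a b, ContDiff ℝ ∞ fun x => u x a b) (hD : ∀ a b c, ContDiff ℝ ∞ fun x => D x a b c)
    (hr : ∀ a b, ContDiff ℝ ∞ fun x => r x a b)
    (hdr : ∀ a b c, ContDiff ℝ ∞ fun x => dr x a b c) :
    ContDiff ℝ ∞ fun x => sourcePoly (u x) (D x) (r x) (dr x) i j := by
  have h1 : ∀ k i j, ContDiff ℝ ∞ fun x => chrPoly (u x) (D x) k i j := fun k i j =>
    contDiff_chrPoly k i j hu hD
  have h2 : ∀ k i j, ContDiff ℝ ∞ fun x => chrPoly (u x) (dr x) k i j := fun k i j =>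
    contDiff_chrPoly k i j hu hdr
  have h3 : ∀ k i j, ContDiff ℝ ∞ fun x => chrDotPoly (u x) (D x) (r x) k i j := fun k i j =>
    contDiff_chrDotPoly k i j hu hD hr
  have h4 : ∀ k i j, ContDiff ℝ ∞ fun x => invJetPoly (u x) (D x) k i j := fun k i j => by
    unfold invJetPoly
    exact (ContDiff.sum fun b _ => (ContDiff.sum fun a _ => (hu _ _).mul (hD _ _ _)).mul
      (hu _ _)).neg
  unfold sourcePoly quadDotPoly
  fun_prop

/-- The quantities entering the lower order terms, at a point. -/
def stateVec (G : Model m n → Matrix (Fin n) (Fin n) ℝ) (z : Model m n) : StateSpace n :=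
  (fun i j => (G z)⁻¹ i j, metricJet G z, fun i j => ricci G z i j, metricJet (ricciMatrix G) z)

theorem inv_sub_inv_apply {X Y : Matrix (Fin n) (Fin n) ℝ} (hX : X.det ≠ 0) (hY : Y.det ≠ 0)
    (k l : Fin n) :
    X⁻¹ k l - Y⁻¹ k l = ∑ b, (∑ a, X⁻¹ k a * (Y a b - X a b)) * Y⁻¹ b l := by
  have h : X⁻¹ - Y⁻¹ = X⁻¹ * (Y - X) * Y⁻¹ := by
    rw [mul_sub, sub_mul, mul_assoc, Matrix.mul_nonsing_inv _ hY.isUnit,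
      Matrix.nonsing_inv_mul _ hX.isUnit, mul_one, one_mul]
  have := congrFun (congrFun h k) l
  simpa [Matrix.mul_apply] using this

/-- From $X^{-1}-Y^{-1}=X^{-1}(Y-X)Y^{-1}$. Hence the energy needs no separate term for the
difference of the inverse metrics. -/
theorem abs_inv_sub_inv_le {X Y : Matrix (Fin n) (Fin n) ℝ} (hX : X.det ≠ 0) (hY : Y.det ≠ 0)
    {R ρ : ℝ} (hρ : 0 ≤ ρ) (hXR : ∀ k l, |X⁻¹ k l| ≤ R) (hYR : ∀ k l, |Y⁻¹ k l| ≤ R)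
    (h : ∀ k l, |X k l - Y k l| ≤ ρ) (k l : Fin n) :
    |X⁻¹ k l - Y⁻¹ k l| ≤ n * (n * (R * R)) * ρ := by
  have hR : 0 ≤ R := (abs_nonneg _).trans (hXR k l)
  rw [inv_sub_inv_apply hX hY]
  have h1 : ∀ b, |(∑ a, X⁻¹ k a * (Y a b - X a b)) * Y⁻¹ b l| ≤ n * (R * R) * ρ := by
    intro b
    have h2 : |∑ a, X⁻¹ k a * (Y a b - X a b)| ≤ n * (R * ρ) := by
      refine (Finset.abs_sum_le_sum_abs _ _).trans ?_
      refine (Finset.sum_le_sum fun a _ => ?_).trans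
        (b := ∑ _a : Fin n, R * ρ) (by simp)
      rw [abs_mul, abs_sub_comm]
      exact mul_le_mul (hXR k a) (h a b) (abs_nonneg _) hR
    rw [abs_mul]
    calc _ ≤ n * (R * ρ) * R := mul_le_mul h2 (hYR b l) (abs_nonneg _) (by positivity)
      _ = _ := by ring
  refine (Finset.abs_sum_le_sum_abs _ _).trans ?_
  refine (Finset.sum_le_sum fun b _ => h1 b).trans ?_
  simp only [Finset.sum_const, Finset.card_univ, Fintype.card_fin, nsmul_eq_mul]
  exact le_of_eq (by ring)

namespace IsLocalFlow

variable {T : ℝ} {U : Set (Model m n)} {G H : ℝ → Model m n → Matrix (Fin n) (Fin n) ℝ}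

theorem continuousOn_stateVec (hG : IsLocalFlow T U G) (hT : 0 < T) (hU : IsOpen U) :
    ContinuousOn (fun q : ℝ × Model m n => stateVec (G q.1) q.2) (Icc 0 T ×ˢ U) := by
  unfold stateVec
  refine ContinuousOn.prodMk ?_ (ContinuousOn.prodMk ?_ (ContinuousOn.prodMk ?_ ?_))
  · exact continuousOn_pi.2 fun i => continuousOn_pi.2 fun j => (hG.smooth_inv i j).continuousOn
  · exact continuousOn_pi.2 fun k => continuousOn_pi.2 fun i => continuousOn_pi.2 fun j =>
      (hG.smooth_jet hT hU k i j).continuousOn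
  · exact continuousOn_pi.2 fun i => continuousOn_pi.2 fun j =>
      (hG.smooth_ricci hT hU i j).continuousOn
  · exact continuousOn_pi.2 fun k => continuousOn_pi.2 fun i => continuousOn_pi.2 fun j =>
      (hG.smooth_ricciJet hT hU k i j).continuousOn

/-- Uniform ellipticity: a positive continuous function on the compact product of $[0,T]$, `K` and
the unit sphere has a positive lower bound, and homogeneity extends it to all $\xi$. -/
theorem exists_coercive (hG : IsLocalFlow T U G) {K : Set (Model m n)} (hK : IsCompact K)
    (hKU : K ⊆ U) : ∃ c, 0 < c ∧ ∀ t ∈ Icc 0 T, ∀ z ∈ K, ∀ ξ : Fin n → ℝ,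
      c * ∑ k, ξ k ^ 2 ≤ ∑ k, ∑ l, (G t z)⁻¹ k l * ξ k * ξ l := by
  set S : Set (Fin n → ℝ) := {ξ | ∑ k, ξ k ^ 2 = 1} with hS
  have hSc : IsCompact S := by
    refine Metric.isCompact_of_isClosed_isBounded (isClosed_eq (by fun_prop) continuous_const) ?_
    refine (Metric.isBounded_closedBall (x := (0 : Fin n → ℝ)) (r := 1)).subset fun ξ hξ => ?_
    rw [mem_closedBall_zero_iff, pi_norm_le_iff_of_nonneg zero_le_one]
    intro k
    rw [Real.norm_eq_abs, ← sq_le_one_iff_abs_le_one, ← (show ∑ k, ξ k ^ 2 = 1 from hξ)]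
    exact Finset.single_le_sum (f := fun k => ξ k ^ 2) (fun k _ => sq_nonneg _) (Finset.mem_univ k)
  have hcont : ContinuousOn (fun q : (ℝ × Model m n) × (Fin n → ℝ) =>
      ∑ k, ∑ l, (G q.1.1 q.1.2)⁻¹ k l * q.2 k * q.2 l) ((Icc 0 T ×ˢ K) ×ˢ S) := by
    refine continuousOn_finsetSum _ fun k _ => continuousOn_finsetSum _ fun l _ => ?_
    have h1 : ContinuousOn (fun q : (ℝ × Model m n) × (Fin n → ℝ) => (G q.1.1 q.1.2)⁻¹ k l)
        ((Icc 0 T ×ˢ K) ×ˢ S) :=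
      (hG.smooth_inv k l).continuousOn.comp (f := Prod.fst) continuousOn_fst
        fun q hq => ⟨hq.1.1, hKU hq.1.2⟩
    exact (h1.mul (by fun_prop)).mul (by fun_prop)
  have hform : ∀ t ∈ Icc 0 T, ∀ z ∈ K, ∀ ξ : Fin n → ℝ, ξ ≠ 0 →
      0 < ∑ k, ∑ l, (G t z)⁻¹ k l * ξ k * ξ l := by
    intro t ht z hz ξ hξ
    have := ((hG.posDef t ht z (hKU hz)).inv).dotProduct_mulVec_pos hξ
    simp only [dotProduct, Matrix.mulVec, Pi.star_apply, star_trivial, Finset.mul_sum] at this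
    exact this.trans_eq (Finset.sum_congr rfl fun k _ => Finset.sum_congr rfl fun l _ => by ring)
  obtain ⟨c, hc, h⟩ := ((isCompact_Icc.prod hK).prod hSc).exists_forall_le' hcont (a := 0)
    (by
      rintro ⟨⟨t, z⟩, ξ⟩ ⟨⟨ht, hz⟩, hξ⟩
      refine hform t ht z hz ξ ?_
      rintro rfl
      simp [hS] at hξ)
  refine ⟨c, hc, fun t ht z hz ξ => ?_⟩
  by_cases hξ : ξ = 0
  · simp [hξ]
  set N := ∑ k, ξ k ^ 2 with hN
  have hNpos : 0 < N := by
    obtain ⟨k, hk⟩ := Function.ne_iff.mp hξ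
    exact Finset.sum_pos' (fun k _ => sq_nonneg _) ⟨k, Finset.mem_univ k, by
      have : ξ k ≠ 0 := hk
      positivity⟩
  have hs : √N ^ 2 = N := Real.sq_sqrt hNpos.le
  have hs0 : √N ≠ 0 := (Real.sqrt_pos.2 hNpos).ne'
  have h1 := h ((t, z), fun k => ξ k / √N) ⟨⟨ht, hz⟩, by
    simp only [hS, mem_ofPred_eq, div_pow, hs, ← Finset.sum_div, ← hN]
    exact div_self hNpos.ne'⟩
  have h2 : ∑ k, ∑ l, (G t z)⁻¹ k l * (ξ k / √N) * (ξ l / √N)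
      = (∑ k, ∑ l, (G t z)⁻¹ k l * ξ k * ξ l) / N := by
    simp only [Finset.sum_div]
    refine Finset.sum_congr rfl fun k _ => Finset.sum_congr rfl fun l _ => ?_
    rw [show (G t z)⁻¹ k l * (ξ k / √N) * (ξ l / √N) = (G t z)⁻¹ k l * ξ k * ξ l / √N ^ 2 by
      field_simp, hs]
  simp only [h2] at h1
  rwa [le_div_iff₀ hNpos] at h1

/-- Bounds for the coefficients and the lower order terms in the equation satisfied by the
difference of two flows. -/
theorem exists_bounds (hG : IsLocalFlow T U G) (hH : IsLocalFlow T U H) (hT : 0 < T)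
    (hU : IsOpen U) {K : Set (Model m n)} (hK : IsCompact K) (hKU : K ⊆ U) :
    ∃ C, 0 ≤ C ∧ ∀ t ∈ Icc 0 T, ∀ z ∈ K,
      (∀ k l, |(G t z)⁻¹ k l| ≤ C) ∧
      (∀ k i j, |ricciFlux (G t) z k i j - ricciFlux (H t) z k i j - ∑ l, (G t z)⁻¹ k l *
        (metricJet (ricciMatrix (G t)) z l i j - metricJet (ricciMatrix (H t)) z l i j)|
          ≤ C * √(locEn (G t) (H t) z)) ∧
      (∀ i j, |ricciSource (G t) z i j - ricciSource (H t) z i j|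
          ≤ C * (√(locEn (G t) (H t) z) + √(locGrad (G t) (H t) z))) := by
  obtain ⟨R₁, hR₁⟩ := (isCompact_Icc.prod hK).exists_bound_of_continuousOn
    ((hG.continuousOn_stateVec hT hU).mono (prod_mono_right hKU))
  obtain ⟨R₂, hR₂⟩ := (isCompact_Icc.prod hK).exists_bound_of_continuousOn
    ((hH.continuousOn_stateVec hT hU).mono (prod_mono_right hKU))
  set R := max (max R₁ R₂) 0 with hR
  have hR0 : 0 ≤ R := le_max_right _ _
  set fF : StateSpace n → Fin n → Fin n → Fin n → ℝ := fun x k i j =>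
    fluxPoly (Matrix.of x.1) x.2.1 (Matrix.of x.2.2.1) k i j with hfF
  set fS : StateSpace n → Fin n → Fin n → ℝ := fun x i j =>
    sourcePoly (Matrix.of x.1) x.2.1 (Matrix.of x.2.2.1) x.2.2.2 i j with hfS
  have hFd : ContDiff ℝ ∞ fF := contDiff_pi.2 fun k => contDiff_pi.2 fun i => contDiff_pi.2
    fun j => contDiff_fluxPoly k i j (fun a b => by simp only [Matrix.of_apply]; fun_prop)
      (fun a b c => by fun_prop) (fun a b => by simp only [Matrix.of_apply]; fun_prop)
  have hSd : ContDiff ℝ ∞ fS := contDiff_pi.2 fun i => contDiff_pi.2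
    fun j => contDiff_sourcePoly i j (fun a b => by simp only [Matrix.of_apply]; fun_prop)
      (fun a b c => by fun_prop) (fun a b => by simp only [Matrix.of_apply]; fun_prop)
      (fun a b c => by fun_prop)
  obtain ⟨CF, hCF0, hCF⟩ := exists_lipschitz_bound hFd R
  obtain ⟨CS, hCS0, hCS⟩ := exists_lipschitz_bound hSd R
  -- The first summand bounds the change of the inverse metric. The added 1 lets the same factor
  -- cover the components that are bounded by `ρ` or `p` directly.
  set A : ℝ := n * (n * (R * R)) + 1 with hA
  have hA1 : 1 ≤ A := by rw [hA]; have : 0 ≤ (n : ℝ) * (n * (R * R)) := by positivity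
                         linarith
  have hA0 : 0 ≤ A := zero_le_one.trans hA1
  refine ⟨R + (n * (A * R) + CF * A) + CS * A, by positivity, fun t ht z hz => ?_⟩
  set ρ := √(locEn (G t) (H t) z) with hρ
  set p := √(locGrad (G t) (H t) z) with hp
  have hρ0 : 0 ≤ ρ := Real.sqrt_nonneg _
  have hp0 : 0 ≤ p := Real.sqrt_nonneg _
  have hx : ‖stateVec (G t) z‖ ≤ R :=
    (hR₁ (t, z) ⟨ht, hz⟩).trans ((le_max_left _ _).trans (le_max_left _ _))
  have hy : ‖stateVec (H t) z‖ ≤ R :=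
    (hR₂ (t, z) ⟨ht, hz⟩).trans ((le_max_right _ _).trans (le_max_left _ _))
  have comp : ∀ X : Model m n → Matrix (Fin n) (Fin n) ℝ, ‖stateVec X z‖ ≤ R →
      (∀ k l, |(X z)⁻¹ k l| ≤ R) ∧ (∀ k i j, |metricJet (ricciMatrix X) z k i j| ≤ R)
      ∧ ‖((stateVec X z).1, (stateVec X z).2.1, (stateVec X z).2.2.1,
        (0 : Fin n → Fin n → Fin n → ℝ))‖ ≤ R := by
    intro X hX
    have h1 := (norm_fst_le (stateVec X z)).trans hX
    have h2 := (norm_snd_le (stateVec X z)).trans hX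
    have h3 := (norm_fst_le (stateVec X z).2).trans h2
    have h4 := (norm_snd_le (stateVec X z).2).trans h2
    have h5 := (norm_fst_le (stateVec X z).2.2).trans h4
    have h6 := (norm_snd_le (stateVec X z).2.2).trans h4
    refine ⟨fun k l => ?_, fun k i j => ?_, ?_⟩
    · exact (norm_le_pi_norm ((stateVec X z).1 k) l).trans
        ((norm_le_pi_norm (stateVec X z).1 k).trans h1)
    · exact (norm_le_pi_norm ((stateVec X z).2.2.2 k i) j).trans
        ((norm_le_pi_norm ((stateVec X z).2.2.2 k) i).trans
        ((norm_le_pi_norm (stateVec X z).2.2.2 k).trans h6))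
    · exact norm_prod_le_iff.2 ⟨h1, norm_prod_le_iff.2 ⟨h3, norm_prod_le_iff.2
        ⟨h5, by simpa using hR0⟩⟩⟩
  obtain ⟨hx1, -, hx3⟩ := comp _ hx
  obtain ⟨hy1, hy2, hy3⟩ := comp _ hy
  have hu : ∀ k l, |(G t z)⁻¹ k l - (H t z)⁻¹ k l| ≤ A * ρ := by
    intro k l
    refine (abs_inv_sub_inv_le (hG.isUnit_det ht (hKU hz)) (hH.isUnit_det ht (hKU hz)) hρ0 hx1 hy1
      (abs_metric_sub_le (G t) (H t) z) k l).trans ?_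
    exact mul_le_mul_of_nonneg_right (by rw [hA]; linarith) hρ0
  have hAρ : ρ ≤ A * ρ := le_mul_of_one_le_left hρ0 hA1
  have d1 : ‖(stateVec (G t) z).1 - (stateVec (H t) z).1‖ ≤ A * ρ :=
    (pi_norm_le_iff_of_nonneg (by positivity)).2 fun k =>
      (pi_norm_le_iff_of_nonneg (by positivity)).2 fun l => hu k l
  have d2 : ‖(stateVec (G t) z).2.1 - (stateVec (H t) z).2.1‖ ≤ A * ρ :=
    (pi_norm_le_iff_of_nonneg (by positivity)).2 fun k =>
      (pi_norm_le_iff_of_nonneg (by positivity)).2 fun i =>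
      (pi_norm_le_iff_of_nonneg (by positivity)).2 fun j =>
        (abs_jet_sub_le (G t) (H t) z k i j).trans hAρ
  have d3 : ‖(stateVec (G t) z).2.2.1 - (stateVec (H t) z).2.2.1‖ ≤ A * ρ :=
    (pi_norm_le_iff_of_nonneg (by positivity)).2 fun k =>
      (pi_norm_le_iff_of_nonneg (by positivity)).2 fun l =>
        (abs_ricci_sub_le (G t) (H t) z k l).trans hAρ
  have d4 : ‖(stateVec (G t) z).2.2.2 - (stateVec (H t) z).2.2.2‖ ≤ p :=
    (pi_norm_le_iff_of_nonneg (by positivity)).2 fun k =>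
      (pi_norm_le_iff_of_nonneg (by positivity)).2 fun i =>
      (pi_norm_le_iff_of_nonneg (by positivity)).2 fun j =>
        abs_ricciJet_sub_le (G t) (H t) z k i j
  have hAp : p ≤ A * p := le_mul_of_one_le_left hp0 hA1
  refine ⟨fun k l => (hx1 k l).trans ?_, fun k i j => ?_, fun i j => ?_⟩
  · have : 0 ≤ (n * (A * R) + CF * A) + CS * A := by positivity
    linarith
  -- What remains beyond the principal part is the change of `u` against the bounded Ricci
  -- derivatives of `H`, and the change of `fF`. Since `fF` ignores the last slot of the state, that
  -- slot is set to 0, which keeps `p` out of the Lipschitz bound.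
  · have h1 : ricciFlux (G t) z k i j - ricciFlux (H t) z k i j - ∑ l, (G t z)⁻¹ k l *
        (metricJet (ricciMatrix (G t)) z l i j - metricJet (ricciMatrix (H t)) z l i j)
        = ∑ l, ((G t z)⁻¹ k l - (H t z)⁻¹ k l) * metricJet (ricciMatrix (H t)) z l i j
          + (fF ((stateVec (G t) z).1, (stateVec (G t) z).2.1, (stateVec (G t) z).2.2.1, 0) k i j
          - fF ((stateVec (H t) z).1, (stateVec (H t) z).2.1, (stateVec (H t) z).2.2.1, 0)
            k i j) := by
      have h0 : ∀ X : Model m n → Matrix (Fin n) (Fin n) ℝ, ricciFlux X z k i j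
          = ∑ l, (X z)⁻¹ k l * metricJet (ricciMatrix X) z l i j
            + fF ((stateVec X z).1, (stateVec X z).2.1, (stateVec X z).2.2.1, 0) k i j :=
        fun X => rfl
      rw [h0, h0]
      simp only [mul_sub, sub_mul, Finset.sum_sub_distrib]
      ring
    have h2 : |∑ l, ((G t z)⁻¹ k l - (H t z)⁻¹ k l) * metricJet (ricciMatrix (H t)) z l i j|
        ≤ n * (A * R) * ρ := by
      refine (Finset.abs_sum_le_sum_abs _ _).trans ?_
      refine (Finset.sum_le_sum fun l _ => ?_).trans (b := ∑ _l : Fin n, A * ρ * R)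
        (le_of_eq (by simp; ring))
      rw [abs_mul]
      exact mul_le_mul (hu k l) (hy2 l i j) (abs_nonneg _) (by positivity)
    have h3 := hCF _ _ hx3 hy3
    have h4 : ‖(((stateVec (G t) z).1, (stateVec (G t) z).2.1, (stateVec (G t) z).2.2.1, 0) :
        StateSpace n) - ((stateVec (H t) z).1, (stateVec (H t) z).2.1, (stateVec (H t) z).2.2.1,
          0)‖ ≤ A * ρ :=
      norm_prod_le_iff.2 ⟨d1, norm_prod_le_iff.2 ⟨d2, norm_prod_le_iff.2
        ⟨d3, by simpa using by positivity⟩⟩⟩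
    have h5 := ((norm_le_pi_norm _ j).trans ((norm_le_pi_norm _ i).trans
      ((norm_le_pi_norm _ k).trans h3))).trans (mul_le_mul_of_nonneg_left h4 hCF0)
    rw [h1]
    refine (abs_add_le _ _).trans ?_
    have h6 : 0 ≤ R * ρ + CS * A * ρ := by positivity
    refine (add_le_add h2 h5).trans ?_
    linarith
  · have h3 := hCS _ _ hx hy
    have h4 : ‖stateVec (G t) z - stateVec (H t) z‖ ≤ A * (ρ + p) := by
      have e1 : A * ρ ≤ A * (ρ + p) := mul_le_mul_of_nonneg_left (by linarith) hA0
      have e2 : p ≤ A * (ρ + p) := hAp.trans (mul_le_mul_of_nonneg_left (by linarith) hA0)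
      exact norm_prod_le_iff.2 ⟨d1.trans e1, norm_prod_le_iff.2 ⟨d2.trans e1, norm_prod_le_iff.2
        ⟨d3.trans e1, d4.trans e2⟩⟩⟩
    have h5 := ((norm_le_pi_norm _ j).trans ((norm_le_pi_norm _ i).trans h3)).trans
      (mul_le_mul_of_nonneg_left h4 hCS0)
    have h6 : 0 ≤ (R + (n * (A * R) + CF * A)) * (ρ + p) := by positivity
    have h7 : |ricciSource (G t) z i j - ricciSource (H t) z i j| ≤ CS * (A * (ρ + p)) := h5
    refine h7.trans ?_
    linarith

end IsLocalFlow

end LocalEnergy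

/-! ### Absorption of the gradient and the energy inequality in one chart. -/

section EnergyInequality

variable {m n : ℕ}

instance isAddHaarMeasure_volume_model : (volume : Measure (Model m n)).IsAddHaarMeasure :=
  Measure.prod.instIsAddHaarMeasure _ _

theorem abs_sum_le_card_mul {f : Fin n → ℝ} {c : ℝ} (h : ∀ k, |f k| ≤ c) :
    |∑ k, f k| ≤ n * c := by
  refine (Finset.abs_sum_le_sum_abs _ _).trans ((Finset.sum_le_sum fun k _ => h k).trans ?_)
  simp

/-- For one component: `h`, `D`, `b` are the differences of metric, jet and Ricci tensor, `x` the
gradient of `b`, `F` and `y` the lower order flux and the source, `s` the gradient of the cutoff.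
Every indefinite term containing the gradient bound `p` carries a factor `σ`, so it is controlled by
`ρ` times `q = |σ| * p`; coercivity supplies the negative term that will absorb this. -/
theorem energy_term_le {C c σ h b y ρ p : ℝ} {x F D s : Fin n → ℝ} {u : Matrix (Fin n) (Fin n) ℝ}
    (hC : 0 ≤ C) (hρ : 0 ≤ ρ) (hp : 0 ≤ p) (hσ : |σ| ≤ C) (hs : ∀ k, |s k| ≤ C)
    (hu : ∀ k l, |u k l| ≤ C) (hF : ∀ k, |F k| ≤ C * ρ) (hy : |y| ≤ C * (ρ + p)) (hh : |h| ≤ ρ)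
    (hb : |b| ≤ ρ) (hD : ∀ k, |D k| ≤ ρ) (hx : ∀ k, |x k| ≤ p)
    (hc : c * ∑ k, x k ^ 2 ≤ ∑ k, ∑ l, u k l * x k * x l) :
    σ ^ 2 * (-4 * (h * b) + ∑ k, -4 * (D k * x k) + 2 * (b * y))
      + ∑ k, 2 * (σ * (-((σ * x k + 2 * s k * b) * (∑ l, u k l * x l + F k))))
      ≤ (4 * C ^ 2 + 4 * n * C ^ 3 + 2 * C ^ 3 + 4 * n * C + 2 * n * C ^ 2 + 4 * n ^ 2 * C ^ 2
          + 2 * C ^ 2) * (ρ ^ 2 + ρ * (|σ| * p))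
        - 2 * c * (σ ^ 2 * ∑ k, x k ^ 2) := by
  set q := |σ| * p with hq
  have hq0 : 0 ≤ q := by positivity
  have hσ2 : σ ^ 2 = |σ| * |σ| := by rw [← sq, sq_abs]
  have hσC : σ ^ 2 ≤ C ^ 2 := by rw [hσ2, sq]; exact mul_le_mul hσ hσ (abs_nonneg _) hC
  have t1 : |σ ^ 2 * (h * b)| ≤ C ^ 2 * ρ ^ 2 := by
    rw [abs_mul, abs_mul, abs_of_nonneg (sq_nonneg σ), sq ρ]
    exact mul_le_mul hσC (mul_le_mul hh hb (abs_nonneg _) hρ) (by positivity) (by positivity)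
  have t2 : |∑ k, σ ^ 2 * (D k * x k)| ≤ n * (C * (ρ * q)) := by
    refine abs_sum_le_card_mul fun k => ?_
    rw [abs_mul, abs_mul, abs_of_nonneg (sq_nonneg σ), hσ2]
    calc |σ| * |σ| * (|D k| * |x k|) = |σ| * (|D k| * (|σ| * |x k|)) := by ring
      _ ≤ C * (ρ * q) := by
        refine mul_le_mul hσ (mul_le_mul (hD k) ?_ (by positivity) hρ) (by positivity) hC
        exact mul_le_mul_of_nonneg_left (hx k) (abs_nonneg _)
  have t3 : |∑ k, σ ^ 2 * (x k * F k)| ≤ n * (C * (C * ρ * q)) := by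
    refine abs_sum_le_card_mul fun k => ?_
    rw [abs_mul, abs_mul, abs_of_nonneg (sq_nonneg σ), hσ2]
    calc |σ| * |σ| * (|x k| * |F k|) = |σ| * (|F k| * (|σ| * |x k|)) := by ring
      _ ≤ C * (C * ρ * q) := by
        refine mul_le_mul hσ (mul_le_mul (hF k) ?_ (by positivity) (by positivity))
          (by positivity) hC
        exact mul_le_mul_of_nonneg_left (hx k) (abs_nonneg _)
  have t4 : |∑ k, σ * (s k * b * ∑ l, u k l * x l)| ≤ n * (C * ρ * (n * (C * q))) := by
    refine abs_sum_le_card_mul fun k => ?_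
    have e : σ * (s k * b * ∑ l, u k l * x l) = s k * b * ∑ l, u k l * (σ * x l) := by
      simp only [Finset.mul_sum]
      exact Finset.sum_congr rfl fun l _ => by ring
    rw [e, abs_mul, abs_mul]
    refine mul_le_mul (mul_le_mul (hs k) hb (abs_nonneg _) hC) ?_ (abs_nonneg _) (by positivity)
    refine abs_sum_le_card_mul fun l => ?_
    rw [abs_mul, abs_mul]
    exact mul_le_mul (hu k l) (mul_le_mul_of_nonneg_left (hx l) (abs_nonneg _)) (by positivity) hC
  have t5 : |∑ k, σ * (s k * b * F k)| ≤ n * (C * (C * ρ * (C * ρ))) := by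
    refine abs_sum_le_card_mul fun k => ?_
    rw [abs_mul, abs_mul, abs_mul]
    exact mul_le_mul hσ (mul_le_mul (mul_le_mul (hs k) hb (abs_nonneg _) hC) (hF k) (abs_nonneg _)
      (by positivity)) (by positivity) hC
  have t6 : |σ ^ 2 * (b * y)| ≤ C ^ 3 * ρ ^ 2 + C ^ 2 * (ρ * q) := by
    rw [abs_mul, abs_mul, abs_of_nonneg (sq_nonneg σ)]
    have h1 : |b| * |y| ≤ ρ * (C * (ρ + p)) := mul_le_mul hb hy (abs_nonneg _) hρ
    have h2 : σ ^ 2 * p ≤ C * q := by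
      rw [hσ2, mul_assoc]; exact mul_le_mul_of_nonneg_right hσ hq0
    calc σ ^ 2 * (|b| * |y|) ≤ σ ^ 2 * (ρ * (C * (ρ + p))) :=
          mul_le_mul_of_nonneg_left h1 (sq_nonneg _)
      _ = C * ρ ^ 2 * σ ^ 2 + C * ρ * (σ ^ 2 * p) := by ring
      _ ≤ C * ρ ^ 2 * C ^ 2 + C * ρ * (C * q) := by gcongr
      _ = _ := by ring
  have t7 : σ ^ 2 * (c * ∑ k, x k ^ 2) ≤ σ ^ 2 * ∑ k, ∑ l, u k l * x k * x l :=
    mul_le_mul_of_nonneg_left hc (sq_nonneg _)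
  have expand : σ ^ 2 * (-4 * (h * b) + ∑ k, -4 * (D k * x k) + 2 * (b * y))
      + ∑ k, 2 * (σ * (-((σ * x k + 2 * s k * b) * (∑ l, u k l * x l + F k))))
      = -4 * (σ ^ 2 * (h * b)) - 4 * ∑ k, σ ^ 2 * (D k * x k) + 2 * (σ ^ 2 * (b * y))
        - 2 * (σ ^ 2 * ∑ k, ∑ l, u k l * x k * x l) - 2 * ∑ k, σ ^ 2 * (x k * F k)
        - 4 * ∑ k, σ * (s k * b * ∑ l, u k l * x l) - 4 * ∑ k, σ * (s k * b * F k) := by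
    have e1 : ∀ k, ∑ l, u k l * x k * x l = x k * ∑ l, u k l * x l := fun k => by
      rw [Finset.mul_sum]; exact Finset.sum_congr rfl fun l _ => by ring
    simp only [e1, mul_add, Finset.mul_sum (s := (Finset.univ : Finset (Fin n))) (a := σ ^ 2)
      (f := fun k => x k * ∑ l, u k l * x l)]
    have e2 : ∑ k, 2 * (σ * (-((σ * x k + 2 * s k * b) * ∑ l, u k l * x l
        + (σ * x k + 2 * s k * b) * F k)))
        = -2 * ∑ k, σ ^ 2 * (x k * ∑ l, u k l * x l) - 2 * ∑ k, σ ^ 2 * (x k * F k)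
        - 4 * ∑ k, σ * (s k * b * ∑ l, u k l * x l) - 4 * ∑ k, σ * (s k * b * F k) := by
      rw [Finset.mul_sum, Finset.mul_sum, Finset.mul_sum, Finset.mul_sum,
        ← Finset.sum_sub_distrib, ← Finset.sum_sub_distrib, ← Finset.sum_sub_distrib]
      exact Finset.sum_congr rfl fun k _ => by ring
    have e3 : σ ^ 2 * ∑ k, -4 * (D k * x k) = -4 * ∑ k, σ ^ 2 * (D k * x k) := by
      rw [Finset.mul_sum, Finset.mul_sum]
      exact Finset.sum_congr rfl fun k _ => by ring
    rw [e2, e3]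
    ring
  rw [expand]
  have a1 := neg_abs_le (σ ^ 2 * (h * b))
  have a2 := neg_abs_le (∑ k, σ ^ 2 * (D k * x k))
  have a3 := neg_abs_le (∑ k, σ ^ 2 * (x k * F k))
  have a4 := neg_abs_le (∑ k, σ * (s k * b * ∑ l, u k l * x l))
  have a5 := neg_abs_le (∑ k, σ * (s k * b * F k))
  have a6 := le_abs_self (σ ^ 2 * (b * y))
  -- These nonnegative surpluses allow one common constant in front of both `ρ ^ 2` and `ρ * q`.
  have b1 : 0 ≤ (4 * C ^ 2 + 4 * n * C ^ 3 + 2 * C ^ 3) * (ρ * q) := by positivity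
  have b2 : 0 ≤ (4 * n * C + 2 * n * C ^ 2 + 4 * n ^ 2 * C ^ 2 + 2 * C ^ 2) * ρ ^ 2 := by positivity
  linarith

/-- The terms of the time derivative of the energy density without second derivatives of the Ricci
tensors. -/
def lowerTerm (G H : Model m n → Matrix (Fin n) (Fin n) ℝ) (i j : Fin n) (z : Model m n) : ℝ :=
  -4 * ((G z i j - H z i j) * (ricci G z i j - ricci H z i j))
    + ∑ k, -4 * ((metricJet G z k i j - metricJet H z k i j) *
      (metricJet (ricciMatrix G) z k i j - metricJet (ricciMatrix H) z k i j))
    + 2 * ((ricci G z i j - ricci H z i j) * (ricciSource G z i j - ricciSource H z i j))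

/-- The flux term of the time derivative of the energy, after integration by parts. -/
def fluxTerm (σ : Model m n → ℝ) (G H : Model m n → Matrix (Fin n) (Fin n) ℝ) (k i j : Fin n)
    (z : Model m n) : ℝ :=
  σ z * (-((σ z * fderiv ℝ (fun w => ricci G w i j - ricci H w i j) z (dy m n k)
    + 2 * fderiv ℝ σ z (dy m n k) * (ricci G z i j - ricci H z i j))
      * (ricciFlux G z k i j - ricciFlux H z k i j)))

/-- The integrand in the time derivative of the energy, after integration by parts. -/
def energyIntegrand (σ : Model m n → ℝ) (G H : Model m n → Matrix (Fin n) (Fin n) ℝ)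
    (z : Model m n) : ℝ :=
  ∑ i, ∑ j, (σ z ^ 2 * lowerTerm G H i j z + ∑ k, 2 * fluxTerm σ G H k i j z)

namespace IsLocalFlow

variable {T : ℝ} {U : Set (Model m n)} {G H : ℝ → Model m n → Matrix (Fin n) (Fin n) ℝ}

theorem smooth_stateVec (hG : IsLocalFlow T U G) (hT : 0 < T) (hU : IsOpen U) {t : ℝ}
    (ht : t ∈ Icc 0 T) : ContDiffOn ℝ ∞ (fun z => stateVec (G t) z) U := by
  refine ContDiffOn.prodMk ?_ (ContDiffOn.prodMk ?_ (ContDiffOn.prodMk ?_ ?_))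
  · exact contDiffOn_pi.2 fun i => contDiffOn_pi.2 fun j =>
      contDiffOn_slice (F := fun t z => (G t z)⁻¹ i j) (hG.smooth_inv i j) ht
  · exact contDiffOn_pi.2 fun k => contDiffOn_pi.2 fun i => contDiffOn_pi.2 fun j =>
      contDiffOn_slice (F := fun t z => metricJet (G t) z k i j) (hG.smooth_jet hT hU k i j) ht
  · exact contDiffOn_pi.2 fun i => contDiffOn_pi.2 fun j =>
      contDiffOn_slice (F := fun t z => ricci (G t) z i j) (hG.smooth_ricci hT hU i j) ht
  · exact contDiffOn_pi.2 fun k => contDiffOn_pi.2 fun i => contDiffOn_pi.2 fun j =>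
      contDiffOn_slice (F := fun t z => metricJet (ricciMatrix (G t)) z k i j)
        (hG.smooth_ricciJet hT hU k i j) ht

theorem smooth_ricciFlux (hG : IsLocalFlow T U G) (hT : 0 < T) (hU : IsOpen U) {t : ℝ}
    (ht : t ∈ Icc 0 T) (k i j : Fin n) :
    ContDiffOn ℝ ∞ (fun z => ricciFlux (G t) z k i j) U := by
  have hfun : ContDiff ℝ ∞ fun x : StateSpace n => ∑ l, x.1 k l * x.2.2.2 l i j
      + fluxPoly (Matrix.of x.1) x.2.1 (Matrix.of x.2.2.1) k i j := by
    refine ContDiff.add (by fun_prop) (contDiff_fluxPoly k i j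
      (fun a b => by simp only [Matrix.of_apply]; fun_prop)
      (fun a b c => by fun_prop) (fun a b => by simp only [Matrix.of_apply]; fun_prop))
  exact hfun.comp_contDiffOn (hG.smooth_stateVec hT hU ht)

theorem smooth_ricciSource (hG : IsLocalFlow T U G) (hT : 0 < T) (hU : IsOpen U) {t : ℝ}
    (ht : t ∈ Icc 0 T) (i j : Fin n) :
    ContDiffOn ℝ ∞ (fun z => ricciSource (G t) z i j) U := by
  have hfun : ContDiff ℝ ∞ fun x : StateSpace n =>
      sourcePoly (Matrix.of x.1) x.2.1 (Matrix.of x.2.2.1) x.2.2.2 i j :=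
    contDiff_sourcePoly i j (fun a b => by simp only [Matrix.of_apply]; fun_prop)
      (fun a b c => by fun_prop) (fun a b => by simp only [Matrix.of_apply]; fun_prop)
      (fun a b c => by fun_prop)
  have h := hfun.comp_contDiffOn (hG.smooth_stateVec hT hU ht)
  refine h.congr fun z _ => ?_
  have e1 : Matrix.of (stateVec (G t) z).1 = (G t z)⁻¹ := rfl
  have e2 : Matrix.of (stateVec (G t) z).2.2.1 = ricciMatrix (G t) z := rfl
  rw [Function.comp_apply, e1, e2, ricciSource, stateVec]

theorem smooth_locEn (hG : IsLocalFlow T U G) (hH : IsLocalFlow T U H) (hT : 0 < T)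
    (hU : IsOpen U) :
    ContDiffOn ℝ ∞ (fun q : ℝ × Model m n => locEn (G q.1) (H q.1) q.2) (Icc 0 T ×ˢ U) := by
  unfold locEn
  refine ContDiffOn.sum fun i _ => ContDiffOn.sum fun j _ => ContDiffOn.add (ContDiffOn.add ?_
    (ContDiffOn.sum fun k _ => ?_)) ?_
  · exact ((hG.smooth i j).sub (hH.smooth i j)).pow 2
  · exact ((hG.smooth_jet hT hU k i j).sub (hH.smooth_jet hT hU k i j)).pow 2
  · exact ((hG.smooth_ricci hT hU i j).sub (hH.smooth_ricci hT hU i j)).pow 2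

theorem hasDerivAt_locEn (hG : IsLocalFlow T U G) (hH : IsLocalFlow T U H) (hU : IsOpen U) {t : ℝ}
    (ht : t ∈ Ioo 0 T) {z : Model m n} (hz : z ∈ U) :
    HasDerivAt (fun s => locEn (G s) (H s) z)
      (∑ i, ∑ j, (-4 * ((G t z i j - H t z i j) * (ricci (G t) z i j - ricci (H t) z i j))
        + ∑ k, -4 * ((metricJet (G t) z k i j - metricJet (H t) z k i j) *
          (metricJet (ricciMatrix (G t)) z k i j - metricJet (ricciMatrix (H t)) z k i j))
        + 2 * ((ricci (G t) z i j - ricci (H t) z i j) *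
          (∑ k, (pd k (fun w => ricciFlux (G t) w k i j) z
              - pd k (fun w => ricciFlux (H t) w k i j) z)
            + (ricciSource (G t) z i j - ricciSource (H t) z i j))))) t := by
  have hI := Icc_mem_nhds ht.1 ht.2
  have ht' := Ioo_subset_Icc_self ht
  unfold locEn
  refine HasDerivAt.fun_sum fun i _ => HasDerivAt.fun_sum fun j _ => HasDerivAt.add (HasDerivAt.add
    ?_ (HasDerivAt.fun_sum fun k _ => ?_)) ?_
  · have h := (((hG.flow z hz t ht' i j).hasDerivAt hI).sub
      ((hH.flow z hz t ht' i j).hasDerivAt hI)).fun_pow 2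
    exact h.congr_deriv (by simp; ring)
  · have h := ((hG.hasDerivAt_jet hU ht hz k i j).sub (hH.hasDerivAt_jet hU ht hz k i j)).fun_pow 2
    exact h.congr_deriv (by simp; ring)
  · have h := ((hG.hasDerivAt_ricci hU ht hz i j).sub (hH.hasDerivAt_ricci hU ht hz i j)).fun_pow 2
    exact h.congr_deriv (by rw [Finset.sum_sub_distrib]; simp; ring)

theorem continuousOn_lowerTerm (hG : IsLocalFlow T U G) (hH : IsLocalFlow T U H) (hT : 0 < T)
    (hU : IsOpen U) {t : ℝ} (ht : t ∈ Icc 0 T) (i j : Fin n) :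
    ContinuousOn (lowerTerm (G t) (H t) i j) U := by
  have hsl : ∀ {F : (ℝ → Model m n → Matrix (Fin n) (Fin n) ℝ) → ℝ → Model m n → ℝ},
      (∀ Z, IsLocalFlow T U Z → ContDiffOn ℝ ∞ (fun q : ℝ × Model m n => F Z q.1 q.2)
        (Icc 0 T ×ˢ U)) → ContinuousOn (fun z => F G t z - F H t z) U := fun hF =>
    ((contDiffOn_slice (hF G hG) ht).sub (contDiffOn_slice (hF H hH) ht)).continuousOn
  have h0 : ContinuousOn (fun z => ricci (G t) z i j - ricci (H t) z i j) U :=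
    hsl (F := fun Z t z => ricci (Z t) z i j) fun Z hZ => hZ.smooth_ricci hT hU i j
  have h1 : ContinuousOn (fun z => G t z i j - H t z i j) U :=
    hsl (F := fun Z t z => Z t z i j) fun Z hZ => hZ.smooth i j
  have h2 : ∀ k, ContinuousOn (fun z => metricJet (G t) z k i j - metricJet (H t) z k i j) U :=
    fun k => hsl (F := fun Z t z => metricJet (Z t) z k i j)
      fun Z hZ => hZ.smooth_jet hT hU k i j
  have h3 : ∀ k, ContinuousOn (fun z => metricJet (ricciMatrix (G t)) z k i j
      - metricJet (ricciMatrix (H t)) z k i j) U :=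
    fun k => hsl (F := fun Z t z => metricJet (ricciMatrix (Z t)) z k i j)
      fun Z hZ => hZ.smooth_ricciJet hT hU k i j
  have h4 : ContinuousOn (fun z => ricciSource (G t) z i j - ricciSource (H t) z i j) U :=
    ((hG.smooth_ricciSource hT hU ht i j).sub (hH.smooth_ricciSource hT hU ht i j)).continuousOn
  exact ((continuousOn_const.mul (h1.mul h0)).add
    (continuousOn_finsetSum _ fun k _ => continuousOn_const.mul ((h2 k).mul (h3 k)))).add
    (continuousOn_const.mul (h0.mul h4))

theorem smooth_ricci_sub (hG : IsLocalFlow T U G) (hH : IsLocalFlow T U H) (hT : 0 < T)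
    (hU : IsOpen U) {t : ℝ} (ht : t ∈ Icc 0 T) (i j : Fin n) :
    ContDiffOn ℝ ∞ (fun z => ricci (G t) z i j - ricci (H t) z i j) U :=
  (contDiffOn_slice (F := fun t z => ricci (G t) z i j) (hG.smooth_ricci hT hU i j) ht).sub
    (contDiffOn_slice (F := fun t z => ricci (H t) z i j) (hH.smooth_ricci hT hU i j) ht)

theorem fderiv_ricci_sub (hG : IsLocalFlow T U G) (hH : IsLocalFlow T U H) (hT : 0 < T)
    (hU : IsOpen U) {t : ℝ} (ht : t ∈ Icc 0 T) {z : Model m n} (hz : z ∈ U) (k i j : Fin n) :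
    fderiv ℝ (fun w => ricci (G t) w i j - ricci (H t) w i j) z (dy m n k)
      = metricJet (ricciMatrix (G t)) z k i j - metricJet (ricciMatrix (H t)) z k i j := by
  have d : ∀ Z, IsLocalFlow T U Z →
      DifferentiableAt ℝ (fun z => ricci (Z t) z i j) z := fun Z hZ =>
    ((contDiffOn_slice (F := fun t z => ricci (Z t) z i j) (hZ.smooth_ricci hT hU i j)
      ht).differentiableOn (by simp) z hz).differentiableAt (hU.mem_nhds hz)
  rw [fderiv_fun_sub (d G hG) (d H hH)]
  rfl

theorem fderiv_ricciFlux_sub (hG : IsLocalFlow T U G) (hH : IsLocalFlow T U H) (hT : 0 < T)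
    (hU : IsOpen U) {t : ℝ} (ht : t ∈ Icc 0 T) {z : Model m n} (hz : z ∈ U) (k i j : Fin n) :
    fderiv ℝ (fun w => ricciFlux (G t) w k i j - ricciFlux (H t) w k i j) z (dy m n k)
      = pd k (fun w => ricciFlux (G t) w k i j) z - pd k (fun w => ricciFlux (H t) w k i j) z := by
  have d : ∀ Z, IsLocalFlow T U Z →
      DifferentiableAt ℝ (fun z => ricciFlux (Z t) z k i j) z := fun Z hZ =>
    ((hZ.smooth_ricciFlux hT hU ht k i j).differentiableOn (by simp) z
      hz).differentiableAt (hU.mem_nhds hz)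
  rw [fderiv_fun_sub (d G hG) (d H hH)]
  rfl

/-- The pointwise bound behind the local energy inequality: the gradient of the difference of the
Ricci tensors is absorbed by the parabolic term. -/
theorem exists_energyIntegrand_le (hG : IsLocalFlow T U G) (hH : IsLocalFlow T U H) (hT : 0 < T)
    (hU : IsOpen U) {σ : Model m n → ℝ} (hσ : ContDiff ℝ ∞ σ) (hc : HasCompactSupport σ)
    (hs : tsupport σ ⊆ U) :
    ∃ A, 0 ≤ A ∧ ∀ t ∈ Icc 0 T, ∀ z ∈ tsupport σ,
      energyIntegrand σ (G t) (H t) z ≤ A * locEn (G t) (H t) z := by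
  obtain ⟨C₁, hC₁0, hC₁⟩ := hG.exists_bounds hH hT hU hc hs
  obtain ⟨c, hc0, hcoer⟩ := hG.exists_coercive hc hs
  obtain ⟨C₂, hC₂⟩ := hc.exists_bound_of_continuousOn hσ.continuous.continuousOn
  obtain ⟨C₃, hC₃⟩ := hc.exists_bound_of_continuousOn (f := fun z (k : Fin n) => pd k σ z)
    (Continuous.continuousOn (continuous_pi fun k =>
      ((hσ.continuous_fderiv (by simp)).clm_apply continuous_const)))
  set C := max C₁ (max C₂ C₃) with hC
  have hC0 : 0 ≤ C := hC₁0.trans (le_max_left _ _)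
  -- The constant of `energy_term_le`, multiplied by the number of index pairs $(i,j)$.
  set B : ℝ := n ^ 2 * (4 * C ^ 2 + 4 * n * C ^ 3 + 2 * C ^ 3 + 4 * n * C + 2 * n * C ^ 2
    + 4 * n ^ 2 * C ^ 2 + 2 * C ^ 2) with hB
  have hB0 : 0 ≤ B := by positivity
  refine ⟨B + B ^ 2 / (8 * c), by positivity, fun t ht z hz => ?_⟩
  obtain ⟨hu, hF, hY⟩ := hC₁ t ht z hz
  set ρ := √(locEn (G t) (H t) z) with hρ
  set p := √(locGrad (G t) (H t) z) with hp
  have hρ0 : 0 ≤ ρ := Real.sqrt_nonneg _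
  have hp0 : 0 ≤ p := Real.sqrt_nonneg _
  have hρ2 : ρ ^ 2 = locEn (G t) (H t) z := Real.sq_sqrt (locEn_nonneg _ _ _)
  have hp2 : p ^ 2 = locGrad (G t) (H t) z :=
    Real.sq_sqrt (by unfold locGrad; positivity)
  have hC1C : C₁ ≤ C := le_max_left _ _
  have hterm : ∀ i j, σ z ^ 2 * lowerTerm (G t) (H t) i j z
      + ∑ k, 2 * fluxTerm σ (G t) (H t) k i j z
      ≤ (4 * C ^ 2 + 4 * n * C ^ 3 + 2 * C ^ 3 + 4 * n * C + 2 * n * C ^ 2 + 4 * n ^ 2 * C ^ 2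
        + 2 * C ^ 2) * (ρ ^ 2 + ρ * (|σ z| * p))
        - 2 * c * (σ z ^ 2 * ∑ k, (metricJet (ricciMatrix (G t)) z k i j
          - metricJet (ricciMatrix (H t)) z k i j) ^ 2) := by
    intro i j
    have h := energy_term_le (n := n) (C := C) (c := c) (σ := σ z) (h := G t z i j - H t z i j)
      (b := ricci (G t) z i j - ricci (H t) z i j)
      (y := ricciSource (G t) z i j - ricciSource (H t) z i j) (ρ := ρ) (p := p)
      (x := fun k => metricJet (ricciMatrix (G t)) z k i j
          - metricJet (ricciMatrix (H t)) z k i j)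
      (F := fun k => ricciFlux (G t) z k i j - ricciFlux (H t) z k i j - ∑ l, (G t z)⁻¹ k l *
        (metricJet (ricciMatrix (G t)) z l i j - metricJet (ricciMatrix (H t)) z l i j))
      (D := fun k => metricJet (G t) z k i j - metricJet (H t) z k i j)
      (s := fun k => fderiv ℝ σ z (dy m n k)) (u := (G t z)⁻¹)
      hC0 hρ0 hp0 ((hC₂ z hz).trans ((le_max_left _ _).trans (le_max_right _ _)))
      (fun k => (norm_le_pi_norm (fun k : Fin n => pd k σ z) k).trans
        ((hC₃ z hz).trans ((le_max_right _ _).trans (le_max_right _ _))))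
      (fun k l => (hu k l).trans hC1C)
      (fun k => (hF k i j).trans (mul_le_mul_of_nonneg_right hC1C hρ0))
      ((hY i j).trans (mul_le_mul_of_nonneg_right hC1C (by positivity)))
      (abs_metric_sub_le _ _ _ _ _) (abs_ricci_sub_le _ _ _ _ _)
      (fun k => abs_jet_sub_le _ _ _ _ _ _) (fun k => abs_ricciJet_sub_le _ _ _ _ _ _)
      (hcoer t ht z hz _)
    -- `F` was the flux difference minus its principal part; adding the principal part back restores
    -- the whole flux difference.
    simp only [add_sub_cancel] at h
    simp only [fluxTerm, hG.fderiv_ricci_sub hH hT hU ht (hs hz)]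
    exact h
  have hsum := Finset.sum_le_sum fun i (_ : i ∈ Finset.univ) =>
    Finset.sum_le_sum fun j (_ : j ∈ Finset.univ) => hterm i j
  have hr : ∑ i : Fin n, ∑ j : Fin n,
      ((4 * C ^ 2 + 4 * n * C ^ 3 + 2 * C ^ 3 + 4 * n * C + 2 * n * C ^ 2 + 4 * n ^ 2 * C ^ 2
        + 2 * C ^ 2) * (ρ ^ 2 + ρ * (|σ z| * p))
        - 2 * c * (σ z ^ 2 * ∑ k, (metricJet (ricciMatrix (G t)) z k i j
          - metricJet (ricciMatrix (H t)) z k i j) ^ 2))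
      = B * (ρ ^ 2 + ρ * (|σ z| * p)) - 2 * c * (σ z ^ 2 * p ^ 2) := by
    simp only [Finset.sum_sub_distrib, ← Finset.mul_sum, Finset.sum_const, Finset.card_univ,
      Fintype.card_fin, nsmul_eq_mul]
    rw [hp2, locGrad, hB]
    ring
  set q := |σ z| * p with hq
  have hq2 : σ z ^ 2 * p ^ 2 = q ^ 2 := by rw [hq, mul_pow, sq_abs]
  have hI : energyIntegrand σ (G t) (H t) z ≤ B * (ρ ^ 2 + ρ * q) - 2 * c * q ^ 2 := by
    rw [← hq2]
    exact hsum.trans_eq hr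
  -- Young's inequality weighted so that `2 * c * q ^ 2` is exactly the available negative term; the
  -- square completed is that of `4 * c * q - B * ρ`.
  have hamgm : B * (ρ * q) ≤ 2 * c * q ^ 2 + B ^ 2 / (8 * c) * ρ ^ 2 := by
    have h0 : 0 ≤ (4 * c * q - B * ρ) ^ 2 / (8 * c) := by positivity
    have h1 : (4 * c * q - B * ρ) ^ 2 / (8 * c)
        = 2 * c * q ^ 2 + B ^ 2 / (8 * c) * ρ ^ 2 - B * (ρ * q) := by
      field_simp; ring
    linarith
  rw [← hρ2]
  linarith

theorem integrable_lowerTerm (hG : IsLocalFlow T U G) (hH : IsLocalFlow T U H) (hT : 0 < T)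
    (hU : IsOpen U) {σ : Model m n → ℝ} (hσ : ContDiff ℝ ∞ σ) (hc : HasCompactSupport σ)
    (hs : tsupport σ ⊆ U) {t : ℝ} (ht : t ∈ Icc 0 T) (i j : Fin n) :
    Integrable fun z => σ z ^ 2 * lowerTerm (G t) (H t) i j z := by
  have h := integrable_cutoff_mul volume hU hσ.continuous hc hs
    (hσ.continuous.continuousOn.mul (hG.continuousOn_lowerTerm hH hT hU ht i j))
  simpa only [sq, mul_assoc, Pi.mul_apply] using h

theorem integrable_fluxTerm (hG : IsLocalFlow T U G) (hH : IsLocalFlow T U H) (hT : 0 < T)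
    (hU : IsOpen U) {σ : Model m n → ℝ} (hσ : ContDiff ℝ ∞ σ) (hc : HasCompactSupport σ)
    (hs : tsupport σ ⊆ U) {t : ℝ} (ht : t ∈ Icc 0 T) (k i j : Fin n) :
    Integrable (fluxTerm σ (G t) (H t) k i j) := by
  have hb := hG.smooth_ricci_sub hH hT hU ht i j
  have hX := (hG.smooth_ricciFlux hT hU ht k i j).sub (hH.smooth_ricciFlux hT hU ht k i j)
  have hdb := (hb.fderiv_of_isOpen hU (m := ∞) (by simp)).clm_apply
    (contDiffOn_const (c := dy m n k))
  have hdσ : ContDiff ℝ ∞ (fun z => fderiv ℝ σ z (dy m n k)) :=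
    (hσ.fderiv_right (m := ∞) (by simp)).clm_apply contDiff_const
  exact integrable_cutoff_mul volume hU hσ.continuous hc hs
    (((hσ.contDiffOn.mul hdb).add ((contDiffOn_const.mul hdσ.contDiffOn).mul hb)).mul
      hX).neg.continuousOn

/-- The time derivative of the energy after integration by parts. -/
theorem integral_deriv_locEn (hG : IsLocalFlow T U G) (hH : IsLocalFlow T U H) (hT : 0 < T)
    (hU : IsOpen U) {σ : Model m n → ℝ} (hσ : ContDiff ℝ ∞ σ) (hc : HasCompactSupport σ)
    (hs : tsupport σ ⊆ U) {t : ℝ} (ht : t ∈ Icc 0 T) :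
    ∫ z, ∑ i, ∑ j, (σ z ^ 2 * lowerTerm (G t) (H t) i j z + ∑ k, 2 * (σ z ^ 2 *
      ((ricci (G t) z i j - ricci (H t) z i j) *
        fderiv ℝ (fun w => ricciFlux (G t) w k i j - ricciFlux (H t) w k i j) z (dy m n k))))
      = ∫ z, energyIntegrand σ (G t) (H t) z := by
  have iP := hG.integrable_lowerTerm hH hT hU hσ hc hs ht
  have iV := hG.integrable_fluxTerm hH hT hU hσ hc hs ht
  have hb := hG.smooth_ricci_sub hH hT hU ht
  have hX : ∀ k i j, ContDiffOn ℝ ∞ (fun z => ricciFlux (G t) z k i j - ricciFlux (H t) z k i j) U :=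
    fun k i j => (hG.smooth_ricciFlux hT hU ht k i j).sub (hH.smooth_ricciFlux hT hU ht k i j)
  have iX : ∀ k i j, Integrable fun z => σ z ^ 2 * ((ricci (G t) z i j - ricci (H t) z i j) *
      fderiv ℝ (fun w => ricciFlux (G t) w k i j - ricciFlux (H t) w k i j) z (dy m n k)) := by
    intro k i j
    have hdX := ((hX k i j).fderiv_of_isOpen hU (m := ∞) (by simp)).clm_apply
      (contDiffOn_const (c := dy m n k))
    have h := integrable_cutoff_mul volume hU hσ.continuous hc hs
      (hσ.contDiffOn.mul ((hb i j).mul hdX)).continuousOn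
    simpa only [sq, mul_assoc] using h
  have iX' : ∀ i j, Integrable fun z => ∑ k, 2 * (σ z ^ 2 *
      ((ricci (G t) z i j - ricci (H t) z i j) *
        fderiv ℝ (fun w => ricciFlux (G t) w k i j - ricciFlux (H t) w k i j) z (dy m n k))) :=
    fun i j => integrable_finsetSum _ fun k _ => (iX k i j).const_mul 2
  have iV' : ∀ i j, Integrable fun z => ∑ k, 2 * fluxTerm σ (G t) (H t) k i j z :=
    fun i j => integrable_finsetSum _ fun k _ => (iV k i j).const_mul 2
  have iPX : ∀ i j, Integrable fun z => σ z ^ 2 * lowerTerm (G t) (H t) i j z + ∑ k, 2 * (σ z ^ 2 *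
      ((ricci (G t) z i j - ricci (H t) z i j) *
        fderiv ℝ (fun w => ricciFlux (G t) w k i j - ricciFlux (H t) w k i j) z (dy m n k))) :=
    fun i j => (iP i j).add (iX' i j)
  have iPV : ∀ i j, Integrable fun z => σ z ^ 2 * lowerTerm (G t) (H t) i j z
      + ∑ k, 2 * fluxTerm σ (G t) (H t) k i j z := fun i j => (iP i j).add (iV' i j)
  unfold energyIntegrand
  rw [integral_finsetSum _ fun i _ => integrable_finsetSum _ fun j _ => iPX i j,
    integral_finsetSum _ fun i _ => integrable_finsetSum _ fun j _ => iPV i j]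
  refine Finset.sum_congr rfl fun i _ => ?_
  rw [integral_finsetSum _ fun j _ => iPX i j, integral_finsetSum _ fun j _ => iPV i j]
  refine Finset.sum_congr rfl fun j _ => ?_
  rw [integral_add (iP i j) (iX' i j), integral_add (iP i j) (iV' i j),
    integral_finsetSum _ fun k _ => (iX k i j).const_mul 2,
    integral_finsetSum _ fun k _ => (iV k i j).const_mul 2]
  congr 1
  refine Finset.sum_congr rfl fun k _ => ?_
  rw [integral_const_mul, integral_const_mul,
    integral_cutoff_sq_mul_fderiv volume hU hσ hc hs (hb i j) (hX k i j)]
  rfl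

/-- The local energy inequality. -/
theorem exists_energy_deriv_le (hG : IsLocalFlow T U G) (hH : IsLocalFlow T U H) (hT : 0 < T)
    (hU : IsOpen U) {σ : Model m n → ℝ} (hσ : ContDiff ℝ ∞ σ) (hc : HasCompactSupport σ)
    (hs : tsupport σ ⊆ U) :
    ∃ A, 0 ≤ A ∧ ∀ t ∈ Ioo 0 T, ∃ E',
      HasDerivAt (fun s => ∫ z, σ z ^ 2 * locEn (G s) (H s) z) E' t ∧
        E' ≤ A * ∫ z in tsupport σ, locEn (G t) (H t) z := by
  obtain ⟨A, hA0, hA⟩ := hG.exists_energyIntegrand_le hH hT hU hσ hc hs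
  refine ⟨A, hA0, fun t ht => ⟨∫ z, energyIntegrand σ (G t) (H t) z, ?_, ?_⟩⟩
  · have ht' := Ioo_subset_Icc_self ht
    have hσ2 : tsupport (fun z => σ z ^ 2) ⊆ tsupport σ :=
      closure_mono fun z hz => by
        simp only [Function.mem_support] at hz ⊢
        intro h; exact hz (by simp [h])
    refine (hasDerivAt_integral_cutoff_mul volume (L := fun s z => locEn (G s) (H s) z)
      hT hU (hσ.pow 2).continuous (IsCompact.of_isClosed_subset hc (isClosed_tsupport _) hσ2)
      (hσ2.trans hs) (hG.smooth_locEn hH hT hU) ht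
      fun z hz => hG.hasDerivAt_locEn hH hU ht hz).congr_deriv ?_
    rw [← hG.integral_deriv_locEn hH hT hU hσ hc hs ht']
    congr 1
    ext z
    by_cases hz : z ∈ U
    · rw [Finset.mul_sum]
      refine Finset.sum_congr rfl fun i _ => ?_
      rw [Finset.mul_sum]
      refine Finset.sum_congr rfl fun j _ => ?_
      simp only [hG.fderiv_ricciFlux_sub hH hT hU ht' hz, ← Finset.mul_sum, lowerTerm]
      ring
    · simp [image_eq_zero_of_notMem_tsupport fun h => hz (hs h)]
  · have ht' := Ioo_subset_Icc_self ht
    have hloc : ContinuousOn (fun z => locEn (G t) (H t) z) U :=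
      (contDiffOn_slice (F := fun t z => locEn (G t) (H t) z) (hG.smooth_locEn hH hT hU)
        ht').continuousOn
    have hI0 : ∀ z, z ∉ tsupport σ → energyIntegrand σ (G t) (H t) z = 0 := by
      intro z hz
      simp [energyIntegrand, fluxTerm, image_eq_zero_of_notMem_tsupport hz]
    have iI : Integrable (energyIntegrand σ (G t) (H t)) :=
      integrable_finsetSum _ fun i _ => integrable_finsetSum _ fun j _ =>
        (hG.integrable_lowerTerm hH hT hU hσ hc hs ht' i j).add (integrable_finsetSum _
          fun k _ => (hG.integrable_fluxTerm hH hT hU hσ hc hs ht' k i j).const_mul 2)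
    -- The pointwise bound carries no weight `σ ^ 2`, since derivatives of `σ` occur. The integral
    -- is therefore taken over the whole support, and the covering argument restores the weight
    -- later.
    rw [← setIntegral_eq_integral_of_forall_compl_eq_zero hI0, ← integral_const_mul]
    exact setIntegral_mono_on iI.integrableOn
      (((hloc.mono hs).integrableOn_compact hc).const_mul _) hc.measurableSet (hA t ht')

end IsLocalFlow

end EnergyInequality

/-! ### Foliated charts -/

section Charts

variable {m n : ℕ} {M : Type*} [TopologicalSpace M] [ChartedSpace (Model m n) M]

section Transition

variable [HasGroupoid M (foliationGroupoid m n)]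

theorem transition_mem {e e' : OpenPartialHomeomorph M (Model m n)} (he : e ∈ atlas (Model m n) M)
    (he' : e' ∈ atlas (Model m n) M) :
    ContDiffOn ℝ ∞ (e.symm ≫ₕ e') (e.symm ≫ₕ e').source ∧
      ∀ z ∈ (e.symm ≫ₕ e').source, ∀ u : Fin m → ℝ, (fderiv ℝ (e.symm ≫ₕ e') z (u, 0)).2 = 0 :=
  (mem_groupoid_of_pregroupoid.mp
    (HasGroupoid.compatible (G := foliationGroupoid m n) he he')).1

theorem isManifold_of_foliation (m n : ℕ) (M : Type*) [TopologicalSpace M]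
    [ChartedSpace (Model m n) M] [HasGroupoid M (foliationGroupoid m n)] :
    IsManifold 𝓘(ℝ, Model m n) ∞ M := by
  refine isManifold_of_contDiffOn _ _ _ fun e e' he he' => ?_
  have h := (transition_mem he he').1
  simpa using h

theorem differentiableAt_transition {e e' : OpenPartialHomeomorph M (Model m n)}
    (he : e ∈ atlas (Model m n) M) (he' : e' ∈ atlas (Model m n) M) {z : Model m n}
    (hz : z ∈ (e.symm ≫ₕ e').source) : DifferentiableAt ℝ (e.symm ≫ₕ e') z :=
  ((transition_mem he he').1.differentiableOn (by simp) z hz).differentiableAt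
    ((e.symm ≫ₕ e').open_source.mem_nhds hz)

theorem mdifferentiableAt_chart_symm {e : OpenPartialHomeomorph M (Model m n)}
    (he : e ∈ atlas (Model m n) M) {z : Model m n} (hz : z ∈ e.target) :
    MDifferentiableAt 𝓘(ℝ, Model m n) 𝓘(ℝ, Model m n) e.symm z := by
  have := isManifold_of_foliation m n M
  exact ((contMDiffOn_symm_of_mem_maximalAtlas
    (IsManifold.subset_maximalAtlas (I := 𝓘(ℝ, Model m n)) (n := ∞) he)).contMDiffAt
    (e.open_target.mem_nhds hz)).mdifferentiableAt (by simp)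

/-- The tangent space is the model seen through the preferred chart, so this derivative is that of a
coordinate change and the groupoid condition applies to it. -/
theorem chartSymmDeriv_eq_fderiv {e : OpenPartialHomeomorph M (Model m n)}
    (he : e ∈ atlas (Model m n) M) {z : Model m n} (hz : z ∈ e.target) :
    chartSymmDeriv e z = fderiv ℝ (e.symm ≫ₕ chartAt (Model m n) (e.symm z)) z := by
  unfold chartSymmDeriv
  rw [MDifferentiableAt.mfderiv (mdifferentiableAt_chart_symm he hz)]
  simp only [writtenInExtChartAt, extChartAt, mfld_simps, fderivWithin_univ]
  rfl

theorem chartSymmDeriv_comp {e e' : OpenPartialHomeomorph M (Model m n)}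
    (he : e ∈ atlas (Model m n) M) (he' : e' ∈ atlas (Model m n) M) {z : Model m n}
    (hz : z ∈ (e.symm ≫ₕ e').source) (u : Model m n) :
    (chartSymmDeriv e z u : Model m n)
      = chartSymmDeriv e' ((e.symm ≫ₕ e') z) (fderiv ℝ (e.symm ≫ₕ e') z u) := by
  have hz1 : z ∈ e.target := by simpa using hz.1
  have hz2 : (e.symm ≫ₕ e') z ∈ e'.target := e'.map_source (by simpa using hz.2)
  have h1 : e.symm =ᶠ[𝓝 z] e'.symm ∘ (e.symm ≫ₕ e') := by
    filter_upwards [(e.symm ≫ₕ e').open_source.mem_nhds hz] with w hw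
    have : e.symm w ∈ e'.source := by simpa using hw.2
    simp [e'.left_inv this]
  have h2 := h1.mfderiv_eq (I := 𝓘(ℝ, Model m n)) (I' := 𝓘(ℝ, Model m n))
  have h3 := mfderiv_comp (I := 𝓘(ℝ, Model m n)) (I' := 𝓘(ℝ, Model m n)) (I'' := 𝓘(ℝ, Model m n)) z
    (mdifferentiableAt_chart_symm he' hz2)
    (differentiableAt_transition he he' hz).mdifferentiableAt
  rw [h3, mfderiv_eq_fderiv] at h2
  exact congrArg (fun L : Model m n →L[ℝ] Model m n => L u) h2

omit [HasGroupoid M (foliationGroupoid m n)] in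
theorem bilin_congr (g : BilinField m n M) {p q : M} (h : p = q) (a b : Model m n) :
    g p a b = g q a b := by
  subst h; rfl

theorem bilinIn_transition {e e' : OpenPartialHomeomorph M (Model m n)}
    (he : e ∈ atlas (Model m n) M) (he' : e' ∈ atlas (Model m n) M) {z : Model m n}
    (hz : z ∈ (e.symm ≫ₕ e').source) (g : BilinField m n M) (u v : Model m n) :
    bilinIn e g z u v = bilinIn e' g ((e.symm ≫ₕ e') z) (fderiv ℝ (e.symm ≫ₕ e') z u)
      (fderiv ℝ (e.symm ≫ₕ e') z v) := by
  have hp : e.symm z = e'.symm ((e.symm ≫ₕ e') z) := by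
    have : e.symm z ∈ e'.source := by simpa using hz.2
    simp [e'.left_inv this]
  unfold bilinIn
  refine (bilin_congr g hp (chartSymmDeriv e z u) (chartSymmDeriv e z v)).trans ?_
  rw [chartSymmDeriv_comp he he' hz u, chartSymmDeriv_comp he he' hz v]

omit [HasGroupoid M (foliationGroupoid m n)] in
theorem mem_transition_chartAt {e : OpenPartialHomeomorph M (Model m n)} {z : Model m n}
    (hz : z ∈ e.target) : z ∈ (e.symm ≫ₕ chartAt (Model m n) (e.symm z)).source := by
  simp [hz]

theorem chartSymmDeriv_leaf {e : OpenPartialHomeomorph M (Model m n)}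
    (he : e ∈ atlas (Model m n) M) {z : Model m n} (hz : z ∈ e.target) (u : Fin m → ℝ) :
    chartSymmDeriv e z (u, 0) ∈ leafTangent m n (e.symm z) := by
  have h := (transition_mem he (chart_mem_atlas (Model m n) (e.symm z))).2 z
    (mem_transition_chartAt hz) u
  rw [← chartSymmDeriv_eq_fderiv he hz] at h
  exact h

theorem fderiv_transition_comp {e e' : OpenPartialHomeomorph M (Model m n)}
    (he : e ∈ atlas (Model m n) M) (he' : e' ∈ atlas (Model m n) M) {z : Model m n}
    (hz : z ∈ (e.symm ≫ₕ e').source) (v : Model m n) :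
    fderiv ℝ (e'.symm ≫ₕ e) ((e.symm ≫ₕ e') z) (fderiv ℝ (e.symm ≫ₕ e') z v) = v := by
  have hz' : (e.symm ≫ₕ e') z ∈ (e'.symm ≫ₕ e).source := by
    have h1 : e.symm z ∈ e'.source := by simpa using hz.2
    have h2 : z ∈ e.target := by simpa using hz.1
    simp [h1, e'.left_inv h1, h2]
  have h := ((differentiableAt_transition he' he hz').hasFDerivAt.comp z
    (differentiableAt_transition he he' hz).hasFDerivAt)
  have hid : (e'.symm ≫ₕ e) ∘ (e.symm ≫ₕ e') =ᶠ[𝓝 z] id := by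
    filter_upwards [(e.symm ≫ₕ e').open_source.mem_nhds hz] with w hw
    have h1 : e.symm w ∈ e'.source := by simpa using hw.2
    have h2 : w ∈ e.target := by simpa using hw.1
    simp [e'.left_inv h1, e.right_inv h2]
  have h3 := h.unique ((hasFDerivAt_id z).congr_of_eventuallyEq hid)
  exact congrArg (fun L : Model m n →L[ℝ] Model m n => L v) h3

/-- The inverse coordinate change preserves the slices too: if the image were tangent to the leaf,
pulling it back would force the transverse part of `v` to vanish. -/
theorem chartSymmDeriv_notMem_leaf {e : OpenPartialHomeomorph M (Model m n)}
    (he : e ∈ atlas (Model m n) M) {z : Model m n} (hz : z ∈ e.target) {v : Model m n}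
    (hv : v.2 ≠ 0) : chartSymmDeriv e z v ∉ leafTangent m n (e.symm z) := by
  intro h
  have hc := chart_mem_atlas (Model m n) (e.symm z)
  have hzs := mem_transition_chartAt hz
  set c := chartAt (Model m n) (e.symm z) with hcdef
  rw [chartSymmDeriv_eq_fderiv he hz] at h
  have h1 : (fderiv ℝ (e.symm ≫ₕ c) z v).2 = 0 := h
  have hz' : (e.symm ≫ₕ c) z ∈ (c.symm ≫ₕ e).source := by
    have h1 : e.symm z ∈ c.source := by simpa using hzs.2
    simp [h1, c.left_inv h1, hz]
  have h2 := (transition_mem hc he).2 _ hz' (fderiv ℝ (e.symm ≫ₕ c) z v).1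
  rw [show ((fderiv ℝ (e.symm ≫ₕ c) z v).1, (0 : Fin n → ℝ)) = fderiv ℝ (e.symm ≫ₕ c) z v from
    Prod.ext rfl h1.symm, fderiv_transition_comp he hc hzs] at h2
  exact hv h2

end Transition

end Charts

/-! ### Change of foliated coordinates -/

section ChangeOfCoordinates

variable {m n : ℕ} {M : Type*} [TopologicalSpace M] [ChartedSpace (Model m n) M]

theorem bilinIn_add_left (e : OpenPartialHomeomorph M (Model m n)) (g : BilinField m n M)
    (z u u' v : Model m n) : bilinIn e g z (u + u') v = bilinIn e g z u v + bilinIn e g z u' v := by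
  simp [bilinIn]

theorem bilinIn_smul_left (e : OpenPartialHomeomorph M (Model m n)) (g : BilinField m n M)
    (z u v : Model m n) (c : ℝ) : bilinIn e g z (c • u) v = c * bilinIn e g z u v := by
  simp [bilinIn]

theorem bilinIn_sum_left (e : OpenPartialHomeomorph M (Model m n)) (g : BilinField m n M)
    (z v : Model m n) (u : Fin n → Model m n) :
    bilinIn e g z (∑ p, u p) v = ∑ p, bilinIn e g z (u p) v := by
  simp [bilinIn]

theorem eq_leaf_add_sum (u : Model m n) : u = (u.1, 0) + ∑ p, u.2 p • dy m n p := by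
  have h : ∑ p, u.2 p • dy m n p = (0, u.2) := by
    simp only [dy, Prod.smul_mk, smul_zero]
    refine Prod.ext ?_ ?_
    · rw [Prod.fst_sum]; simp
    · rw [Prod.snd_sum]
      ext q
      simp [Finset.sum_apply, Pi.single_apply]
  rw [h]
  simp

variable [HasGroupoid M (foliationGroupoid m n)]

theorem bilinIn_leaf_left {e : OpenPartialHomeomorph M (Model m n)} (he : e ∈ atlas (Model m n) M)
    {g : BilinField m n M} (hg : IsTransverseMetric g) {z : Model m n} (hz : z ∈ e.target)
    (u : Fin m → ℝ) (v : Model m n) : bilinIn e g z (u, 0) v = 0 :=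
  hg.leaf _ _ (chartSymmDeriv_leaf he hz u) _

omit [HasGroupoid M (foliationGroupoid m n)] in
theorem bilinIn_symm (e : OpenPartialHomeomorph M (Model m n))
    {g : BilinField m n M} (hg : IsTransverseMetric g) (z u v : Model m n) :
    bilinIn e g z u v = bilinIn e g z v u :=
  hg.symm _ _ _

theorem bilinIn_eq_sum {e : OpenPartialHomeomorph M (Model m n)} (he : e ∈ atlas (Model m n) M)
    {g : BilinField m n M} (hg : IsTransverseMetric g) {z : Model m n} (hz : z ∈ e.target)
    (u v : Model m n) :
    bilinIn e g z u v = ∑ p, ∑ q, u.2 p * v.2 q * metricIn e g z p q := by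
  have h1 : ∀ u v : Model m n, bilinIn e g z u v = ∑ p, u.2 p * bilinIn e g z (dy m n p) v := by
    intro u v
    conv_lhs => rw [eq_leaf_add_sum u]
    rw [bilinIn_add_left, bilinIn_leaf_left he hg hz, zero_add, bilinIn_sum_left]
    simp only [bilinIn_smul_left]
  rw [h1]
  refine Finset.sum_congr rfl fun p _ => ?_
  rw [bilinIn_symm e hg, h1, Finset.mul_sum]
  refine Finset.sum_congr rfl fun q _ => ?_
  rw [bilinIn_symm e hg, metricIn, Matrix.of_apply]
  ring

theorem metricIn_posDef {e : OpenPartialHomeomorph M (Model m n)} (he : e ∈ atlas (Model m n) M)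
    {g : BilinField m n M} (hg : IsTransverseMetric g) {z : Model m n} (hz : z ∈ e.target) :
    (metricIn e g z).PosDef := by
  refine Matrix.PosDef.of_dotProduct_mulVec_pos ?_ fun x hx => ?_
  · ext i j
    exact bilinIn_symm e hg _ _ _
  · have h := hg.pos _ _ (chartSymmDeriv_notMem_leaf he hz (v := ((0 : Fin m → ℝ), x)) hx)
    change 0 < bilinIn e g z (0, x) (0, x) at h
    rw [bilinIn_eq_sum he hg hz] at h
    refine h.trans_eq ?_
    simp only [dotProduct, Matrix.mulVec, Pi.star_apply, star_trivial, Finset.mul_sum]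
    exact Finset.sum_congr rfl fun p _ => Finset.sum_congr rfl fun q _ => by ring

theorem IsTransverseRicciFlow.isLocalFlow {T : ℝ} {g : ℝ → BilinField m n M}
    (hg : IsTransverseRicciFlow T g) {e : OpenPartialHomeomorph M (Model m n)}
    (he : e ∈ atlas (Model m n) M) : IsLocalFlow T e.target fun t => metricIn e (g t) where
  smooth _ _ := hg.smooth e he _ _
  posDef t ht _ hz := metricIn_posDef he (hg.metric t ht) hz
  flow z hz t ht i j := hg.flow e he z hz t ht i j

omit [HasGroupoid M (foliationGroupoid m n)] in
/-- The components of a transverse metric are constant along the leaves. -/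
theorem fderiv_metricIn_leaf {e : OpenPartialHomeomorph M (Model m n)}
    (he : e ∈ atlas (Model m n) M) {g : BilinField m n M} (hg : IsTransverseMetric g)
    {z : Model m n} (hz : z ∈ e.target) (p q : Fin n) (u : Fin m → ℝ) :
    fderiv ℝ (fun w => metricIn e g w p q) z (u, 0) = 0 := by
  have h := hg.holonomy e he (fun _ => (u, 0)) contDiffOn_const (fun _ _ => rfl) z hz
    (dy m n p) (dy m n q)
  simpa [bilinIn, metricIn] using h

omit [HasGroupoid M (foliationGroupoid m n)] in
theorem fderiv_metricIn {e : OpenPartialHomeomorph M (Model m n)}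
    (he : e ∈ atlas (Model m n) M) {g : BilinField m n M} (hg : IsTransverseMetric g)
    {z : Model m n} (hz : z ∈ e.target) (p q : Fin n) (v : Model m n) :
    fderiv ℝ (fun w => metricIn e g w p q) z v = ∑ r, v.2 r * metricJet (metricIn e g) z r p q := by
  conv_lhs => rw [eq_leaf_add_sum v]
  rw [map_add, fderiv_metricIn_leaf he hg hz, zero_add, map_sum]
  simp only [map_smul, smul_eq_mul]
  rfl

/-- The transverse Jacobian `∂y'^p/∂y^i` of a change of foliated coordinates. -/
def transJac (φ : Model m n → Model m n) (z : Model m n) (p i : Fin n) : ℝ :=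
  (fderiv ℝ φ z (dy m n i)).2 p

theorem metricIn_transition {e e' : OpenPartialHomeomorph M (Model m n)}
    (he : e ∈ atlas (Model m n) M) (he' : e' ∈ atlas (Model m n) M) {z : Model m n}
    (hz : z ∈ (e.symm ≫ₕ e').source) {g : BilinField m n M} (hg : IsTransverseMetric g)
    (i j : Fin n) :
    metricIn e g z i j = ∑ p, ∑ q, transJac (e.symm ≫ₕ e') z p i * transJac (e.symm ≫ₕ e') z q j *
      metricIn e' g ((e.symm ≫ₕ e') z) p q := by
  have hz2 : (e.symm ≫ₕ e') z ∈ e'.target := e'.map_source (by simpa using hz.2)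
  rw [metricIn, Matrix.of_apply, bilinIn_transition he he' hz, bilinIn_eq_sum he' hg hz2]
  rfl

theorem contDiffOn_transJac {e e' : OpenPartialHomeomorph M (Model m n)}
    (he : e ∈ atlas (Model m n) M) (he' : e' ∈ atlas (Model m n) M) (p i : Fin n) :
    ContDiffOn ℝ ∞ (fun z => transJac (e.symm ≫ₕ e') z p i) (e.symm ≫ₕ e').source := by
  have h := ((transition_mem he he').1.fderiv_of_isOpen (e.symm ≫ₕ e').open_source (m := ∞)
    (by simp)).clm_apply (contDiffOn_const (c := dy m n i))
  exact contDiffOn_pi.1 h.snd p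

/-- Product and chain rule. Holonomy invariance removes the leafwise part of the image of
$\partial/\partial y^k$, so the transverse jets transform among themselves, with an inhomogeneous
term linear in the metric. -/
theorem metricJet_transition {e e' : OpenPartialHomeomorph M (Model m n)}
    (he : e ∈ atlas (Model m n) M) (he' : e' ∈ atlas (Model m n) M) {z : Model m n}
    (hz : z ∈ (e.symm ≫ₕ e').source) {g : BilinField m n M} (hg : IsTransverseMetric g)
    (k i j : Fin n) :
    metricJet (metricIn e g) z k i j = ∑ p, ∑ q,
      ((pd k (fun w => transJac (e.symm ≫ₕ e') w p i) z * transJac (e.symm ≫ₕ e') z q j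
        + transJac (e.symm ≫ₕ e') z p i * pd k (fun w => transJac (e.symm ≫ₕ e') w q j) z) *
        metricIn e' g ((e.symm ≫ₕ e') z) p q
      + transJac (e.symm ≫ₕ e') z p i * transJac (e.symm ≫ₕ e') z q j *
        ∑ r, transJac (e.symm ≫ₕ e') z r k *
          metricJet (metricIn e' g) ((e.symm ≫ₕ e') z) r p q) := by
  set φ := e.symm ≫ₕ e' with hφ
  have hO : φ.source ∈ 𝓝 z := φ.open_source.mem_nhds hz
  have hz2 : φ z ∈ e'.target := e'.map_source (by simpa [hφ] using hz.2)
  have hJ : ∀ p i, DifferentiableAt ℝ (fun w => transJac φ w p i) z := fun p i =>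
    ((contDiffOn_transJac he he' p i).differentiableOn (by simp) z hz).differentiableAt hO
  have hg' : ∀ p q, DifferentiableAt ℝ (fun w => metricIn e' g w p q) (φ z) := fun p q =>
    ((hg.smooth e' he' _ _).differentiableOn (by simp) (φ z) hz2).differentiableAt
      (e'.open_target.mem_nhds hz2)
  have hφd := differentiableAt_transition he he' hz
  have hcomp : ∀ p q, HasFDerivAt (fun w => metricIn e' g (φ w) p q)
      ((fderiv ℝ (fun w => metricIn e' g w p q) (φ z)).comp (fderiv ℝ φ z)) z := fun p q =>
    (hg' p q).hasFDerivAt.comp z hφd.hasFDerivAt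
  have hev : (fun w => metricIn e g w i j) =ᶠ[𝓝 z] fun w => ∑ p, ∑ q,
      transJac φ w p i * transJac φ w q j * metricIn e' g (φ w) p q := by
    filter_upwards [hO] with w hw
    exact metricIn_transition he he' hw hg i j
  have hd : HasFDerivAt (fun w => ∑ p, ∑ q,
      transJac φ w p i * transJac φ w q j * metricIn e' g (φ w) p q) _ z :=
    HasFDerivAt.fun_sum fun p _ => HasFDerivAt.fun_sum fun q _ =>
      ((hJ p i).hasFDerivAt.fun_mul (hJ q j).hasFDerivAt).fun_mul (hcomp p q)
  rw [metricJet, pd, hev.fderiv_eq, hd.fderiv]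
  simp only [sum_apply, add_apply, smul_apply, smul_eq_mul, ContinuousLinearMap.comp_apply,
    fderiv_metricIn he' hg hz2]
  refine Finset.sum_congr rfl fun p _ => Finset.sum_congr rfl fun q _ => ?_
  simp only [pd, transJac]
  ring

/-- The transformation law of the metric has time-independent Jacobians. Differentiating it along
the flow yields the law for the Ricci tensor without transforming Christoffel symbols or curvature.
-/
theorem ricci_transition {T : ℝ} (hT : 0 < T) {g : ℝ → BilinField m n M}
    (hg : IsTransverseRicciFlow T g) {e e' : OpenPartialHomeomorph M (Model m n)}
    (he : e ∈ atlas (Model m n) M) (he' : e' ∈ atlas (Model m n) M) {z : Model m n}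
    (hz : z ∈ (e.symm ≫ₕ e').source) {t : ℝ} (ht : t ∈ Icc 0 T) (i j : Fin n) :
    ricci (metricIn e (g t)) z i j = ∑ p, ∑ q,
      transJac (e.symm ≫ₕ e') z p i * transJac (e.symm ≫ₕ e') z q j *
        ricci (metricIn e' (g t)) ((e.symm ≫ₕ e') z) p q := by
  have hz1 : z ∈ e.target := by simpa using hz.1
  have hz2 : (e.symm ≫ₕ e') z ∈ e'.target := e'.map_source (by simpa using hz.2)
  have h1 := hg.flow e he z hz1 t ht i j
  have h2 : HasDerivWithinAt (fun s => ∑ p, ∑ q,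
      transJac (e.symm ≫ₕ e') z p i * transJac (e.symm ≫ₕ e') z q j *
        metricIn e' (g s) ((e.symm ≫ₕ e') z) p q) _ (Icc 0 T) t :=
    HasDerivWithinAt.fun_sum fun p _ => HasDerivWithinAt.fun_sum fun q _ =>
      (hg.flow e' he' _ hz2 t ht p q).const_mul _
  have h3 := h2.congr_of_mem (fun s hs => metricIn_transition he he' hz (hg.metric s hs) i j) ht
  have h4 := (uniqueDiffOn_Icc hT t ht).eq_deriv _ h1 h3
  have h5 : ricci (metricIn e (g t)) z i j = (-1 / 2) * (-2 * ricci (metricIn e (g t)) z i j) := by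
    ring
  rw [h5, h4, Finset.mul_sum]
  refine Finset.sum_congr rfl fun p _ => ?_
  rw [Finset.mul_sum]
  exact Finset.sum_congr rfl fun q _ => by ring

theorem abs_double_sum_le {f : Fin n → Fin n → ℝ} {c : ℝ} (h : ∀ p q, |f p q| ≤ c) :
    |∑ p, ∑ q, f p q| ≤ n * (n * c) :=
  abs_sum_le_card_mul fun p => abs_sum_le_card_mul fun q => h p q

/-- The energy densities in two charts are comparable. -/
theorem exists_locEn_le {T : ℝ} (hT : 0 < T) {g g' : ℝ → BilinField m n M}
    (hg : IsTransverseRicciFlow T g) (hg' : IsTransverseRicciFlow T g')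
    {e e' : OpenPartialHomeomorph M (Model m n)}
    (he : e ∈ atlas (Model m n) M) (he' : e' ∈ atlas (Model m n) M) {N : Set (Model m n)}
    (hN : IsCompact N) (hNs : N ⊆ (e.symm ≫ₕ e').source) :
    ∃ C, 0 ≤ C ∧ ∀ t ∈ Icc 0 T, ∀ z ∈ N,
      locEn (metricIn e (g t)) (metricIn e (g' t)) z
        ≤ C * locEn (metricIn e' (g t)) (metricIn e' (g' t)) ((e.symm ≫ₕ e') z) := by
  set φ := e.symm ≫ₕ e' with hφ
  obtain ⟨R₁, hR₁⟩ := hN.exists_bound_of_continuousOn (f := fun z (p i : Fin n) => transJac φ z p i)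
    (continuousOn_pi.2 fun p => continuousOn_pi.2 fun i =>
      (contDiffOn_transJac he he' p i).continuousOn.mono hNs)
  obtain ⟨R₂, hR₂⟩ := hN.exists_bound_of_continuousOn
    (f := fun z (k p i : Fin n) => pd k (fun w => transJac φ w p i) z)
    (continuousOn_pi.2 fun k => continuousOn_pi.2 fun p => continuousOn_pi.2 fun i =>
      ((((contDiffOn_transJac he he' p i).fderiv_of_isOpen φ.open_source (m := ∞)
        (by simp)).clm_apply (contDiffOn_const (c := dy m n k))).continuousOn.mono hNs))
  set R := max (max R₁ R₂) 0 with hR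
  have hR0 : 0 ≤ R := le_max_right _ _
  set A : ℝ := n * (n * (R * R)) with hA
  set B : ℝ := n * (n * ((R * R + R * R) + R * R * (n * R))) with hB
  have hA0 : 0 ≤ A := by positivity
  have hB0 : 0 ≤ B := by positivity
  refine ⟨n * (n * (A ^ 2 + n * B ^ 2 + A ^ 2)), by positivity, fun t ht z hz => ?_⟩
  have hzs := hNs hz
  have hJ : ∀ p i, |transJac φ z p i| ≤ R := fun p i =>
    ((norm_le_pi_norm (fun i => transJac φ z p i) i).trans
      (norm_le_pi_norm (fun (p i : Fin n) => transJac φ z p i) p)).trans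
      ((hR₁ z hz).trans ((le_max_left _ _).trans (le_max_left _ _)))
  have hdJ : ∀ k p i, |pd k (fun w => transJac φ w p i) z| ≤ R := fun k p i =>
    ((norm_le_pi_norm (fun i => pd k (fun w => transJac φ w p i) z) i).trans
      ((norm_le_pi_norm (fun (p i : Fin n) => pd k (fun w => transJac φ w p i) z) p).trans
      (norm_le_pi_norm (fun (k p i : Fin n) => pd k (fun w => transJac φ w p i) z) k))).trans
      ((hR₂ z hz).trans ((le_max_right _ _).trans (le_max_left _ _)))
  set L := locEn (metricIn e' (g t)) (metricIn e' (g' t)) (φ z) with hL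
  set ρ := √L with hρ
  have hρ0 : 0 ≤ ρ := Real.sqrt_nonneg _
  have hρ2 : ρ ^ 2 = L := Real.sq_sqrt (locEn_nonneg _ _ _)
  have hm := hg.metric t ht
  have hm' := hg'.metric t ht
  have hJJ : ∀ p q i j, |transJac φ z p i * transJac φ z q j| ≤ R * R := fun p q i j => by
    rw [abs_mul]; exact mul_le_mul (hJ p i) (hJ q j) (abs_nonneg _) hR0
  have h1 : ∀ i j, |metricIn e (g t) z i j - metricIn e (g' t) z i j| ≤ A * ρ := by
    intro i j
    rw [metricIn_transition he he' hzs hm, metricIn_transition he he' hzs hm',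
      ← Finset.sum_sub_distrib]
    simp only [← Finset.sum_sub_distrib, ← mul_sub]
    refine (abs_double_sum_le (c := R * R * ρ) fun p q => ?_).trans (le_of_eq (by rw [hA]; ring))
    rw [abs_mul]
    exact mul_le_mul (hJJ p q i j) (abs_metric_sub_le _ _ _ _ _) (abs_nonneg _) (by positivity)
  have h3 : ∀ i j, |ricci (metricIn e (g t)) z i j - ricci (metricIn e (g' t)) z i j|
      ≤ A * ρ := by
    intro i j
    rw [ricci_transition hT hg he he' hzs ht, ricci_transition hT hg' he he' hzs ht,
      ← Finset.sum_sub_distrib]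
    simp only [← Finset.sum_sub_distrib, ← mul_sub]
    refine (abs_double_sum_le (c := R * R * ρ) fun p q => ?_).trans (le_of_eq (by rw [hA]; ring))
    rw [abs_mul]
    exact mul_le_mul (hJJ p q i j) (abs_ricci_sub_le _ _ _ _ _) (abs_nonneg _) (by positivity)
  have h2 : ∀ k i j, |metricJet (metricIn e (g t)) z k i j - metricJet (metricIn e (g' t)) z k i j|
      ≤ B * ρ := by
    intro k i j
    rw [metricJet_transition he he' hzs hm, metricJet_transition he he' hzs hm',
      ← Finset.sum_sub_distrib]
    simp only [← Finset.sum_sub_distrib]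
    refine (abs_double_sum_le (c := (R * R + R * R) * ρ + R * R * (n * (R * ρ)))
      fun p q => ?_).trans (le_of_eq (by rw [hB]; ring))
    -- The second derivatives of the coordinate change multiply the undifferentiated difference of
    -- the metrics, which the energy already controls.
    rw [add_sub_add_comm, ← mul_sub, ← mul_sub, ← Finset.sum_sub_distrib]
    simp only [← mul_sub]
    refine (abs_add_le _ _).trans (add_le_add ?_ ?_)
    · rw [abs_mul]
      refine mul_le_mul ((abs_add_le _ _).trans (add_le_add ?_ ?_)) (abs_metric_sub_le _ _ _ _ _)
        (abs_nonneg _) (by positivity)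
      · rw [abs_mul]; exact mul_le_mul (hdJ k p i) (hJ q j) (abs_nonneg _) hR0
      · rw [abs_mul]; exact mul_le_mul (hJ p i) (hdJ k q j) (abs_nonneg _) hR0
    · rw [abs_mul]
      refine mul_le_mul (hJJ p q i j) (abs_sum_le_card_mul fun r => ?_) (abs_nonneg _)
        (by positivity)
      rw [abs_mul]
      exact mul_le_mul (hJ r k) (abs_jet_sub_le _ _ _ _ _ _) (abs_nonneg _) hR0
  have sqle : ∀ {x c : ℝ}, 0 ≤ c → |x| ≤ c * ρ → x ^ 2 ≤ c ^ 2 * L := by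
    intro x c _ hx
    rw [← hρ2, ← mul_pow, ← sq_abs]
    exact pow_le_pow_left₀ (abs_nonneg _) hx 2
  have hterm : ∀ i j, (metricIn e (g t) z i j - metricIn e (g' t) z i j) ^ 2
      + ∑ k, (metricJet (metricIn e (g t)) z k i j - metricJet (metricIn e (g' t)) z k i j) ^ 2
      + (ricci (metricIn e (g t)) z i j - ricci (metricIn e (g' t)) z i j) ^ 2
      ≤ (A ^ 2 + n * B ^ 2 + A ^ 2) * L := by
    intro i j
    have s2 : ∑ k, (metricJet (metricIn e (g t)) z k i j
        - metricJet (metricIn e (g' t)) z k i j) ^ 2 ≤ n * (B ^ 2 * L) :=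
      (Finset.sum_le_sum fun k _ => sqle hB0 (h2 k i j)).trans (by simp)
    have s1 := sqle hA0 (h1 i j)
    have s3 := sqle hA0 (h3 i j)
    linarith
  unfold locEn
  refine (Finset.sum_le_sum fun i _ => Finset.sum_le_sum fun j _ => hterm i j).trans (le_of_eq ?_)
  simp only [Finset.sum_const, Finset.card_univ, Fintype.card_fin, nsmul_eq_mul]
  ring

end ChangeOfCoordinates

/-! ### The global energy -/

section GlobalEnergy

variable {m n : ℕ} {M : Type*} [TopologicalSpace M] [ChartedSpace (Model m n) M]

/-- Charts of the foliated atlas with smooth cutoff functions, such that the sets where the cutoff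
functions are locally equal to `1` cover the manifold. -/
structure IsCutoffCover {ι : Type*} (e : ι → OpenPartialHomeomorph M (Model m n))
    (σ : ι → Model m n → ℝ) : Prop where
  mem_atlas : ∀ a, e a ∈ atlas (Model m n) M
  smooth : ∀ a, ContDiff ℝ ∞ (σ a)
  compact : ∀ a, HasCompactSupport (σ a)
  tsupport_subset : ∀ a, tsupport (σ a) ⊆ (e a).target
  cover : ∀ p, ∃ a, p ∈ (e a).source ∧ ∀ᶠ z in 𝓝 (e a p), σ a z = 1

/-- Bump functions supported inside the chart targets; by compactness, finitely many of the balls on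
which they equal 1 cover `M`. -/
theorem exists_isCutoffCover (m n : ℕ) (M : Type*) [TopologicalSpace M]
    [ChartedSpace (Model m n) M] [CompactSpace M] :
    ∃ (s : Finset M) (e : s → OpenPartialHomeomorph M (Model m n)) (σ : s → Model m n → ℝ),
      IsCutoffCover e σ := by
  have h : ∀ p : M, ∃ f : ContDiffBump (chartAt (Model m n) p p),
      tsupport f ⊆ (chartAt (Model m n) p).target := by
    intro p
    obtain ⟨ε, hε, hb⟩ := Metric.isOpen_iff.1 (chartAt (Model m n) p).open_target _
      (mem_chart_target (Model m n) p)
    refine ⟨⟨ε / 4, ε / 2, by positivity, by linarith⟩, ?_⟩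
    rw [ContDiffBump.tsupport_eq]
    exact (Metric.closedBall_subset_ball (by change ε / 2 < ε; linarith)).trans hb
  choose f hf using h
  obtain ⟨s, -, hs⟩ := isCompact_univ.elim_nhds_subcover
    (fun p => (chartAt (Model m n) p).source ∩
      chartAt (Model m n) p ⁻¹' Metric.ball (chartAt (Model m n) p p) (f p).rIn)
    fun p _ => ((chartAt (Model m n) p).isOpen_inter_preimage Metric.isOpen_ball).mem_nhds
      ⟨mem_chart_source _ p, Metric.mem_ball_self (f p).rIn_pos⟩
  refine ⟨s, fun p => chartAt (Model m n) p.1, fun p => f p.1, fun a => chart_mem_atlas _ _,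
    fun a => (f a.1).contDiff, fun a => (f a.1).hasCompactSupport, fun a => hf a.1, fun p => ?_⟩
  obtain ⟨q, hq, hp⟩ := mem_iUnion₂.1 (hs (mem_univ p))
  refine ⟨⟨q, hq⟩, hp.1, ?_⟩
  filter_upwards [Metric.isOpen_ball.mem_nhds hp.2] with z hz
  exact (f q).one_of_mem_closedBall (Metric.ball_subset_closedBall hz)

/-- The local energy density of two families of transverse metrics in a foliated chart. -/
abbrev chartEn (e : OpenPartialHomeomorph M (Model m n)) (g g' : ℝ → BilinField m n M) (t : ℝ)
    (z : Model m n) : ℝ :=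
  locEn (metricIn e (g t)) (metricIn e (g' t)) z

/-- The sum of the local energies with respect to a cover by charts with cutoff functions. -/
def globalEn {ι : Type*} [Fintype ι] (e : ι → OpenPartialHomeomorph M (Model m n))
    (σ : ι → Model m n → ℝ) (g g' : ℝ → BilinField m n M) (t : ℝ) : ℝ :=
  ∑ a, ∫ z, σ a z ^ 2 * chartEn (e a) g g' t z

theorem tsupport_sq_subset {E : Type*} [TopologicalSpace E] (σ : E → ℝ) :
    tsupport (fun z => σ z ^ 2) ⊆ tsupport σ :=
  closure_mono fun z hz => by
    simp only [Function.mem_support] at hz ⊢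
    intro h
    exact hz (by simp [h])

theorem IsLocalFlow.continuousOn_locEn {T : ℝ} {U : Set (Model m n)}
    {G H : ℝ → Model m n → Matrix (Fin n) (Fin n) ℝ}
    (hG : IsLocalFlow T U G) (hH : IsLocalFlow T U H) (hT : 0 < T) (hU : IsOpen U) {t : ℝ}
    (ht : t ∈ Icc 0 T) : ContinuousOn (locEn (G t) (H t)) U :=
  (contDiffOn_slice (F := fun t z => locEn (G t) (H t) z) (hG.smooth_locEn hH hT hU)
    ht).continuousOn

variable [HasGroupoid M (foliationGroupoid m n)] {T : ℝ} {g g' : ℝ → BilinField m n M}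

theorem continuousOn_chartEn (hT : 0 < T) (hg : IsTransverseRicciFlow T g)
    (hg' : IsTransverseRicciFlow T g') {e : OpenPartialHomeomorph M (Model m n)}
    (he : e ∈ atlas (Model m n) M) :
    ContinuousOn (fun q : ℝ × Model m n => chartEn e g g' q.1 q.2) (Icc 0 T ×ˢ e.target) :=
  ((hg.isLocalFlow he).smooth_locEn (hg'.isLocalFlow he) hT e.open_target).continuousOn

theorem continuousOn_chartEn_slice (hT : 0 < T) (hg : IsTransverseRicciFlow T g)
    (hg' : IsTransverseRicciFlow T g') {e : OpenPartialHomeomorph M (Model m n)}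
    (he : e ∈ atlas (Model m n) M) {t : ℝ} (ht : t ∈ Icc 0 T) :
    ContinuousOn (chartEn e g g' t) e.target :=
  (hg.isLocalFlow he).continuousOn_locEn (hg'.isLocalFlow he) hT e.open_target ht

/-- Near each point of a chart, the local energy in this chart is dominated by the one in any other
chart around the point. -/
theorem exists_nhds_lintegral_chartEn_le (hT : 0 < T) (hg : IsTransverseRicciFlow T g)
    (hg' : IsTransverseRicciFlow T g') {e e' : OpenPartialHomeomorph M (Model m n)}
    (he : e ∈ atlas (Model m n) M) (he' : e' ∈ atlas (Model m n) M) {z : Model m n}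
    (hz : z ∈ (e.symm ≫ₕ e').source) {W : Set (Model m n)} (hW : W ∈ 𝓝 ((e.symm ≫ₕ e') z)) :
    ∃ V ∈ 𝓝 z, ∃ C : ENNReal, C ≠ ⊤ ∧ ∀ t ∈ Icc 0 T,
      ∫⁻ x in V, ENNReal.ofReal (chartEn e g g' t x)
        ≤ C * ∫⁻ y in W, ENNReal.ofReal (chartEn e' g g' t y) := by
  set φ := e.symm ≫ₕ e' with hφ
  set ψ := e'.symm ≫ₕ e with hψ
  have hsymm : φ.symm = ψ := by
    rw [hφ, hψ, OpenPartialHomeomorph.trans_symm_eq_symm_trans_symm,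
      OpenPartialHomeomorph.symm_symm]
  have hsrc : ψ.source = φ.target := by rw [← hsymm]; rfl
  have hψφ : ∀ x ∈ φ.source, ψ (φ x) = x := fun x hx => by rw [← hsymm]; exact φ.left_inv hx
  have hφψ : ∀ x ∈ ψ.source, φ (ψ x) = x := fun x hx => by
    rw [← hsymm]; exact φ.right_inv (hsrc ▸ hx)
  have hψm : ∀ x ∈ ψ.source, ψ x ∈ φ.source := fun x hx => by
    rw [← hsymm]; exact φ.map_target (hsrc ▸ hx)
  have hw : φ z ∈ ψ.source := hsrc ▸ φ.map_source hz
  obtain ⟨ε, hε, hball⟩ := Metric.nhds_basis_closedBall.mem_iff.1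
    (Filter.inter_mem hW (ψ.open_source.mem_nhds hw))
  -- The compact set is chosen in the coordinates of `e'`, inside `W`. Its image under `ψ` is the
  -- neighbourhood of `z`, and the change of variables needs only a bound for the Jacobian of `ψ` on
  -- `N`.
  set N := Metric.closedBall (φ z) ε with hN
  have hNc : IsCompact N := isCompact_closedBall _ _
  have hNW : N ⊆ W := hball.trans inter_subset_left
  have hNs : N ⊆ ψ.source := hball.trans inter_subset_right
  have hψN : IsCompact (ψ '' N) := hNc.image_of_continuousOn (ψ.continuousOn.mono hNs)
  have hψNs : ψ '' N ⊆ φ.source := by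
    rintro _ ⟨x, hx, rfl⟩
    exact hψm x (hNs hx)
  obtain ⟨C, hC0, hC⟩ := exists_locEn_le hT hg hg' he he' hψN hψNs
  have hdet : ContinuousOn (fun x => (fderiv ℝ ψ x).det) N :=
    (ContinuousLinearMap.continuous_det.comp_continuousOn
      ((transition_mem he' he).1.continuousOn_fderiv_of_isOpen ψ.open_source (by simp))).mono hNs
  obtain ⟨D, hD⟩ := hNc.exists_bound_of_continuousOn hdet
  have hV : ψ '' N ∈ 𝓝 z := by
    have h := ψ.image_mem_nhds hw (Metric.closedBall_mem_nhds (φ z) hε)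
    rwa [hψφ z hz] at h
  refine ⟨ψ '' N, hV, ENNReal.ofReal D * ENNReal.ofReal C,
    ENNReal.mul_ne_top ENNReal.ofReal_ne_top ENNReal.ofReal_ne_top, fun t ht => ?_⟩
  rw [lintegral_image_eq_lintegral_abs_det_fderiv_mul volume hNc.measurableSet
    (fun x hx => (differentiableAt_transition he' he (hNs hx)).hasFDerivAt.hasFDerivWithinAt)
    (ψ.injOn.mono hNs)]
  calc ∫⁻ x in N, ENNReal.ofReal |(fderiv ℝ ψ x).det| * ENNReal.ofReal (chartEn e g g' t (ψ x))
      ≤ ∫⁻ x in N, ENNReal.ofReal D * ENNReal.ofReal C * ENNReal.ofReal (chartEn e' g g' t x) := by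
        refine setLIntegral_mono' hNc.measurableSet fun x hx => ?_
        rw [mul_assoc]
        gcongr
        · exact hD x hx
        · rw [← ENNReal.ofReal_mul hC0]
          have h := hC t ht (ψ x) (mem_image_of_mem _ hx)
          rw [hφψ x (hNs hx)] at h
          exact ENNReal.ofReal_le_ofReal h
    _ = ENNReal.ofReal D * ENNReal.ofReal C *
          ∫⁻ x in N, ENNReal.ofReal (chartEn e' g g' t x) :=
        lintegral_const_mul' _ _ (ENNReal.mul_ne_top ENNReal.ofReal_ne_top ENNReal.ofReal_ne_top)
    _ ≤ _ := by gcongr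

variable {ι : Type*} [Fintype ι] {e : ι → OpenPartialHomeomorph M (Model m n)}
  {σ : ι → Model m n → ℝ}

namespace IsCutoffCover

omit [Fintype ι] in
theorem integrable_sq_mul_chartEn (hσ : IsCutoffCover e σ) (hT : 0 < T)
    (hg : IsTransverseRicciFlow T g) (hg' : IsTransverseRicciFlow T g') (a : ι) {t : ℝ}
    (ht : t ∈ Icc 0 T) : Integrable fun z => σ a z ^ 2 * chartEn (e a) g g' t z :=
  integrable_cutoff_mul volume (e a).open_target ((hσ.smooth a).continuous.pow 2)
    ((hσ.compact a).mono' ((subset_tsupport _).trans (tsupport_sq_subset _)))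
    ((tsupport_sq_subset _).trans (hσ.tsupport_subset a))
    (continuousOn_chartEn_slice hT hg hg' (hσ.mem_atlas a) ht)

theorem ofReal_globalEn (hσ : IsCutoffCover e σ) (hT : 0 < T)
    (hg : IsTransverseRicciFlow T g) (hg' : IsTransverseRicciFlow T g') {t : ℝ}
    (ht : t ∈ Icc 0 T) :
    ENNReal.ofReal (globalEn e σ g g' t)
      = ∑ a, ∫⁻ z, ENNReal.ofReal (σ a z ^ 2 * chartEn (e a) g g' t z) := by
  rw [globalEn, ENNReal.ofReal_sum_of_nonneg fun a _ =>
    integral_nonneg fun z => mul_nonneg (sq_nonneg _) (locEn_nonneg _ _ _)]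
  refine Finset.sum_congr rfl fun a _ => ?_
  exact ofReal_integral_eq_lintegral_ofReal (hσ.integrable_sq_mul_chartEn hT hg hg' a ht)
    (Filter.Eventually.of_forall fun z => mul_nonneg (sq_nonneg _) (locEn_nonneg _ _ _))

/-- Near each point of the support some cutoff `σ b` equals 1 in its own chart, and there the energy
is dominated by the summand `b` of `globalEn`. Compactness of the support leaves finitely many such
neighbourhoods. -/
theorem exists_setIntegral_chartEn_le (hσ : IsCutoffCover e σ) (hT : 0 < T)
    (hg : IsTransverseRicciFlow T g) (hg' : IsTransverseRicciFlow T g') (a : ι) :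
    ∃ C, 0 ≤ C ∧ ∀ t ∈ Icc 0 T,
      ∫ z in tsupport (σ a), chartEn (e a) g g' t z ≤ C * globalEn e σ g g' t := by
  have key : ∃ C : ENNReal, C ≠ ⊤ ∧ ∀ t ∈ Icc 0 T,
      ∫⁻ z in tsupport (σ a), ENNReal.ofReal (chartEn (e a) g g' t z)
        ≤ C * ENNReal.ofReal (globalEn e σ g g' t) := by
    refine (hσ.compact a).isCompact.induction_on
      (p := fun s => ∃ C : ENNReal, C ≠ ⊤ ∧ ∀ t ∈ Icc 0 T,
        ∫⁻ z in s, ENNReal.ofReal (chartEn (e a) g g' t z)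
          ≤ C * ENNReal.ofReal (globalEn e σ g g' t)) ⟨0, by simp, by simp⟩ ?_ ?_ fun z hz => ?_
    · rintro s s' hss ⟨C, hC, h⟩
      exact ⟨C, hC, fun t ht => (lintegral_mono_set hss).trans (h t ht)⟩
    · rintro s s' ⟨C, hC, h⟩ ⟨C', hC', h'⟩
      refine ⟨C + C', ENNReal.add_ne_top.2 ⟨hC, hC'⟩, fun t ht => ?_⟩
      rw [add_mul]
      exact (lintegral_union_le _ _ _).trans (add_le_add (h t ht) (h' t ht))
    · have hzt := hσ.tsupport_subset a hz
      obtain ⟨b, hb, hev⟩ := hσ.cover ((e a).symm z)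
      have hzs : z ∈ ((e a).symm ≫ₕ e b).source := by simp [hzt, hb]
      obtain ⟨V, hV, C, hC, h⟩ := exists_nhds_lintegral_chartEn_le hT hg hg' (hσ.mem_atlas a)
        (hσ.mem_atlas b) hzs (W := interior {w | σ b w = 1}) (interior_mem_nhds.2 hev)
      refine ⟨V, mem_nhdsWithin_of_mem_nhds hV, C, hC, fun t ht => (h t ht).trans ?_⟩
      gcongr
      rw [hσ.ofReal_globalEn hT hg hg' ht]
      refine le_trans ?_ (Finset.single_le_sum (fun _ _ => zero_le) (Finset.mem_univ b))
      refine le_trans (le_of_eq ?_) (setLIntegral_le_lintegral (interior {w | σ b w = 1}) _)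
      refine setLIntegral_congr_fun isOpen_interior.measurableSet fun w hw => ?_
      have : w ∈ {w | σ b w = 1} := interior_subset hw
      rw [mem_ofPred_eq] at this
      simp [this]
  obtain ⟨C, hC, h⟩ := key
  refine ⟨C.toReal, ENNReal.toReal_nonneg, fun t ht => ?_⟩
  have hE : 0 ≤ globalEn e σ g g' t := Finset.sum_nonneg fun a _ =>
    integral_nonneg fun z => mul_nonneg (sq_nonneg _) (locEn_nonneg _ _ _)
  rw [← ENNReal.ofReal_le_ofReal_iff (mul_nonneg ENNReal.toReal_nonneg hE),
    ENNReal.ofReal_mul ENNReal.toReal_nonneg, ENNReal.ofReal_toReal hC,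
    ofReal_integral_eq_lintegral_ofReal _ (Filter.Eventually.of_forall fun z => locEn_nonneg _ _ _)]
  · exact h t ht
  · exact ((continuousOn_chartEn_slice hT hg hg' (hσ.mem_atlas a) ht).mono
      (hσ.tsupport_subset a)).integrableOn_compact (hσ.compact a).isCompact

theorem exists_globalEn_deriv_le (hσ : IsCutoffCover e σ) (hT : 0 < T)
    (hg : IsTransverseRicciFlow T g) (hg' : IsTransverseRicciFlow T g') :
    ∃ C, ∀ t ∈ Ioo 0 T, ∃ E',
      HasDerivAt (globalEn e σ g g') E' t ∧ E' ≤ C * globalEn e σ g g' t := by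
  choose A hA0 hA using fun a => (hg.isLocalFlow (hσ.mem_atlas a)).exists_energy_deriv_le
    (hg'.isLocalFlow (hσ.mem_atlas a)) hT (e a).open_target (hσ.smooth a) (hσ.compact a)
    (hσ.tsupport_subset a)
  choose B hB0 hB using hσ.exists_setIntegral_chartEn_le hT hg hg'
  refine ⟨∑ a, A a * B a, fun t ht => ?_⟩
  choose E' hd hE using fun a => hA a t ht
  refine ⟨∑ a, E' a, HasDerivAt.fun_sum fun a _ => hd a, ?_⟩
  rw [Finset.sum_mul]
  refine Finset.sum_le_sum fun a _ => (hE a).trans ?_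
  rw [mul_assoc]
  exact mul_le_mul_of_nonneg_left (hB a t (Ioo_subset_Icc_self ht)) (hA0 a)

theorem continuousOn_globalEn (hσ : IsCutoffCover e σ) (hT : 0 < T)
    (hg : IsTransverseRicciFlow T g) (hg' : IsTransverseRicciFlow T g') :
    ContinuousOn (globalEn e σ g g') (Icc 0 T) :=
  continuousOn_finsetSum _ fun a _ =>
    continuousOn_integral_cutoff_mul volume (e a).open_target ((hσ.smooth a).continuous.pow 2)
      ((hσ.compact a).mono' ((subset_tsupport _).trans (tsupport_sq_subset _)))
      ((tsupport_sq_subset _).trans (hσ.tsupport_subset a))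
      (continuousOn_chartEn hT hg hg' (hσ.mem_atlas a))

theorem globalEn_eq_zero (hσ : IsCutoffCover e σ) (hT : 0 < T)
    (hg : IsTransverseRicciFlow T g) (hg' : IsTransverseRicciFlow T g') (h0 : g 0 = g' 0) {t : ℝ}
    (ht : t ∈ Icc 0 T) : globalEn e σ g g' t = 0 := by
  have hE0 : globalEn e σ g g' 0 = 0 := by
    simp [globalEn, chartEn, locEn, h0]
  have hE : 0 ≤ globalEn e σ g g' t := Finset.sum_nonneg fun a _ =>
    integral_nonneg fun z => mul_nonneg (sq_nonneg _) (locEn_nonneg _ _ _)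
  obtain ⟨C, hC⟩ := hσ.exists_globalEn_deriv_le hT hg hg'
  choose! E' hd hle using hC
  -- Grönwall's inequality by an integrating factor. The differential inequality is needed only at
  -- interior times, because the energy is continuous on the closed interval.
  have hanti : AntitoneOn (fun s => Real.exp (-C * s) * globalEn e σ g g' s) (Icc 0 T) := by
    refine antitoneOn_of_hasDerivWithinAt_nonpos (convex_Icc 0 T)
      (f' := fun s => Real.exp (-C * s) * (-C) * globalEn e σ g g' s + Real.exp (-C * s) * E' s)
      (ContinuousOn.mul (by fun_prop) (hσ.continuousOn_globalEn hT hg hg')) ?_ ?_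
    · intro s hs
      rw [interior_Icc] at hs
      have h1 : HasDerivAt (fun s => Real.exp (-C * s)) (Real.exp (-C * s) * (-C)) s := by
        simpa using ((hasDerivAt_id s).const_mul (-C)).exp
      exact (h1.mul (hd s hs)).hasDerivWithinAt
    · intro s hs
      rw [interior_Icc] at hs
      nlinarith [mul_le_mul_of_nonneg_left (hle s hs) (Real.exp_pos (-C * s)).le]
  have h := hanti ⟨le_rfl, hT.le⟩ ht ht.1
  simp only [hE0, mul_zero] at h
  exact le_antisymm (nonpos_of_mul_nonpos_right h (Real.exp_pos _)) hE

/-- The summands of the vanishing energy are integrals of nonnegative continuous functions, so each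
integrand vanishes everywhere and not just almost everywhere. -/
theorem metricIn_eq (hσ : IsCutoffCover e σ) (hT : 0 < T)
    (hg : IsTransverseRicciFlow T g) (hg' : IsTransverseRicciFlow T g') (h0 : g 0 = g' 0) {t : ℝ}
    (ht : t ∈ Icc 0 T) {a : ι} {z : Model m n} (hz : σ a z = 1) :
    metricIn (e a) (g t) z = metricIn (e a) (g' t) z := by
  have hnn : ∀ a z, 0 ≤ σ a z ^ 2 * chartEn (e a) g g' t z :=
    fun a z => mul_nonneg (sq_nonneg _) (locEn_nonneg _ _ _)
  have h1 := (Finset.sum_eq_zero_iff_of_nonneg fun a _ => integral_nonneg (hnn a)).1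
    (hσ.globalEn_eq_zero hT hg hg' h0 ht) a (Finset.mem_univ a)
  have hcont : Continuous fun z => σ a z ^ 2 * chartEn (e a) g g' t z :=
    continuous_mul_of_tsupport_subset (e a).open_target ((hσ.smooth a).continuous.pow 2)
      ((tsupport_sq_subset _).trans (hσ.tsupport_subset a))
      (continuousOn_chartEn_slice hT hg hg' (hσ.mem_atlas a) ht)
  have h2 := (integral_eq_zero_iff_of_nonneg (hnn a)
    (hσ.integrable_sq_mul_chartEn hT hg hg' a ht)).1 h1
  have h3 := congrFun ((hcont.ae_eq_iff_eq volume continuous_zero).1 h2) z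
  have h4 : chartEn (e a) g g' t z = 0 := by simpa [hz] using h3
  ext i j
  have h5 := abs_metric_sub_le (metricIn (e a) (g t)) (metricIn (e a) (g' t)) z i j
  rw [show locEn (metricIn (e a) (g t)) (metricIn (e a) (g' t)) z = 0 from h4,
    Real.sqrt_zero] at h5
  exact sub_eq_zero.1 (abs_nonpos_iff.1 h5)

end IsCutoffCover

theorem chartSymmDeriv_surjective {e : OpenPartialHomeomorph M (Model m n)}
    (he : e ∈ atlas (Model m n) M) {z : Model m n} (hz : z ∈ e.target) :
    Function.Surjective (chartSymmDeriv e z) := by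
  rw [chartSymmDeriv_eq_fderiv he hz]
  refine LinearMap.surjective_of_injective
    (f := (fderiv ℝ (e.symm ≫ₕ chartAt (Model m n) (e.symm z)) z : Model m n →ₗ[ℝ] Model m n)) ?_
  exact Function.LeftInverse.injective (g := fderiv ℝ
    ((chartAt (Model m n) (e.symm z)).symm ≫ₕ e)
      ((e.symm ≫ₕ chartAt (Model m n) (e.symm z)) z)) fun v =>
    fderiv_transition_comp he (chart_mem_atlas (Model m n) (e.symm z))
      (mem_transition_chartAt hz) v

/-- The chart derivative is onto the tangent space, and both forms have the leaf directions in their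
kernel, so the transverse components determine them. -/
theorem eq_of_metricIn_eq {e : OpenPartialHomeomorph M (Model m n)}
    (he : e ∈ atlas (Model m n) M) {g g' : BilinField m n M} (hg : IsTransverseMetric g)
    (hg' : IsTransverseMetric g') {p : M} (hp : p ∈ e.source)
    (h : metricIn e g (e p) = metricIn e g' (e p)) : g p = g' p := by
  have hz := e.map_source hp
  have hpp := e.left_inv hp
  have key : ∀ u v : Model m n, g (e.symm (e p)) u v = g' (e.symm (e p)) u v := by
    intro u v
    obtain ⟨u, rfl⟩ := chartSymmDeriv_surjective he hz u
    obtain ⟨v, rfl⟩ := chartSymmDeriv_surjective he hz v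
    change bilinIn e g (e p) u v = bilinIn e g' (e p) u v
    rw [bilinIn_eq_sum he hg hz, bilinIn_eq_sum he hg' hz, h]
  refine ContinuousLinearMap.ext fun u => ContinuousLinearMap.ext fun v => ?_
  have h1 := key u v
  exact ((bilin_congr g hpp u v).symm.trans h1).trans (bilin_congr g' hpp u v)

/-- Uniqueness for the transverse Ricci flow on a compact foliated manifold. -/
theorem IsTransverseRicciFlow.eq_of_initial_eq [CompactSpace M] (hT : 0 < T)
    (hg : IsTransverseRicciFlow T g) (hg' : IsTransverseRicciFlow T g') (h0 : g 0 = g' 0) {t : ℝ}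
    (ht : t ∈ Icc 0 T) : g t = g' t := by
  obtain ⟨s, e, σ, hσ⟩ := exists_isCutoffCover m n M
  funext p
  obtain ⟨a, hp, hev⟩ := hσ.cover p
  exact eq_of_metricIn_eq (hσ.mem_atlas a) (hg.metric t ht) (hg'.metric t ht) hp
    (hσ.metricIn_eq hT hg hg' h0 ht hev.self_of_nhds)

end GlobalEnergy

/-! ### The energy density of a metric compared with itself. -/

section EnergyOfEqual

variable {m n : ℕ} {M : Type*} [TopologicalSpace M] [ChartedSpace (Model m n) M]

theorem energyDensity_self (g : BilinField m n M) : energyDensity g g = 0 := by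
  funext p
  simp [energyDensity, hNormSq, aNormSq, sNormSq, covNormSq, mixNormSq]

end EnergyOfEqual

end TransverseRicci

end

/-! ### The theorem, deduced from uniqueness. -/

theorem mainTheorem7 (n : ℕ) (K : ℝ) :
    ∃ C₀ : ℝ, ∀ (m : ℕ) (M : Type*) [TopologicalSpace M] [T2Space M] [CompactSpace M]
      [ChartedSpace (TransverseRicci.Model m n) M]
      [HasGroupoid M (TransverseRicci.foliationGroupoid m n)]
      [MeasurableSpace M] [BorelSpace M]
      (χ : TransverseRicci.LeafFormField m n M) (T : ℝ)
      (g g' : ℝ → TransverseRicci.BilinField m n M),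
      TransverseRicci.IsHomologicalOrientation χ →
      0 < T →
      TransverseRicci.IsTransverseRicciFlow T g →
      TransverseRicci.IsTransverseRicciFlow T g' →
      g 0 = g' 0 →
      TransverseRicci.CurvatureBound K T g →
      TransverseRicci.CurvatureBound K T g' →
      (∀ t ∈ Set.Icc 0 T,
        MeasureTheory.Integrable (TransverseRicci.energyDensity (g t) (g' t))
            (TransverseRicci.volumeMeasure χ (g t)) ∧
          ∃ E' : ℝ,
            HasDerivWithinAt (TransverseRicci.energy χ g g') E' (Set.Icc 0 T) t ∧
              E' ≤ C₀ * TransverseRicci.energy χ g g' t) ∧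
        (∀ t ∈ Set.Icc 0 T, TransverseRicci.energy χ g g' t = 0) ∧
        ∀ t ∈ Set.Icc 0 T, g t = g' t := by
  -- The energy turns out to be identically zero, so its derivative is 0 and the constant 0
  -- suffices.
  refine ⟨0, fun m M _ _ _ _ _ _ _ χ T g g' _ hT hg hg' h0 _ _ => ?_⟩
  have heq : ∀ t ∈ Set.Icc 0 T, g t = g' t := fun t ht => hg.eq_of_initial_eq hT hg' h0 ht
  have hE : ∀ t ∈ Set.Icc 0 T, TransverseRicci.energy χ g g' t = 0 := fun t ht => by
    simp [TransverseRicci.energy, heq t ht, TransverseRicci.energyDensity_self]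
  refine ⟨fun t ht => ⟨?_, 0, ?_, by simp⟩, hE, heq⟩
  -- The density is the zero function, hence integrable for every measure.
  · rw [heq t ht, TransverseRicci.energyDensity_self]
    exact MeasureTheory.integrable_zero _ _ _
  · exact (hasDerivWithinAt_const t (Set.Icc 0 T) (0 : ℝ)).congr hE (hE t ht)
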